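/- Let $g>0$. Consider the shallow water system $\partial_t h+\partial_x(hu)=0$, $\partial_t(hu)+\partial_x\big(h(u^2+\tfrac{gh}{2})\big)+gh\,\partial_x a=0$, $\partial_t a=0$ for states $U=(h,u,a)$, with Riemann data $U_L=(h_L,u_L,a_L)$ for $x<0$ and $U_R=(h_R,u_R,a_R)$ for $x>0$, $h_L,h_R>0$. Let $\lambda_1=u-\sqrt{gh}$, $\lambda_2=u+\sqrt{gh}$; for $h>0$ put $G_1=\{\lambda_1>0\}$, $G_2=\{\lambda_1<0<\lambda_2\}$, $G_2^-=G_2\cap\{u\le 0\}$, $\mathcal C_\pm=\{u=\pm\sqrt{gh}\}$, $\bar G_2=\{\lambda_1\le 0\le\lambda_2\}$. **Waves and solutions.** Put $\sigma(h,h_0)=\sqrt{g/2}\,(h-h_0)\sqrt{1/h+1/h_0}$ and $\rho(h,h_0)=2\sqrt g(\sqrt h-\sqrt{h_0})$. A left state $U_0$ and a right state $U$ with $a=a_0$ are joined by: a 1-shock if $0<h_0<h$, $u-u_0+\sigma(h,h_0)=0$; a 2-shock if $0<h<h_0$, $u-u_0-\sigma(h,h_0)=0$; a 1-rarefaction if $0\le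 h\le h_0$, $h_0>0$, $u-u_0+\rho(h,h_0)=0$; a 2-rarefaction if $0\le h_0\le h$, $h>0$, $u-u_0-\rho(h,h_0)=0$; a dry zone if $h=h_0=0$ and $u_0\le u$. Shocks travel with speed $\bar\lambda(U_0,U)=\frac{hu-h_0u_0}{h-h_0}$; an $i$-rarefaction occupies the speeds from $\lambda_i(U_0)$ to $\lambda_i(U)$; a dry zone those from $u_0$ to $u$. States $U_0,U$ with $h_0,h>0$ are joined by a stationary contact (speed $0$) if $hu=h_0u_0$ and $a=A(h)$, where $A(x)=a_0+\frac{1}{2g}\big(u_0^2-(h_0u_0/x)^2\big)+h_0-x$, and $A$ is monotone on the interval between $h_0$ and $h$. A *solution* of the Riemann problem is a self-similar function $U(x,t)=v(x/t)$ consisting of finitely many such waves, arranged by nondecreasing speed, leading from $U_L$ to $U_R$, constant between consecutive waves, such that the total variation of $a$ over its waves is at most $|a_L-a_R|$. Two solutions are identified if $h$, $hu$ and $a$ agree almost everywhere. **Curves and states.** The curve $\mathcal W_1(U_L)$ is the set of $U$ with $h>0$, $a=a_L$ and $u-u_L+\sigma(h,h_L)=0$ if $h>h_L$, $u-u_L+\rho(h,h_L)=0$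 if $h\le h_L$. Let $\Phi_2(U;U_R)=u-u_R-\sigma(h,h_R)$ if $h>h_R$, and $\Phi_2(U;U_R)=u-u_R-\rho(h,h_R)$ if $h\le h_R$. The curve $\mathcal W_2^B(U_R)$ is $\{\Phi_2(\cdot\,;U_R)=0\}$; a state $U$ lies above (on, below) it if $\Phi_2(U;U_R)$ is positive (zero, negative). The set $\mathcal W_1^a(U_L)$ consists of the states at level $a_R$ that are reached by a stationary contact from some $U\in\mathcal W_1(U_L)$ with $\lambda_1(U)\le0$. The states $K\in\mathcal W_1(U_L)\cap\bar G_2$ and $K^o\in\bar G_2$, where $K^o$ has level $a_R$ and is reached from $K$ by a stationary contact, are determined by $K\in\mathcal C_-$ if $a_L\ge a_R$ and by $K^o\in\mathcal C_-$ if $a_L<a_R$ (in the latter case they need not exist). If $a_L>a_R$, let $U_1\in\mathcal W_1(U_L)\cap\mathcal C_+$, and let $U_1^o\in G_2$ and $U_2\in G_1$ be the states at level $a_R$ reached from $U_1$ by stationary contacts; let $U_2^\#=(h_2^\#,\,u_2h_2/h_2^\#,\,a_R)$ with $h_2^\#=\tfrac12\big(-h_2+\sqrt{h_2^2+8h_2u_2^2/g}\big)$,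 and let $h_1^o$ be the height of $U_1^o$. **Theorem.** Let $U_L\in G_2$. (a) *Existence.* The Riemann problem has a solution if $K$ and $K^o$ exist, $K^o$ lies below or on $\mathcal W_2^B(U_R)$, and, for every $M\in\mathcal W_2^B(U_R)\cap\mathcal W_1^a(U_L)\cap G_2^-$ such that the 2-wave from $M$ to $U_R$ is a shock (i.e. $h_R<h_M$), $\bar\lambda(M,U_R)\ge0$. (b) *Uniqueness.* Let $U_R\in G_1\cup\mathcal C_+\cup G_2$. The Riemann problem has at most one solution if one of the following holds: $a_L\le a_R$; or $a_L>a_R$ and $h_1^o\ge h_2^\#$; or $a_L>a_R$, $h_1^o<h_2^\#$, and $U_1^o$ and $U_2^\#$ lie (strictly) on the same side of $\mathcal W_2^B(U_R)$. (c) *Multiple solutions.* If $a_L>a_R$, $h_1^o<h_2^\#$, $U_1^o$ lies above $\mathcal W_2^B(U_R)$ and $U_2^\#$ lies below $\mathcal W_2^B(U_R)$, then the Riemann problem has exactly three solutions. -/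

import Mathlib

noncomputable section

namespace ShallowWater

/-- A state `(h, u, a)`: water height, velocity, bottom level.  Only differences of bottom levels
matter, so `a` may be any real number. -/
@[ext] structure State where
  h : ℝ
  u : ℝ
  a : ℝ

/-- First characteristic speed `u - √(g h)`. -/
def lam1 (g : ℝ) (U : State) : ℝ := U.u - √(g * U.h)

/-- Second characteristic speed `u + √(g h)`. -/
def lam2 (g : ℝ) (U : State) : ℝ := U.u + √(g * U.h)

/-- Supercritical states: both characteristic speeds positive. -/
def G1 (g : ℝ) : Set State := {U | 0 < U.h ∧ 0 < lam1 g U}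

/-- Subcritical states: the third characteristic speed `0` lies strictly between the others. -/
def G2 (g : ℝ) : Set State := {U | 0 < U.h ∧ lam1 g U < 0 ∧ 0 < lam2 g U}

/-- Subcritical states with `u ≤ 0`. -/
def G2minus (g : ℝ) : Set State := {U | U ∈ G2 g ∧ U.u ≤ 0}

/-- `G2` with its boundary (away from `h = 0`). -/
def G2closed (g : ℝ) : Set State := {U | 0 < U.h ∧ lam1 g U ≤ 0 ∧ 0 ≤ lam2 g U}

/-- The resonance surface `u = √(g h)`. -/
def CPlus (g : ℝ) : Set State := {U | 0 < U.h ∧ U.u = √(g * U.h)}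

/-- The resonance surface `u = -√(g h)`. -/
def CMinus (g : ℝ) : Set State := {U | 0 < U.h ∧ U.u = -√(g * U.h)}

/-! ### Elementary waves -/

/-- `√(g/2) (h - h₀) √(1/h + 1/h₀)`: the velocity jump across a shock between two heights. -/
def shockJump (g h h₀ : ℝ) : ℝ := √(g / 2) * (h - h₀) * √(1 / h + 1 / h₀)

/-- `2 √g (√h - √h₀)`: the velocity change along a rarefaction between two heights. -/
def rareJump (g h h₀ : ℝ) : ℝ := 2 * √g * (√h - √h₀)

/-- Speed of a shock between `U` and `V` (first Rankine-Hugoniot relation); used only when the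
heights differ. -/
def shockSpeed (U V : State) : ℝ := (V.h * V.u - U.h * U.u) / (V.h - U.h)

/-- The state on the left of a Lax 1-shock is `U`, the one on the right is `V`. -/
def IsShock1 (g : ℝ) (U V : State) : Prop :=
  0 < U.h ∧ U.h < V.h ∧ V.a = U.a ∧ V.u - U.u + shockJump g V.h U.h = 0

/-- The state on the left of a Lax 2-shock is `U`, the one on the right is `V`. -/
def IsShock2 (g : ℝ) (U V : State) : Prop :=
  0 < V.h ∧ V.h < U.h ∧ V.a = U.a ∧ V.u - U.u - shockJump g V.h U.h = 0

/-- 1-rarefaction from `U` (left) to `V` (right); it may end at a dry state `V.h = 0`. -/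
def IsRare1 (g : ℝ) (U V : State) : Prop :=
  0 < U.h ∧ 0 ≤ V.h ∧ V.h ≤ U.h ∧ V.a = U.a ∧ V.u - U.u + rareJump g V.h U.h = 0

/-- 2-rarefaction from `U` (left) to `V` (right); it may start at a dry state `U.h = 0`. -/
def IsRare2 (g : ℝ) (U V : State) : Prop :=
  0 < V.h ∧ 0 ≤ U.h ∧ U.h ≤ V.h ∧ V.a = U.a ∧ V.u - U.u - rareJump g V.h U.h = 0

/-- The bottom level, as a function of the height, along the stationary curve through `U₀`. -/
def bottomAlong (g : ℝ) (U₀ : State) (x : ℝ) : ℝ :=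
  U₀.a + (U₀.u ^ 2 - (U₀.h * U₀.u / x) ^ 2) / (2 * g) + U₀.h - x

/-- Stationary contact from `U` (left) to `V` (right): `h u` and `u²/2 + g (h + a)` are the same on
both sides, and the bottom level is monotone in the height along the part of the stationary curve
that is used (first half of the monotonicity criterion). -/
def IsContact (g : ℝ) (U V : State) : Prop :=
  0 < U.h ∧ 0 < V.h ∧ V.h * V.u = U.h * U.u ∧ V.a = bottomAlong g U V.h ∧
    (MonotoneOn (bottomAlong g U) (Set.uIcc U.h V.h) ∨
      AntitoneOn (bottomAlong g U) (Set.uIcc U.h V.h))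

/-- Dry zone between the dry states `U` (left) and `V` (right). -/
def IsDryZone (U V : State) : Prop :=
  U.h = 0 ∧ V.h = 0 ∧ V.a = U.a ∧ U.u ≤ V.u

inductive WaveKind
  | shock1
  | shock2
  | rare1
  | rare2
  | contact
  | dry

/-- `U` (left) and `V` (right) are connected by a wave of the given kind. -/
def IsWave (g : ℝ) : WaveKind → State → State → Prop
  | .shock1, U, V => IsShock1 g U V
  | .shock2, U, V => IsShock2 g U V
  | .rare1, U, V => IsRare1 g U V
  | .rare2, U, V => IsRare2 g U V
  | .contact, U, V => IsContact g U V
  | .dry, U, V => IsDryZone U V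

/-- Speed of the left edge of a wave. -/
def speedLeft (g : ℝ) : WaveKind → State → State → ℝ
  | .shock1, U, V => shockSpeed U V
  | .shock2, U, V => shockSpeed U V
  | .rare1, U, _ => lam1 g U
  | .rare2, U, _ => lam2 g U
  | .contact, _, _ => 0
  | .dry, U, _ => U.u

/-- Speed of the right edge of a wave. -/
def speedRight (g : ℝ) : WaveKind → State → State → ℝ
  | .shock1, U, V => shockSpeed U V
  | .shock2, U, V => shockSpeed U V
  | .rare1, _, V => lam1 g V
  | .rare2, _, V => lam2 g V
  | .contact, _, _ => 0
  | .dry, _, V => V.u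

/-- The value `W` taken at `x / t = ξ` strictly between the edges of a wave starting at `U`.
(Shocks and contacts have no interior; in a dry zone the velocity carries no information.) -/
def InFan (g : ℝ) : WaveKind → State → ℝ → State → Prop
  | .shock1, _, _, _ => True
  | .shock2, _, _, _ => True
  | .rare1, U, ξ, W => IsRare1 g U W ∧ lam1 g W = ξ
  | .rare2, U, ξ, W => IsRare2 g U W ∧ lam2 g W = ξ
  | .contact, _, _, _ => True
  | .dry, U, _, W => W.h = 0 ∧ W.a = U.a

/-! ### Solutions of the Riemann problem -/

/-- The profile `v` (the self-similar function `(x, t) ↦ v (x / t)`, `t > 0`) consists of the `n`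
waves of kinds `k 0, …, k (n - 1)` separating the states `UL = U 0, U 1, …, U n = UR`. -/
structure IsWavePattern (g : ℝ) (UL UR : State) (n : ℕ) (U : ℕ → State) (k : ℕ → WaveKind)
    (v : ℝ → State) : Prop where
  start : U 0 = UL
  finish : U n = UR
  wave : ∀ i < n, IsWave g (k i) (U i) (U (i + 1))
  /-- The waves are arranged by increasing speed. -/
  ordered : ∀ i, i + 1 < n →
    speedRight g (k i) (U i) (U (i + 1)) ≤ speedLeft g (k (i + 1)) (U (i + 1)) (U (i + 2))
  /-- Second half of the monotonicity criterion: the total variation of the bottom level. -/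
  variation : ∑ i ∈ Finset.range n, |(U (i + 1)).a - (U i).a| ≤ |UR.a - UL.a|
  /-- Between two consecutive waves the profile is constant. -/
  const : ∀ i ≤ n, ∀ ξ : ℝ,
    (∀ j, j + 1 = i → speedRight g (k j) (U j) (U (j + 1)) < ξ) →
    (i < n → ξ < speedLeft g (k i) (U i) (U (i + 1))) → v ξ = U i
  /-- Inside a wave the profile is the corresponding fan. -/
  fan : ∀ i < n, ∀ ξ : ℝ, speedLeft g (k i) (U i) (U (i + 1)) < ξ →
    ξ < speedRight g (k i) (U i) (U (i + 1)) → InFan g (k i) (U i) ξ (v ξ)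

/-- `v` is the profile of a solution of the Riemann problem with data `UL`, `UR`. -/
def IsRiemannSolution (g : ℝ) (UL UR : State) (v : ℝ → State) : Prop :=
  ∃ (n : ℕ) (U : ℕ → State) (k : ℕ → WaveKind), IsWavePattern g UL UR n U k v

/-- Two profiles are the same solution: `h`, `h u` and `a` agree almost everywhere. -/
def SameSolution (v w : ℝ → State) : Prop :=
  ∀ᵐ ξ ∂(MeasureTheory.volume : MeasureTheory.Measure ℝ),
    (v ξ).h = (w ξ).h ∧ (v ξ).h * (v ξ).u = (w ξ).h * (w ξ).u ∧ (v ξ).a = (w ξ).a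

/-- The Riemann problem has at most one solution. -/
def AtMostOneSolution (g : ℝ) (UL UR : State) : Prop :=
  ∀ v w, IsRiemannSolution g UL UR v → IsRiemannSolution g UL UR w → SameSolution v w

/-- The Riemann problem has exactly three solutions. -/
def ThreeSolutions (g : ℝ) (UL UR : State) : Prop :=
  ∃ v₁ v₂ v₃, IsRiemannSolution g UL UR v₁ ∧ IsRiemannSolution g UL UR v₂ ∧
    IsRiemannSolution g UL UR v₃ ∧
    ¬ SameSolution v₁ v₂ ∧ ¬ SameSolution v₁ v₃ ∧ ¬ SameSolution v₂ v₃ ∧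
    ∀ w, IsRiemannSolution g UL UR w →
      SameSolution w v₁ ∨ SameSolution w v₂ ∨ SameSolution w v₃

/-! ### Wave curves in the `(h, u)`-plane and the distinguished states -/

/-- `Ψ₁(V; U₀)`, whose zero set is the forward 1-wave curve of `U₀`. -/
def Psi1 (g : ℝ) (V U₀ : State) : ℝ :=
  V.u - U₀.u + if U₀.h < V.h then shockJump g V.h U₀.h else rareJump g V.h U₀.h

/-- `Φ₂(V; U₀)`, whose zero set is the backward 2-wave curve of `U₀`; the state `V` lies above
(below) that curve when `Φ₂(V; U₀)` is positive (negative). -/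
def Phi2 (g : ℝ) (V U₀ : State) : ℝ :=
  V.u - U₀.u - if U₀.h < V.h then shockJump g V.h U₀.h else rareJump g V.h U₀.h

/-- The forward 1-wave curve of `U₀`, at the bottom level of `U₀`. -/
def W1 (g : ℝ) (U₀ : State) : Set State := {V | 0 < V.h ∧ V.a = U₀.a ∧ Psi1 g V U₀ = 0}

/-- The composite curve: states at level `aR` reached by a stationary contact from a state `U` of
the forward 1-wave curve of `UL` with nonpositive first characteristic speed. -/
def W1a (g : ℝ) (UL : State) (aR : ℝ) : Set State :=
  {V | V.a = aR ∧ ∃ U ∈ W1 g UL, lam1 g U ≤ 0 ∧ IsContact g U V}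

/-- `K` is the lower limit state on the forward 1-wave curve of `UL`, and `Ko` (the state written
`K^o`) results from `K` by a subcritical stationary contact to the level `aR`: if `aR ≤ UL.a` then
`K` lies on `CMinus`, and if `UL.a < aR` then `Ko` lies on `CMinus`. -/
def IsLowerState (g : ℝ) (UL : State) (aR : ℝ) (K Ko : State) : Prop :=
  K ∈ W1 g UL ∧ K ∈ G2closed g ∧ IsContact g K Ko ∧ Ko.a = aR ∧ Ko ∈ G2closed g ∧
    (aR ≤ UL.a → K ∈ CMinus g) ∧ (UL.a < aR → Ko ∈ CMinus g)

/-- The states `U₁`, `U₁^o`, `U₂` (for `aR < UL.a`): `U₁` is where the forward 1-wave curve of `UL`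
meets `CPlus`; stationary contacts from `U₁` to the level `aR` lead to `U₁^o` in `G2` and to `U₂`
in `G1`. -/
def AreUpperStates (g : ℝ) (UL : State) (aR : ℝ) (U₁ U₁o U₂ : State) : Prop :=
  U₁ ∈ W1 g UL ∧ U₁ ∈ CPlus g ∧
    IsContact g U₁ U₁o ∧ U₁o.a = aR ∧ U₁o ∈ G2 g ∧
    IsContact g U₁ U₂ ∧ U₂.a = aR ∧ U₂ ∈ G1 g

/-- The height `h^#`. -/
def sharpHeight (g : ℝ) (U : State) : ℝ :=
  (-U.h + √(U.h ^ 2 + 8 * U.h * U.u ^ 2 / g)) / 2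

/-- The state `U^#` reached from `U` by a 1-shock of zero speed. -/
def sharp (g : ℝ) (U : State) : State :=
  ⟨sharpHeight g U, U.u * U.h / sharpHeight g U, U.a⟩

end ShallowWater

end

noncomputable section

namespace ShallowWater

/-! ### Celerity and the velocity jumps -/

/-! Written in the celerity c = √(gh), both wave curves become explicit, and along a forward 1-wave
curve u falls at least twice as fast as c rises (`jump_steep`), with equality on rarefactions. So
forward 1-wave curves fall and backward 2-wave curves rise in the (h,u)-plane, they meet at most
once, and a pattern without contacts between wet states is determined by its end states, up to
finitely many speeds (`Arranged.classical`, `Arranged.classical_unique`). A stationary contact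
amounts to equal discharge hu, equal head u²/2 + g(h+a), and both states on the same side of
criticality u² = gh. The reflection x ↦ -x exchanges the two wave families and turns a rising bottom
into a falling one.

Uniqueness. Over a strictly falling bottom a solution is cut at speed zero into a left state X,
zero-speed waves, and a right state Y. `Chain.classify` and `IsRiemannSolution.exists_split` leave
three kinds of middle part: a subcritical flow without loss of head, a flow from C₊ through a
stationary 1-shock to a subcritical state, and a flow from C₊ to a supercritical jet. Discharge and
energy vary in opposite senses among the possible X (`LeftState.trichotomy`) but in the same sense
along the backward 2-wave curve (`W2_compare`), while zero-speed waves keep the discharge and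
lossless ones shift the energy by a constant. Hence two different solutions are incompatible; pairs
involving a stationary shock or a jet need in addition that shocks dissipate energy
(`SplitType.eq`). The argument uses only λ₁(U_L) < 0 < λ₂(U_R), so it covers every alternative of
(b).

Existence. Over a falling bottom the composite curve has three arcs: contacts from subcritical
states of the 1-wave curve, a zero-speed shock between two contacts, and 1-waves behind a
supercritical contact. Its lower end K^o lies below or on the backward 2-wave curve, so an
intermediate value argument on the right arc gives an intersection, or the jet runs dry
(`joined_of_lower_state`). Over a rising bottom the existence of K^o says that water at rest at the
higher level lies below the 1-wave curve (`rest_lt_of_lower_state`), and the reflected problem is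
solved by `joined_of_rest`.

Multiplicity. U₁^o has the energy of U₂, whereas U₂^# has lost energy in a shock. Both are
subcritical with the same discharge, so h₁^o > h₂^# always (`AreUpperStates.sharp_lt`): the
hypotheses of (c) are contradictory and (c) holds vacuously. -/

/-- The celerity `√(g h)`. -/
def cel (g h : ℝ) : ℝ := √(g * h)

/-- The velocity change along the backward 2-wave curve of a state of height `h₀`. -/
def jump (g h h₀ : ℝ) : ℝ := if h₀ < h then shockJump g h h₀ else rareJump g h h₀

/-- Root mean square of the celerities of two heights. -/
def celMean (g h h₀ : ℝ) : ℝ := √((cel g h ^ 2 + cel g h₀ ^ 2) / 2)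

theorem lam1_eq (g : ℝ) (U : State) : lam1 g U = U.u - cel g U.h := rfl

theorem lam2_eq (g : ℝ) (U : State) : lam2 g U = U.u + cel g U.h := rfl

theorem Psi1_eq (g : ℝ) (V U : State) : Psi1 g V U = V.u - U.u + jump g V.h U.h := rfl

theorem Phi2_eq (g : ℝ) (V U : State) : Phi2 g V U = V.u - U.u - jump g V.h U.h := rfl

theorem cel_nonneg (g h : ℝ) : 0 ≤ cel g h := Real.sqrt_nonneg _

@[simp] theorem cel_zero (g : ℝ) : cel g 0 = 0 := by simp [cel]

theorem continuous_cel (g : ℝ) : Continuous (cel g) := by unfold cel; fun_prop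

variable {g : ℝ}

theorem cel_sq (hg : 0 < g) {h : ℝ} (hh : 0 ≤ h) : cel g h ^ 2 = g * h :=
  Real.sq_sqrt (by positivity)

theorem cel_pos (hg : 0 < g) {h : ℝ} (hh : 0 < h) : 0 < cel g h :=
  Real.sqrt_pos.2 (by positivity)

theorem cel_le_cel (hg : 0 < g) {h h' : ℝ} (hh : h' ≤ h) : cel g h' ≤ cel g h :=
  Real.sqrt_le_sqrt (by gcongr)

theorem cel_lt_cel (hg : 0 < g) {h h' : ℝ} (h0 : 0 ≤ h') (hh : h' < h) : cel g h' < cel g h :=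
  Real.sqrt_lt_sqrt (by positivity) (by gcongr)

theorem le_of_cel_le (hg : 0 < g) {h h' : ℝ} (h0 : 0 ≤ h) (hh : cel g h' ≤ cel g h) : h' ≤ h := by
  by_contra hc
  exact absurd (cel_lt_cel hg h0 (not_le.1 hc)) (not_lt.2 hh)

theorem lt_of_cel_lt (hg : 0 < g) {h h' : ℝ} (hh : cel g h' < cel g h) : h' < h := by
  by_contra hc
  exact absurd (cel_le_cel hg (not_lt.1 hc)) (not_le.2 hh)

theorem cel_inj (hg : 0 < g) {h h' : ℝ} (h0 : 0 ≤ h) (h0' : 0 ≤ h') (hh : cel g h = cel g h') :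
    h = h' :=
  le_antisymm (le_of_cel_le hg h0' hh.le) (le_of_cel_le hg h0 hh.ge)

theorem cel_sq_div (hg : 0 < g) {x : ℝ} (hx : 0 ≤ x) : cel g (x ^ 2 / g) = x := by
  rw [cel, mul_div_cancel₀ _ hg.ne', Real.sqrt_sq hx]

theorem rareJump_eq (hg : 0 < g) (h h₀ : ℝ) : rareJump g h h₀ = 2 * (cel g h - cel g h₀) := by
  simp only [rareJump, cel, Real.sqrt_mul hg.le]; ring

theorem celMean_sq (g h h₀ : ℝ) : celMean g h h₀ ^ 2 = (cel g h ^ 2 + cel g h₀ ^ 2) / 2 :=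
  Real.sq_sqrt (by positivity)

theorem celMean_nonneg (g h h₀ : ℝ) : 0 ≤ celMean g h h₀ := Real.sqrt_nonneg _

theorem celMean_le (hg : 0 < g) {h h₀ : ℝ} (hh : h₀ ≤ h) : celMean g h h₀ ≤ cel g h := by
  have h1 := cel_le_cel hg hh
  have h2 := cel_nonneg g h₀
  exact abs_le_of_sq_le_sq' (by rw [celMean_sq]; nlinarith) (cel_nonneg g h) |>.2

theorem le_celMean (hg : 0 < g) {h h₀ : ℝ} (hh : h₀ ≤ h) : cel g h₀ ≤ celMean g h h₀ := by
  have h1 := cel_le_cel hg hh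
  have h2 := cel_nonneg g h₀
  exact abs_le_of_sq_le_sq' (by rw [celMean_sq]; nlinarith) (celMean_nonneg g h h₀) |>.2

theorem celMean_lt (hg : 0 < g) {h h₀ : ℝ} (h0 : 0 ≤ h₀) (hh : h₀ < h) :
    celMean g h h₀ < cel g h := by
  have h1 := cel_lt_cel hg h0 hh
  have h2 := cel_nonneg g h₀
  exact lt_of_pow_lt_pow_left₀ 2 (cel_nonneg g h) (by rw [celMean_sq]; nlinarith)

theorem lt_celMean (hg : 0 < g) {h h₀ : ℝ} (h0 : 0 ≤ h₀) (hh : h₀ < h) :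
    cel g h₀ < celMean g h h₀ := by
  have h1 := cel_lt_cel hg h0 hh
  have h2 := cel_nonneg g h₀
  exact lt_of_pow_lt_pow_left₀ 2 (celMean_nonneg g h h₀) (by rw [celMean_sq]; nlinarith)

theorem mean_le_celMean (g h h₀ : ℝ) : (cel g h + cel g h₀) / 2 ≤ celMean g h h₀ :=
  abs_le_of_sq_le_sq' (by rw [celMean_sq]; nlinarith [sq_nonneg (cel g h - cel g h₀)])
    (celMean_nonneg g h h₀) |>.2

/-- Substituting h = c²/g leaves an expression rational in the two celerities and their root mean
square. The shock estimates below are made in this form. -/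
theorem shockJump_eq (hg : 0 < g) {h h₀ : ℝ} (hh : 0 < h) (hh₀ : 0 < h₀) :
    shockJump g h h₀ = (cel g h / cel g h₀ - cel g h₀ / cel g h) * celMean g h h₀ := by
  have ht := cel_pos hg hh
  have ht₀ := cel_pos hg hh₀
  have e1 : √(g / 2) * √(1 / h + 1 / h₀) = g * celMean g h h₀ / (cel g h * cel g h₀) := by
    rw [← Real.sqrt_mul (by positivity), Real.sqrt_eq_iff_mul_self_eq (by positivity)
      (by have := celMean_nonneg g h h₀; positivity), ← sq, div_pow, mul_pow, mul_pow, celMean_sq,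
      cel_sq hg hh.le, cel_sq hg hh₀.le]
    field_simp
    ring
  have e2 : h - h₀ = (cel g h ^ 2 - cel g h₀ ^ 2) / g := by
    rw [cel_sq hg hh.le, cel_sq hg hh₀.le]; field_simp
  calc shockJump g h h₀ = (h - h₀) * (√(g / 2) * √(1 / h + 1 / h₀)) := by
        rw [shockJump]; ring
    _ = _ := by rw [e1, e2]; field_simp

theorem shockJump_comm (g h h₀ : ℝ) : shockJump g h₀ h = -shockJump g h h₀ := by
  simp only [shockJump, add_comm (1 / h₀)]; ring

/-- A shock curve is at least as steep in the celerity as a rarefaction curve, whose slope is 2.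
After factoring out t - s, the root mean square z is bounded below by the arithmetic mean and z + y
above by t + s. -/
theorem shockJump_steep (hg : 0 < g) {h h' h₀ : ℝ} (h0 : 0 < h₀) (h1 : h₀ ≤ h') (h2 : h' ≤ h) :
    2 * (cel g h - cel g h') ≤ shockJump g h h₀ - shockJump g h' h₀ := by
  rw [shockJump_eq hg (by linarith) h0, shockJump_eq hg (by linarith) h0]
  have a0 := cel_pos hg h0
  have a1 := cel_le_cel hg h1
  have a2 := cel_le_cel hg h2
  have b1 := mean_le_celMean g h h₀
  have b2 := celMean_le hg (h1.trans h2)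
  have b3 := celMean_le hg h1
  have b4 := celMean_sq g h h₀
  have b5 := celMean_sq g h' h₀
  have b6 := mean_le_celMean g h' h₀
  generalize cel g h = t at *
  generalize cel g h' = s at *
  generalize cel g h₀ = r at *
  generalize celMean g h h₀ = z at *
  generalize celMean g h' h₀ = y at *
  have hs : 0 < s := by linarith
  have ht : 0 < t := by linarith
  have hz : 0 < z := by linarith
  have hy : 0 < y := by linarith
  have e : (t / r - r / t) * z - (s / r - r / s) * y
      = (t - s) * ((1 / r + r / (t * s)) * z + (s / r - r / s) * ((t + s) / (2 * (z + y)))) := by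
    have : z - y = (t - s) * (t + s) / (2 * (z + y)) := by
      field_simp; nlinarith
    have e' : (t / r - r / t) * z - (s / r - r / s) * y
      = (t - s) * ((1 / r + r / (t * s)) * z) + (s / r - r / s) * (z - y) := by
      field_simp; ring
    rw [e', this]; ring
  rw [e]
  have k1 : (1 / r + r / (t * s)) * ((t + r) / 2) ≤ (1 / r + r / (t * s)) * z := by gcongr
  have k2 : (s / r - r / s) * (1 / 2) ≤ (s / r - r / s) * ((t + s) / (2 * (z + y))) := by
    apply mul_le_mul_of_nonneg_left
    · rw [div_le_div_iff₀ (by norm_num) (by positivity)]; linarith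
    · rw [sub_nonneg, div_le_div_iff₀ hs a0]; nlinarith
  -- This is the inequality of arithmetic and geometric means for t²s, ts² and r³, whose product is
  -- (rts)³.
  have k3 : 2 ≤ (1 / r + r / (t * s)) * ((t + r) / 2) + (s / r - r / s) * (1 / 2) := by
    have : (1 / r + r / (t * s)) * ((t + r) / 2) + (s / r - r / s) * (1 / 2) - 2
      = (t ^ 2 * s + t * s ^ 2 + r ^ 3 - 3 * (r * t * s)) / (2 * r * t * s) := by
      field_simp; ring
    have : 0 ≤ (t ^ 2 * s + t * s ^ 2 + r ^ 3 - 3 * (r * t * s)) / (2 * r * t * s) := by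
      apply div_nonneg _ (by positivity)
      nlinarith [mul_nonneg (sub_nonneg.2 a1) (sub_nonneg.2 a2),
        mul_nonneg (mul_nonneg (sub_nonneg.2 a1) (sub_nonneg.2 a2)) ht.le,
        mul_nonneg (mul_nonneg (sub_nonneg.2 a1) (sub_nonneg.2 a2)) hs.le,
        mul_nonneg (mul_nonneg (sub_nonneg.2 a1) (sub_nonneg.2 a1)) hs.le,
        mul_nonneg (mul_nonneg (sub_nonneg.2 a1) (sub_nonneg.2 a1)) a0.le,
        mul_nonneg (mul_nonneg (sub_nonneg.2 a2) (sub_nonneg.2 a2)) hs.le,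
        mul_nonneg (mul_nonneg (sub_nonneg.2 a1) (sub_nonneg.2 a2)) a0.le]
    linarith
  nlinarith [sub_nonneg.2 a2]

/-- The slope in the height is at most g divided by the celerity of the base state: r times the jump
is (t² - r²)(z/t), and the factor z/t is at most 1 and decreases with t. This keeps the loss of
kinetic energy along a shock curve below the gain of potential energy. -/
theorem shockJump_sub_le (hg : 0 < g) {h h' h₀ : ℝ} (h0 : 0 < h₀) (h1 : h₀ ≤ h') (h2 : h' ≤ h) :
    cel g h₀ * (shockJump g h h₀ - shockJump g h' h₀) ≤ g * (h - h') := by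
  have hh' : 0 < h' := by linarith
  have hh : 0 < h := by linarith
  rw [shockJump_eq hg hh h0, shockJump_eq hg hh' h0]
  have a0 := cel_pos hg h0
  have a1 := cel_le_cel hg h1
  have a2 := cel_le_cel hg h2
  have b2 := celMean_le hg (h1.trans h2)
  have b3 := celMean_le hg h1
  have b4 := celMean_sq g h h₀
  have b5 := celMean_sq g h' h₀
  have b6 := celMean_nonneg g h' h₀
  have b7 := celMean_nonneg g h h₀
  have : g * (h - h') = cel g h ^ 2 - cel g h' ^ 2 := by
    rw [cel_sq hg hh.le, cel_sq hg hh'.le]; ring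
  rw [this]
  generalize cel g h = t at *
  generalize cel g h' = s at *
  generalize cel g h₀ = r at *
  generalize celMean g h h₀ = z at *
  generalize celMean g h' h₀ = y at *
  have hs : 0 < s := by linarith
  have ht : 0 < t := by linarith
  have e : r * ((t / r - r / t) * z - (s / r - r / s) * y)
      = (t ^ 2 - r ^ 2) * (z / t) - (s ^ 2 - r ^ 2) * (y / s) := by
    field_simp
  rw [e]
  have k1 : z / t ≤ 1 := by rw [div_le_one ht]; exact b2
  have k2 : z / t ≤ y / s := by
    rw [div_le_div_iff₀ ht hs]
    refine abs_le_of_sq_le_sq' ?_ (by positivity) |>.2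
    rw [mul_pow, mul_pow, b4, b5]
    nlinarith [mul_nonneg (sub_nonneg.2 a2) (add_pos hs ht).le, sq_nonneg r]
  have k3 : (s ^ 2 - r ^ 2) * (z / t) ≤ (s ^ 2 - r ^ 2) * (y / s) :=
    mul_le_mul_of_nonneg_left k2 (by nlinarith)
  have k4 : (t ^ 2 - s ^ 2) * (z / t) ≤ (t ^ 2 - s ^ 2) * 1 :=
    mul_le_mul_of_nonneg_left k1 (by nlinarith)
  linarith

@[simp] theorem shockJump_self (g h : ℝ) : shockJump g h h = 0 := by simp [shockJump]

@[simp] theorem rareJump_self (g h : ℝ) : rareJump g h h = 0 := by simp [rareJump]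

@[simp] theorem jump_self (g h : ℝ) : jump g h h = 0 := by simp [jump]

theorem jump_of_lt {h h₀ : ℝ} (hh : h₀ < h) : jump g h h₀ = shockJump g h h₀ := if_pos hh

theorem jump_of_le (hg : 0 < g) {h h₀ : ℝ} (hh : h ≤ h₀) :
    jump g h h₀ = 2 * (cel g h - cel g h₀) := by
  rw [← rareJump_eq hg]; exact if_neg (not_lt.2 hh)

theorem jump_of_ge {h h₀ : ℝ} (hh : h₀ ≤ h) : jump g h h₀ = shockJump g h h₀ := by
  rcases hh.eq_or_lt with rfl | hh
  · simp
  · exact jump_of_lt hh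

theorem jump_steep (hg : 0 < g) {h h' h₀ : ℝ} (h0 : 0 < h₀) (h2 : h' ≤ h) :
    2 * (cel g h - cel g h') ≤ jump g h h₀ - jump g h' h₀ := by
  rcases le_total h h₀ with h1 | h1
  · rw [jump_of_le hg h1, jump_of_le hg (h2.trans h1)]; linarith
  · rcases le_total h' h₀ with h3 | h3
    · have := shockJump_steep hg h0 le_rfl h1
      rw [jump_of_ge h1, jump_of_le hg h3]
      rw [shockJump_self] at this; linarith
    · rw [jump_of_ge h1, jump_of_ge h3]; exact shockJump_steep hg h0 h3 h2

theorem jump_strictMono (hg : 0 < g) {h h' h₀ : ℝ} (h0 : 0 < h₀) (hh' : 0 ≤ h') (h2 : h' < h) :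
    jump g h' h₀ < jump g h h₀ := by
  have := jump_steep hg h0 h2.le
  have := cel_lt_cel hg hh' h2
  linarith

theorem jump_mono (hg : 0 < g) {h h' h₀ : ℝ} (h0 : 0 < h₀) (h2 : h' ≤ h) :
    jump g h' h₀ ≤ jump g h h₀ := by
  have := jump_steep hg h0 h2
  have := cel_le_cel hg h2
  linarith

theorem continuous_jump (hg : 0 < g) {h₀ : ℝ} (h0 : 0 < h₀) : Continuous fun h => jump g h h₀ := by
  -- One of the two terms always vanishes, and max h h₀ stays away from the singularity of the shock
  -- jump at height zero.
  have e : (fun h => jump g h h₀)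
      = fun h => shockJump g (max h h₀) h₀ + rareJump g (min h h₀) h₀ := by
    funext h
    rcases le_total h h₀ with h1 | h1
    · rw [jump_of_le hg h1, max_eq_right h1, min_eq_left h1, rareJump_eq hg, shockJump_self,
        zero_add]
    · rw [jump_of_ge h1, max_eq_left h1, min_eq_right h1, rareJump_self, add_zero]
  rw [e]
  have : ∀ h, max h h₀ ≠ 0 := fun h => (lt_max_of_lt_right h0).ne'
  unfold shockJump rareJump
  fun_prop (disch := assumption)

end ShallowWater
end

noncomputable section

namespace ShallowWater

/-! ### Reflection, elementary waves and their speeds -/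

/-- The reflection of a state under `x ↦ -x`. -/
def mirror (U : State) : State := ⟨U.h, -U.u, U.a⟩

@[simp] theorem mirror_h (U : State) : (mirror U).h = U.h := rfl
@[simp] theorem mirror_u (U : State) : (mirror U).u = -U.u := rfl
@[simp] theorem mirror_a (U : State) : (mirror U).a = U.a := rfl
@[simp] theorem mirror_mirror (U : State) : mirror (mirror U) = U := by ext <;> simp

@[simp] theorem lam1_mirror (g : ℝ) (U : State) : lam1 g (mirror U) = -lam2 g U := by
  simp [lam1, lam2]; ring

@[simp] theorem lam2_mirror (g : ℝ) (U : State) : lam2 g (mirror U) = -lam1 g U := by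
  simp [lam1, lam2]; ring

theorem shockSpeed_mirror (U V : State) :
    shockSpeed (mirror V) (mirror U) = -shockSpeed U V := by
  simp only [shockSpeed, mirror_h, mirror_u, ← neg_div]
  rw [← neg_div_neg_eq]
  congr 1 <;> ring

theorem Psi1_mirror (g : ℝ) (V U : State) : Psi1 g (mirror V) (mirror U) = -Phi2 g V U := by
  simp only [Psi1_eq, Phi2_eq, mirror_h, mirror_u]; ring

theorem isShock1_mirror {g : ℝ} {U V : State} :
    IsShock1 g (mirror V) (mirror U) ↔ IsShock2 g U V := by
  simp only [IsShock1, IsShock2, mirror_h, mirror_u, mirror_a]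
  rw [shockJump_comm, eq_comm (a := U.a)]
  have : -U.u - -V.u + -shockJump g V.h U.h = V.u - U.u - shockJump g V.h U.h := by ring
  rw [this]

theorem isShock2_mirror {g : ℝ} {U V : State} :
    IsShock2 g (mirror V) (mirror U) ↔ IsShock1 g U V := by
  rw [← isShock1_mirror, mirror_mirror, mirror_mirror]

theorem isRare1_mirror {g : ℝ} {U V : State} :
    IsRare1 g (mirror V) (mirror U) ↔ IsRare2 g U V := by
  simp only [IsRare1, IsRare2, mirror_h, mirror_u, mirror_a, rareJump]
  rw [eq_comm (a := U.a)]
  have : -U.u - -V.u + 2 * √g * (√U.h - √V.h) = V.u - U.u - 2 * √g * (√V.h - √U.h) := by ring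
  rw [this]

theorem isRare2_mirror {g : ℝ} {U V : State} :
    IsRare2 g (mirror V) (mirror U) ↔ IsRare1 g U V := by
  rw [← isRare1_mirror, mirror_mirror, mirror_mirror]

variable {g : ℝ} {U V : State}

theorem IsRare1.eq (hg : 0 < g) (h : IsRare1 g U V) :
    V.u + 2 * cel g V.h = U.u + 2 * cel g U.h := by
  have := h.2.2.2.2; rw [rareJump_eq hg] at this; linarith

theorem IsRare2.eq (hg : 0 < g) (h : IsRare2 g U V) :
    V.u - 2 * cel g V.h = U.u - 2 * cel g U.h := by
  have := h.2.2.2.2; rw [rareJump_eq hg] at this; linarith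

theorem isRare1_iff (hg : 0 < g) : IsRare1 g U V ↔ 0 < U.h ∧ 0 ≤ V.h ∧ V.h ≤ U.h ∧ V.a = U.a ∧
    V.u + 2 * cel g V.h = U.u + 2 * cel g U.h := by
  refine ⟨fun h => ⟨h.1, h.2.1, h.2.2.1, h.2.2.2.1, h.eq hg⟩, fun h => ⟨h.1, h.2.1, h.2.2.1,
    h.2.2.2.1, ?_⟩⟩
  rw [rareJump_eq hg]; linarith [h.2.2.2.2]

theorem isRare2_iff (hg : 0 < g) : IsRare2 g U V ↔ 0 < V.h ∧ 0 ≤ U.h ∧ U.h ≤ V.h ∧ V.a = U.a ∧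
    V.u - 2 * cel g V.h = U.u - 2 * cel g U.h := by
  refine ⟨fun h => ⟨h.1, h.2.1, h.2.2.1, h.2.2.2.1, h.eq hg⟩, fun h => ⟨h.1, h.2.1, h.2.2.1,
    h.2.2.2.1, ?_⟩⟩
  rw [rareJump_eq hg]; linarith [h.2.2.2.2]

/-- In this form, and its companion at the right state, the Lax inequalities reduce to r < z < t for
the celerities r < t and their root mean square z. -/
theorem IsShock1.speed_left (hg : 0 < g) (h : IsShock1 g U V) :
    shockSpeed U V = U.u - cel g V.h / cel g U.h * celMean g V.h U.h := by
  obtain ⟨h1, h2, -, h3⟩ := h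
  have hV : 0 < V.h := h1.trans h2
  rw [shockJump_eq hg hV h1] at h3
  have a0 := cel_pos hg h1
  have a1 := cel_pos hg hV
  have e0 := cel_sq hg h1.le
  have e1 := cel_sq hg hV.le
  have e : V.u = U.u - (cel g V.h / cel g U.h - cel g U.h / cel g V.h) * celMean g V.h U.h := by
    linarith
  rw [shockSpeed, div_eq_iff (by linarith), e]
  have k0 : U.h = cel g U.h ^ 2 / g := by rw [e0]; field_simp
  have k1 : V.h = cel g V.h ^ 2 / g := by rw [e1]; field_simp
  generalize cel g V.h = t at *
  generalize cel g U.h = r at *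
  generalize celMean g V.h U.h = z at *
  rw [k0, k1]
  field_simp
  ring

theorem IsShock1.speed_right (hg : 0 < g) (h : IsShock1 g U V) :
    shockSpeed U V = V.u - cel g U.h / cel g V.h * celMean g V.h U.h := by
  rw [h.speed_left hg]
  obtain ⟨h1, h2, -, h3⟩ := h
  rw [shockJump_eq hg (h1.trans h2) h1] at h3
  linarith

theorem IsShock1.speed_lt_lam1 (hg : 0 < g) (h : IsShock1 g U V) : shockSpeed U V < lam1 g U := by
  rw [h.speed_left hg, lam1_eq]
  have a0 := cel_pos hg h.1
  have a1 := cel_lt_cel hg h.1.le h.2.1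
  have a2 := lt_celMean hg h.1.le h.2.1
  have : 1 < cel g V.h / cel g U.h := (one_lt_div a0).2 a1
  nlinarith

theorem IsShock1.lam1_lt_speed (hg : 0 < g) (h : IsShock1 g U V) : lam1 g V < shockSpeed U V := by
  rw [h.speed_right hg, lam1_eq]
  have a0 := cel_pos hg h.1
  have a1 := cel_lt_cel hg h.1.le h.2.1
  have a2 := celMean_lt hg h.1.le h.2.1
  have a3 := lt_celMean hg h.1.le h.2.1
  have : cel g U.h / cel g V.h < 1 := (div_lt_one (a0.trans a1)).2 a1
  nlinarith

theorem IsShock1.speed_lt_right (hg : 0 < g) (h : IsShock1 g U V) : shockSpeed U V < V.u := by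
  rw [h.speed_right hg]
  have a0 := cel_pos hg h.1
  have a1 := cel_pos hg (h.1.trans h.2.1)
  have a3 := lt_celMean hg h.1.le h.2.1
  have : 0 < cel g U.h / cel g V.h * celMean g V.h U.h := by
    have := a0.trans a3
    positivity
  linarith

theorem IsShock2.lam2_lt_speed (hg : 0 < g) (h : IsShock2 g U V) : lam2 g V < shockSpeed U V := by
  have := (isShock1_mirror.2 h).speed_lt_lam1 hg
  rw [shockSpeed_mirror, lam1_mirror] at this; linarith

theorem IsShock2.speed_lt_lam2 (hg : 0 < g) (h : IsShock2 g U V) : shockSpeed U V < lam2 g U := by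
  have := (isShock1_mirror.2 h).lam1_lt_speed hg
  rw [shockSpeed_mirror, lam1_mirror] at this; linarith

theorem IsShock2.left_lt_speed (hg : 0 < g) (h : IsShock2 g U V) : U.u < shockSpeed U V := by
  have := (isShock1_mirror.2 h).speed_lt_right hg
  rw [shockSpeed_mirror, mirror_u] at this; linarith

theorem IsRare1.lam1_le (hg : 0 < g) (h : IsRare1 g U V) : lam1 g U ≤ lam1 g V := by
  have := h.eq hg
  have := cel_le_cel hg h.2.2.1
  rw [lam1_eq, lam1_eq]; linarith

theorem IsRare2.lam2_le (hg : 0 < g) (h : IsRare2 g U V) : lam2 g U ≤ lam2 g V := by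
  have := h.eq hg
  have := cel_le_cel hg h.2.2.1
  rw [lam2_eq, lam2_eq]; linarith

theorem speedLeft_le_speedRight (hg : 0 < g) {k : WaveKind} (h : IsWave g k U V) :
    speedLeft g k U V ≤ speedRight g k U V := by
  cases k with
  | shock1 => exact le_rfl
  | shock2 => exact le_rfl
  | rare1 => exact IsRare1.lam1_le hg h
  | rare2 => exact IsRare2.lam2_le hg h
  | contact => exact le_rfl
  | dry => exact h.2.2.2

/-- The kind of 1-wave connecting `U` to the state `V` of its forward 1-wave curve. -/
def kind1 (U V : State) : WaveKind := if U.h < V.h then .shock1 else .rare1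

/-- The kind of 2-wave connecting the state `U` of the backward 2-wave curve of `V` to `V`. -/
def kind2 (U V : State) : WaveKind := if V.h < U.h then .shock2 else .rare2

theorem isWave_kind1 (hU : 0 < U.h) (hV : 0 ≤ V.h) (ha : V.a = U.a) (h : Psi1 g V U = 0) :
    IsWave g (kind1 U V) U V := by
  unfold kind1
  rw [Psi1] at h
  split_ifs at * with hh
  · exact ⟨hU, hh, ha, h⟩
  · exact ⟨hU, hV, not_lt.1 hh, ha, h⟩

theorem isWave_kind2 (hU : 0 ≤ U.h) (hV : 0 < V.h) (ha : V.a = U.a) (h : Phi2 g U V = 0) :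
    IsWave g (kind2 U V) U V := by
  unfold kind2
  rw [Phi2] at h
  split_ifs at * with hh
  · refine ⟨hV, hh, ha, ?_⟩
    rw [shockJump_comm] at h; linarith
  · refine ⟨hV, hU, not_lt.1 hh, ha, ?_⟩
    simp only [rareJump] at h ⊢; linarith

theorem IsShock1.kind1 (h : IsShock1 g U V) : kind1 U V = .shock1 := if_pos h.2.1
theorem IsRare1.kind1 (h : IsRare1 g U V) : kind1 U V = .rare1 := if_neg (not_lt.2 h.2.2.1)
theorem IsShock2.kind2 (h : IsShock2 g U V) : kind2 U V = .shock2 := if_pos h.2.1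
theorem IsRare2.kind2 (h : IsRare2 g U V) : kind2 U V = .rare2 := if_neg (not_lt.2 h.2.2.1)
@[simp] theorem kind1_self (U : State) : kind1 U U = .rare1 := if_neg (lt_irrefl _)
@[simp] theorem kind2_self (U : State) : kind2 U U = .rare2 := if_neg (lt_irrefl _)

theorem IsShock1.Psi1_eq_zero (h : IsShock1 g U V) : Psi1 g V U = 0 := by
  rw [Psi1, if_pos h.2.1]; exact h.2.2.2

theorem IsRare1.Psi1_eq_zero (h : IsRare1 g U V) : Psi1 g V U = 0 := by
  rw [Psi1, if_neg (not_lt.2 h.2.2.1)]; exact h.2.2.2.2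

theorem IsShock2.Phi2_eq_zero (h : IsShock2 g U V) : Phi2 g U V = 0 := by
  rw [Phi2, if_pos h.2.1, shockJump_comm]; linarith [h.2.2.2]

theorem IsRare2.Phi2_eq_zero (h : IsRare2 g U V) : Phi2 g U V = 0 := by
  have := h.2.2.2.2
  rw [Phi2, if_neg (not_lt.2 h.2.2.1)]
  simp only [rareJump] at *; linarith

@[simp] theorem Psi1_self (g : ℝ) (U : State) : Psi1 g U U = 0 := by simp [Psi1_eq]
@[simp] theorem Phi2_self (g : ℝ) (U : State) : Phi2 g U U = 0 := by simp [Phi2_eq]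

theorem isRare1_refl (hU : 0 < U.h) : IsRare1 g U U := ⟨hU, hU.le, le_rfl, rfl, by simp⟩
theorem isRare2_refl (hU : 0 < U.h) : IsRare2 g U U := ⟨hU, hU.le, le_rfl, rfl, by simp⟩

theorem IsRare1.trans {W : State} (hg : 0 < g) (h : IsRare1 g U V) (h' : IsRare1 g V W) :
    IsRare1 g U W := by
  rw [isRare1_iff hg] at *
  exact ⟨h.1, h'.2.1, h'.2.2.1.trans h.2.2.1, h'.2.2.2.1.trans h.2.2.2.1,
    h'.2.2.2.2.trans h.2.2.2.2⟩

theorem IsRare2.trans {W : State} (hg : 0 < g) (h : IsRare2 g U V) (h' : IsRare2 g V W) :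
    IsRare2 g U W := by
  rw [isRare2_iff hg] at *
  exact ⟨h'.1, h.2.1, h.2.2.1.trans h'.2.2.1, h'.2.2.2.1.trans h.2.2.2.1,
    h'.2.2.2.2.trans h.2.2.2.2⟩

/-! ### Discharge and energy along the wave curves -/

/-- The specific energy `u²/2 + g h`. -/
def energy (g : ℝ) (U : State) : ℝ := U.u ^ 2 / 2 + g * U.h

@[simp] theorem energy_mirror (g : ℝ) (U : State) : energy g (mirror U) = energy g U := by
  simp [energy]

theorem cel_eq_div (hg : 0 < g) {h : ℝ} (hh : 0 ≤ h) : h = cel g h ^ 2 / g := by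
  rw [cel_sq hg hh]; field_simp

/-- Along the forward 1-wave curve, in the direction of increasing heights. -/
theorem W1_compare_rare {X Y : State} (hg : 0 < g) (hX : 0 ≤ X.h) (hY : 0 ≤ Y.h)
    (hu : X.u + 2 * cel g X.h = Y.u + 2 * cel g Y.h) (hh : Y.h < X.h) (hl : lam1 g Y ≤ 0) :
    X.h * X.u < Y.h * Y.u ∧ energy g Y < energy g X := by
  rw [lam1_eq] at hl
  have c0 := cel_nonneg g Y.h
  have c1 := cel_lt_cel hg hY hh
  rw [energy, energy, ← cel_sq hg hX, ← cel_sq hg hY]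
  have eX := cel_eq_div hg hX
  have eY := cel_eq_div hg hY
  generalize cel g X.h = s at *
  generalize cel g Y.h = t at *
  rw [eX, eY]
  -- The Riemann invariant k is common to both states, and λ₁(Y) ≤ 0 says k ≤ 3t. This sign makes
  -- the factored difference of discharges positive.
  obtain ⟨k, hk⟩ : ∃ k, k = Y.u + 2 * t := ⟨_, rfl⟩
  have e1 : X.u = k - 2 * s := by linarith
  have e2 : Y.u = k - 2 * t := by linarith
  rw [e1, e2]
  have hk3 : k ≤ 3 * t := by linarith
  constructor
  · rw [div_mul_eq_mul_div, div_mul_eq_mul_div, div_lt_div_iff_of_pos_right hg]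
    have : t ^ 2 * (k - 2 * t) - s ^ 2 * (k - 2 * s)
      = (s - t) * ((2 * s + t) * (s - t) + (3 * t - k) * (s + t)) := by ring
    have h1 : 0 < (s - t) * ((2 * s + t) * (s - t) + (3 * t - k) * (s + t)) := by
      have h2 : 0 < s - t := sub_pos.2 c1
      have h3 : 0 ≤ 3 * t - k := by linarith
      have h4 : 0 < 2 * s + t := by linarith
      have h5 : 0 ≤ s + t := by linarith
      positivity
    linarith
  · nlinarith

theorem discharge_shockJump {h h' h₀ : ℝ} (hg : 0 < g) (h0 : 0 < h₀) (h0Y : h₀ ≤ h')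
    (hh : h' ≤ h) : cel g h₀ * (h - h') ≤ h * shockJump g h h₀ - h' * shockJump g h' h₀ := by
  have hY : 0 < h' := by linarith
  have c0 := cel_pos hg h0
  have c1 := cel_le_cel hg hh
  have c2 := cel_le_cel hg h0Y
  have hX : 0 < h := by linarith
  have z1 := celMean_sq g h h₀
  have z2 := celMean_sq g h' h₀
  have z3 := celMean_nonneg g h h₀
  have z4 := celMean_nonneg g h' h₀
  have z5 := le_celMean hg (h0Y.trans hh)
  rw [shockJump_eq hg hX h0, shockJump_eq hg hY h0]
  have e0 := cel_eq_div hg hX.le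
  have e1 := cel_eq_div hg hY.le
  generalize cel g h = s at *
  generalize cel g h' = t at *
  generalize cel g h₀ = r at *
  generalize celMean g h h₀ = z at *
  generalize celMean g h' h₀ = y at *
  rw [e0, e1]
  have ht : 0 < t := by linarith
  have hs : 0 < s := by linarith
  have e : s ^ 2 / g * ((s / r - r / s) * z) - t ^ 2 / g * ((t / r - r / t) * y)
      = (s * (s ^ 2 - r ^ 2) * z - t * (t ^ 2 - r ^ 2) * y) / (g * r) := by
    field_simp
  rw [e, le_div_iff₀ (by positivity)]
  have e' : r * (s ^ 2 / g - t ^ 2 / g) * (g * r) = r ^ 2 * (s ^ 2 - t ^ 2) := by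
    field_simp
  rw [e']
  have yz : t * y ≤ s * z := by
    have : y ≤ z := abs_le_of_sq_le_sq' (by rw [z1, z2]; gcongr) z3 |>.2
    nlinarith
  have rs : r ^ 2 ≤ s * z := by nlinarith
  have k5 : 0 ≤ t ^ 2 - r ^ 2 := by nlinarith
  have k6 : 0 ≤ s ^ 2 - t ^ 2 := by nlinarith
  have k7 := mul_le_mul_of_nonneg_left yz k5
  have k8 := mul_le_mul_of_nonneg_left rs k6
  have e2 : s * (s ^ 2 - r ^ 2) * z - t * (t ^ 2 - r ^ 2) * y
      = (s ^ 2 - t ^ 2) * (s * z) + (t ^ 2 - r ^ 2) * (s * z) - (t ^ 2 - r ^ 2) * (t * y) := by ring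
  linarith

theorem W1_compare_shock {U₀ X Y : State} (hg : 0 < g) (h0 : 0 < U₀.h) (hl : lam1 g U₀ < 0)
    (hu : X.u - U₀.u + shockJump g X.h U₀.h = 0) (hu' : Y.u - U₀.u + shockJump g Y.h U₀.h = 0)
    (h0Y : U₀.h ≤ Y.h) (hh : Y.h < X.h) :
    X.h * X.u < Y.h * Y.u ∧ energy g Y < energy g X := by
  have hY : 0 < Y.h := by linarith
  have k1 := shockJump_sub_le hg h0 h0Y hh.le
  have k2 := shockJump_steep hg h0 h0Y hh.le
  have c0 := cel_pos hg h0
  have c1 := cel_lt_cel hg hY.le hh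
  have k3 := shockJump_steep hg h0 le_rfl h0Y
  have c2 := cel_le_cel hg h0Y
  rw [lam1_eq] at hl
  rw [shockJump_self] at k3
  have q1 := discharge_shockJump hg h0 h0Y hh.le
  generalize shockJump g X.h U₀.h = a at *
  generalize shockJump g Y.h U₀.h = b at *
  have eX : X.u = U₀.u - a := by linarith
  have eY : Y.u = U₀.u - b := by linarith
  rw [energy, energy, eX, eY]
  generalize cel g U₀.h = r at *
  have hd : 0 < X.h - Y.h := sub_pos.2 hh
  constructor
  · nlinarith
  · have hab : 0 < a - b := by linarith
    have hb : 0 ≤ b := by linarith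
    nlinarith [mul_nonneg hab.le hb, mul_pos hab hab]

/-- Along the forward 1-wave curve of a state with negative first speed, beyond any state with
nonpositive first speed, the discharge decreases and the energy increases with the height. -/
theorem W1_compare {U₀ X Y : State} (hg : 0 < g) (h0 : 0 < U₀.h) (hl : lam1 g U₀ < 0)
    (hX : Psi1 g X U₀ = 0) (hY : Psi1 g Y U₀ = 0) (hY0 : 0 ≤ Y.h) (hh : Y.h < X.h)
    (hlY : lam1 g Y ≤ 0) :
    X.h * X.u < Y.h * Y.u ∧ energy g Y < energy g X := by
  rw [Psi1_eq] at hX hY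
  rcases le_total X.h U₀.h with h1 | h1
  · rw [jump_of_le hg h1] at hX
    rw [jump_of_le hg (hh.le.trans h1)] at hY
    exact W1_compare_rare hg (hY0.trans hh.le) hY0 (by linarith) hh hlY
  rcases le_total U₀.h Y.h with h2 | h2
  · rw [jump_of_ge h1] at hX
    rw [jump_of_ge h2] at hY
    exact W1_compare_shock hg h0 hl hX hY h2 hh
  rw [jump_of_ge h1] at hX
  rw [jump_of_le hg h2] at hY
  -- Here Y lies on the rarefaction branch and X on the shock branch, so both are compared with the
  -- common end U₀.
  have A : U₀.h < X.h → X.h * X.u < U₀.h * U₀.u ∧ energy g U₀ < energy g X := fun h =>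
    W1_compare_shock hg h0 hl hX (by simp) le_rfl h
  have B : Y.h < U₀.h → U₀.h * U₀.u < Y.h * Y.u ∧ energy g Y < energy g U₀ := fun h =>
    W1_compare_rare hg h0.le hY0 (by linarith) h hlY
  rcases h2.lt_or_eq with h3 | h3
  · rcases h1.lt_or_eq with h4 | h4
    · exact ⟨(A h4).1.trans (B h3).1, (B h3).2.trans (A h4).2⟩
    · have : X.u = U₀.u := by rw [← h4] at hX; simp at hX; linarith
      rw [energy, energy, this, ← h4]
      exact B h3
  · have : Y.u = U₀.u := by rw [h3] at hY; linarith
    rw [energy, energy, this, h3]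
    exact A (h3 ▸ hh)

/-- Along the backward 2-wave curve of a state with positive second speed, beyond any state with
nonnegative second speed, velocity, discharge and energy increase with the height. -/
theorem W2_compare {U₀ X Y : State} (hg : 0 < g) (h0 : 0 < U₀.h) (hl : 0 < lam2 g U₀)
    (hX : Phi2 g X U₀ = 0) (hY : Phi2 g Y U₀ = 0) (hY0 : 0 ≤ Y.h) (hh : Y.h < X.h)
    (hlY : 0 ≤ lam2 g Y) :
    Y.u < X.u ∧ Y.h * Y.u < X.h * X.u ∧ energy g Y < energy g X := by
  have := W1_compare (U₀ := mirror U₀) (X := mirror X) (Y := mirror Y) hg h0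
    (by rw [lam1_mirror]; linarith) (by rw [Psi1_mirror, hX, neg_zero])
    (by rw [Psi1_mirror, hY, neg_zero]) hY0 hh (by rw [lam1_mirror]; linarith)
  simp only [mirror_h, mirror_u, energy_mirror] at this
  refine ⟨?_, by linarith [this.1], this.2⟩
  rw [Phi2_eq] at hX hY
  linarith [jump_strictMono hg h0 hY0 hh]

/-- A 1-shock of nonnegative speed dissipates energy. -/
theorem IsShock1.energy_lt (hg : 0 < g) (h : IsShock1 g U V) (hs : 0 ≤ shockSpeed U V) :
    energy g V < energy g U := by
  have s1 := h.speed_left hg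
  have s2 := h.speed_right hg
  obtain ⟨h1, h2, -, -⟩ := h
  have hV := h1.trans h2
  have a0 := cel_pos hg h1
  have a1 := cel_lt_cel hg h1.le h2
  have z1 := celMean_sq g V.h U.h
  have z2 := lt_celMean hg h1.le h2
  rw [energy, energy, ← cel_sq hg hV.le, ← cel_sq hg h1.le]
  generalize shockSpeed U V = s at *
  generalize cel g V.h = t at *
  generalize cel g U.h = r at *
  generalize celMean g V.h U.h = z at *
  have ht : 0 < t := a0.trans a1
  have hz : 0 < z := by linarith
  -- With velocities taken relative to the shock speed s, the terms s² cancel, the cross terms have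
  -- the right sign since s ≥ 0, and what remains is the loss (t² - r²)³/(4t²r²) of a stationary
  -- shock.
  have eU : U.u = s + t / r * z := by linarith
  have eV : V.u = s + r / t * z := by linarith
  rw [eU, eV]
  have hlt : r / t < t / r := by rw [div_lt_div_iff₀ ht a0]; nlinarith
  have k1 : s * (r / t * z) ≤ s * (t / r * z) := by gcongr
  have k2 : (r / t * z) ^ 2 / 2 + t ^ 2 < (t / r * z) ^ 2 / 2 + r ^ 2 := by
    rw [mul_pow, mul_pow, z1, ← sub_pos]
    have : (t / r) ^ 2 * ((t ^ 2 + r ^ 2) / 2) / 2 + r ^ 2 - ((r / t) ^ 2 * ((t ^ 2 + r ^ 2) / 2) / 2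
        + t ^ 2) = (t ^ 2 - r ^ 2) ^ 3 / (4 * t ^ 2 * r ^ 2) := by
      field_simp; ring
    rw [this]
    have : 0 < t ^ 2 - r ^ 2 := by nlinarith
    positivity
  nlinarith

end ShallowWater
end

noncomputable section

namespace ShallowWater

/-! ### Stationary contacts -/

/-- The specific energy at height `h` for the discharge `q`. -/
def specEnergy (g q h : ℝ) : ℝ := q ^ 2 / (2 * h ^ 2) + g * h

variable {g : ℝ} {U V W : State}

theorem energy_eq_specEnergy (hU : U.h ≠ 0) : energy g U = specEnergy g (U.h * U.u) U.h := by
  rw [energy, specEnergy]; field_simp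

/-- The second factor decides monotonicity: it is positive for distinct heights at or above the
critical height, where gx³ = q², and negative for distinct heights at or below it. -/
theorem specEnergy_sub {q x y : ℝ} (hx : 0 < x) (hy : 0 < y) :
    specEnergy g q y - specEnergy g q x
      = (y - x) * (g - q ^ 2 * (x + y) / (2 * x ^ 2 * y ^ 2)) := by
  rw [specEnergy, specEnergy]; field_simp; ring

theorem specEnergy_lt_of_subcritical (hg : 0 < g) {q x y : ℝ} (hx : 0 < x) (hq : q ^ 2 ≤ g * x ^ 3)
    (hxy : x < y) : specEnergy g q x < specEnergy g q y := by
  have hy : 0 < y := hx.trans hxy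
  rw [← sub_pos, specEnergy_sub hx hy]
  refine mul_pos (sub_pos.2 hxy) (sub_pos.2 ?_)
  rw [div_lt_iff₀ (by positivity)]
  calc q ^ 2 * (x + y) ≤ g * x ^ 3 * (x + y) := by gcongr
    _ < g * x ^ 3 * (2 * y) := by gcongr; linarith
    _ = g * x ^ 2 * (2 * y * x) := by ring
    _ ≤ g * x ^ 2 * (2 * y * y) := by gcongr
    _ = g * (2 * x ^ 2 * y ^ 2) := by ring

theorem specEnergy_lt_of_supercritical (hg : 0 < g) {q x y : ℝ} (hx : 0 < x)
    (hq : g * y ^ 3 ≤ q ^ 2) (hxy : x < y) : specEnergy g q y < specEnergy g q x := by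
  have hy : 0 < y := hx.trans hxy
  rw [← sub_neg, specEnergy_sub hx hy]
  refine mul_neg_of_pos_of_neg (sub_pos.2 hxy) (sub_neg.2 ?_)
  rw [lt_div_iff₀ (by positivity)]
  calc g * (2 * x ^ 2 * y ^ 2) = g * y ^ 2 * (x * (2 * x)) := by ring
    _ < g * y ^ 2 * (y * (x + y)) := by gcongr; linarith
    _ = g * y ^ 3 * (x + y) := by ring
    _ ≤ q ^ 2 * (x + y) := by gcongr

theorem specEnergy_le_of_subcritical (hg : 0 < g) {q x y : ℝ} (hx : 0 < x) (hq : q ^ 2 ≤ g * x ^ 3)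
    (hxy : x ≤ y) : specEnergy g q x ≤ specEnergy g q y := by
  rcases hxy.eq_or_lt with rfl | h
  · exact le_rfl
  · exact (specEnergy_lt_of_subcritical hg hx hq h).le

theorem specEnergy_le_of_supercritical (hg : 0 < g) {q x y : ℝ} (hx : 0 < x)
    (hq : g * y ^ 3 ≤ q ^ 2) (hxy : x ≤ y) : specEnergy g q y ≤ specEnergy g q x := by
  rcases hxy.eq_or_lt with rfl | h
  · exact le_rfl
  · exact (specEnergy_lt_of_supercritical hg hx hq h).le

theorem bottomAlong_eq (hg : 0 < g) (U : State) {x : ℝ} (hx : x ≠ 0) :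
    bottomAlong g U x = U.a + (energy g U - specEnergy g (U.h * U.u) x) / g := by
  rw [bottomAlong, energy, specEnergy]; field_simp; ring

/-- `u² ≤ g h`. -/
theorem discharge_sq_le_iff (hU : 0 < U.h) :
    (U.h * U.u) ^ 2 ≤ g * U.h ^ 3 ↔ U.u ^ 2 ≤ g * U.h := by
  have : 0 < U.h ^ 2 := by positivity
  rw [mul_pow, show g * U.h ^ 3 = U.h ^ 2 * (g * U.h) by ring, mul_le_mul_iff_right₀ this]

theorem le_discharge_sq_iff (hU : 0 < U.h) :
    g * U.h ^ 3 ≤ (U.h * U.u) ^ 2 ↔ g * U.h ≤ U.u ^ 2 := by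
  have : 0 < U.h ^ 2 := by positivity
  rw [mul_pow, show g * U.h ^ 3 = U.h ^ 2 * (g * U.h) by ring, mul_le_mul_iff_right₀ this]

theorem IsContact.head (hg : 0 < g) (h : IsContact g U V) :
    energy g V + g * V.a = energy g U + g * U.a := by
  obtain ⟨h1, h2, h3, h4, -⟩ := h
  rw [bottomAlong_eq hg U h2.ne', ← h3, ← energy_eq_specEnergy h2.ne'] at h4
  rw [h4]; field_simp; ring

theorem exists_criticalHeight (hg : 0 < g) {q : ℝ} (hq : q ≠ 0) : ∃ x, 0 < x ∧ g * x ^ 3 = q ^ 2 := by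
  have h0 : 0 < q ^ 2 / g := by positivity
  refine ⟨(q ^ 2 / g) ^ ((3 : ℕ) : ℝ)⁻¹, Real.rpow_pos_of_pos h0 _, ?_⟩
  rw [Real.rpow_inv_natCast_pow h0.le (by norm_num)]; field_simp

/-- At fixed discharge the specific energy has a strict minimum at the critical height, so the
bottom level has a strict maximum there. Monotonicity of the bottom between the two heights
therefore forbids crossing the critical height. -/
theorem IsContact.side (hg : 0 < g) (h : IsContact g U V) :
    (U.u ^ 2 ≤ g * U.h ∧ V.u ^ 2 ≤ g * V.h) ∨ (g * U.h ≤ U.u ^ 2 ∧ g * V.h ≤ V.u ^ 2) := by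
  obtain ⟨h1, h2, h3, -, h5⟩ := h
  rw [← discharge_sq_le_iff h1, ← discharge_sq_le_iff h2, ← le_discharge_sq_iff h1,
    ← le_discharge_sq_iff h2, h3]
  generalize hq : U.h * U.u = q at *
  have key : ∀ x y, 0 < x → 0 < y → Set.uIcc U.h V.h = Set.uIcc x y →
      ¬ (g * x ^ 3 < q ^ 2 ∧ q ^ 2 < g * y ^ 3) := by
    rintro x y hx hy hxy ⟨a1, a2⟩
    have hq0 : q ≠ 0 := by
      rintro rfl
      have : 0 < g * x ^ 3 := by positivity
      norm_num at a1; linarith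
    obtain ⟨z, hz, e⟩ := exists_criticalHeight hg hq0
    rw [← e] at a1 a2
    have b1 : x < z := lt_of_pow_lt_pow_left₀ 3 hz.le (lt_of_mul_lt_mul_left a1 hg.le)
    have b2 : z < y := lt_of_pow_lt_pow_left₀ 3 hy.le (lt_of_mul_lt_mul_left a2 hg.le)
    have c1 := specEnergy_lt_of_supercritical hg hx e.le b1
    have c2 := specEnergy_lt_of_subcritical hg hz e.ge b2
    have lt : ∀ w, w ≠ 0 → specEnergy g q z < specEnergy g q w →
        bottomAlong g U w < bottomAlong g U z := by
      intro w hw hlt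
      rw [bottomAlong_eq hg U hw, bottomAlong_eq hg U hz.ne', hq]
      gcongr
    have l1 := lt x hx.ne' c1
    have l2 := lt y hy.ne' c2
    rw [hxy] at h5
    have m1 : x ∈ Set.uIcc x y := Set.left_mem_uIcc
    have m2 : y ∈ Set.uIcc x y := Set.right_mem_uIcc
    have m3 : z ∈ Set.uIcc x y := Set.mem_uIcc_of_le b1.le b2.le
    rcases h5 with h5 | h5
    · exact absurd (h5 m3 m2 b2.le) (not_le.2 l2)
    · exact absurd (h5 m1 m3 b1.le) (not_le.2 l1)
  have k1 := key _ _ h1 h2 rfl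
  have k2 := key _ _ h2 h1 (Set.uIcc_comm _ _)
  rcases lt_or_ge (g * U.h ^ 3) (q ^ 2) with a | a
  · exact Or.inr ⟨a.le, not_lt.1 fun b => k1 ⟨a, b⟩⟩
  · rcases lt_or_ge (g * V.h ^ 3) (q ^ 2) with b | b
    · exact Or.inr ⟨not_lt.1 fun c => k2 ⟨b, c⟩, b.le⟩
    · exact Or.inl ⟨a, b⟩

theorem bottom_eq_of_head (hg : 0 < g) (hV : 0 < V.h) (hq : V.h * V.u = U.h * U.u)
    (he : energy g V + g * V.a = energy g U + g * U.a) : V.a = bottomAlong g U V.h := by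
  rw [bottomAlong_eq hg U hV.ne', ← hq, ← energy_eq_specEnergy hV.ne']
  field_simp; linarith

theorem isContact_of_subcritical (hg : 0 < g) (hU : 0 < U.h) (hV : 0 < V.h)
    (hq : V.h * V.u = U.h * U.u) (he : energy g V + g * V.a = energy g U + g * U.a)
    (sU : U.u ^ 2 ≤ g * U.h) (sV : V.u ^ 2 ≤ g * V.h) : IsContact g U V := by
  refine ⟨hU, hV, hq, bottom_eq_of_head hg hV hq he, Or.inr ?_⟩
  have hm : 0 < min U.h V.h := lt_min hU hV
  rw [← discharge_sq_le_iff hU] at sU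
  rw [← discharge_sq_le_iff hV, hq] at sV
  have sm : (U.h * U.u) ^ 2 ≤ g * (min U.h V.h) ^ 3 := by
    rcases min_choice U.h V.h with h | h <;> rw [h] <;> assumption
  intro x hx y hy hxy
  have hx0 : 0 < x := hm.trans_le hx.1
  rw [bottomAlong_eq hg U hx0.ne', bottomAlong_eq hg U (hx0.trans_le hxy).ne']
  have : specEnergy g (U.h * U.u) x ≤ specEnergy g (U.h * U.u) y :=
    specEnergy_le_of_subcritical hg hx0 (sm.trans (by gcongr; exact hx.1)) hxy
  gcongr

theorem isContact_of_supercritical (hg : 0 < g) (hU : 0 < U.h) (hV : 0 < V.h)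
    (hq : V.h * V.u = U.h * U.u) (he : energy g V + g * V.a = energy g U + g * U.a)
    (sU : g * U.h ≤ U.u ^ 2) (sV : g * V.h ≤ V.u ^ 2) : IsContact g U V := by
  refine ⟨hU, hV, hq, bottom_eq_of_head hg hV hq he, Or.inl ?_⟩
  have hm : 0 < min U.h V.h := lt_min hU hV
  rw [← le_discharge_sq_iff hU] at sU
  rw [← le_discharge_sq_iff hV, hq] at sV
  have sm : g * (max U.h V.h) ^ 3 ≤ (U.h * U.u) ^ 2 := by
    rcases max_choice U.h V.h with h | h <;> rw [h] <;> assumption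
  intro x hx y hy hxy
  have hx0 : 0 < x := hm.trans_le hx.1
  have hy0 := hx0.trans_le hxy
  rw [bottomAlong_eq hg U hx0.ne', bottomAlong_eq hg U hy0.ne']
  have : specEnergy g (U.h * U.u) y ≤ specEnergy g (U.h * U.u) x :=
    specEnergy_le_of_supercritical hg hx0 (le_trans (by gcongr; exact hy.2) sm) hxy
  gcongr

/-- The converse of `IsContact.head` and `IsContact.side`. Contacts can thus be handled through
discharge, head and side of criticality, without the monotonicity condition. -/
theorem isContact_of_side (hg : 0 < g) (hU : 0 < U.h) (hV : 0 < V.h)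
    (hq : V.h * V.u = U.h * U.u) (he : energy g V + g * V.a = energy g U + g * U.a)
    (h : (U.u ^ 2 ≤ g * U.h ∧ V.u ^ 2 ≤ g * V.h) ∨ (g * U.h ≤ U.u ^ 2 ∧ g * V.h ≤ V.u ^ 2)) :
    IsContact g U V :=
  h.elim (fun h => isContact_of_subcritical hg hU hV hq he h.1 h.2)
    fun h => isContact_of_supercritical hg hU hV hq he h.1 h.2

/-- Two states with the same discharge and energy on the same side of criticality coincide. -/
theorem height_eq_of_side (hg : 0 < g) (hU : 0 < U.h) (hV : 0 < V.h)
    (hq : V.h * V.u = U.h * U.u) (he : energy g V = energy g U)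
    (h : (U.u ^ 2 ≤ g * U.h ∧ V.u ^ 2 ≤ g * V.h) ∨ (g * U.h ≤ U.u ^ 2 ∧ g * V.h ≤ V.u ^ 2)) :
    V.h = U.h := by
  rw [energy_eq_specEnergy hU.ne', energy_eq_specEnergy hV.ne', hq] at he
  rw [← discharge_sq_le_iff hU, ← discharge_sq_le_iff hV, ← le_discharge_sq_iff hU,
    ← le_discharge_sq_iff hV, hq] at h
  by_contra hne
  rcases lt_or_gt_of_ne hne with hlt | hlt <;> rcases h with ⟨a, b⟩ | ⟨a, b⟩
  · exact (specEnergy_lt_of_subcritical hg hV b hlt).ne he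
  · exact (specEnergy_lt_of_supercritical hg hV a hlt).ne he.symm
  · exact (specEnergy_lt_of_subcritical hg hU a hlt).ne he.symm
  · exact (specEnergy_lt_of_supercritical hg hU b hlt).ne he

theorem velocity_eq_of_height (hU : 0 < U.h) (hq : V.h * V.u = U.h * U.u) (hh : V.h = U.h) :
    V.u = U.u := by
  rw [hh] at hq; exact mul_left_cancel₀ hU.ne' hq

theorem eq_of_side (hg : 0 < g) (hU : 0 < U.h) (hV : 0 < V.h)
    (hq : V.h * V.u = U.h * U.u) (he : energy g V = energy g U) (ha : V.a = U.a)
    (h : (U.u ^ 2 ≤ g * U.h ∧ V.u ^ 2 ≤ g * V.h) ∨ (g * U.h ≤ U.u ^ 2 ∧ g * V.h ≤ V.u ^ 2)) :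
    V = U := by
  have hh := height_eq_of_side hg hU hV hq he h
  exact State.ext hh (velocity_eq_of_height hU hq hh) ha

/-- A stationary contact without change of the bottom level is trivial. -/
theorem IsContact.eq_of_bottom_eq (hg : 0 < g) (h : IsContact g U V) (ha : V.a = U.a) : V = U := by
  have he := h.head hg
  rw [ha] at he
  exact eq_of_side hg h.1 h.2.1 h.2.2.1 (by linarith) ha (h.side hg)

/-- The energy is minimal at the critical state of given discharge. -/
theorem energy_critical_le (hg : 0 < g) (hU : 0 < U.h) (hV : 0 < V.h) (hq : V.h * V.u = U.h * U.u)
    (hc : U.u ^ 2 = g * U.h) : energy g U ≤ energy g V := by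
  have c1 := (discharge_sq_le_iff hU).2 hc.le
  have c2 := (le_discharge_sq_iff hU).2 hc.ge
  rw [energy_eq_specEnergy hU.ne', energy_eq_specEnergy hV.ne', hq]
  rcases le_total U.h V.h with h | h
  · exact specEnergy_le_of_subcritical hg hU c1 h
  · exact specEnergy_le_of_supercritical hg hV c2 h

/-- The equality case of minimality at the critical state. It prevents a flow over a falling bottom,
whose energy does not decrease across a contact, from arriving at criticality from elsewhere. -/
theorem height_eq_of_energy_le_critical (hg : 0 < g) (hU : 0 < U.h) (hV : 0 < V.h)
    (hq : V.h * V.u = U.h * U.u) (hc : U.u ^ 2 = g * U.h) (he : energy g V ≤ energy g U) :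
    V.h = U.h := by
  refine height_eq_of_side hg hU hV hq (le_antisymm he (energy_critical_le hg hU hV hq hc)) ?_
  rcases le_total (V.u ^ 2) (g * V.h) with h | h
  · exact Or.inl ⟨hc.le, h⟩
  · exact Or.inr ⟨hc.ge, h⟩

/-- Two subcritical states of the same discharge are ordered by their energies. -/
theorem height_le_of_energy_le (hg : 0 < g) (hU : 0 < U.h) (hV : 0 < V.h)
    (hq : V.h * V.u = U.h * U.u) (sV : V.u ^ 2 ≤ g * V.h)
    (he : energy g U ≤ energy g V) : U.h ≤ V.h := by
  by_contra hlt
  rw [not_le] at hlt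
  rw [energy_eq_specEnergy hU.ne', energy_eq_specEnergy hV.ne', hq] at he
  rw [← discharge_sq_le_iff hV, hq] at sV
  exact absurd (specEnergy_lt_of_subcritical hg hV sV hlt) (not_lt.2 he)

theorem subcritical_iff (hg : 0 < g) (hU : 0 ≤ U.h) :
    U.u ^ 2 ≤ g * U.h ↔ lam1 g U ≤ 0 ∧ 0 ≤ lam2 g U := by
  rw [← cel_sq hg hU, sq_le_sq, abs_of_nonneg (cel_nonneg g U.h), abs_le, lam1_eq, lam2_eq]
  constructor
  · rintro ⟨a, b⟩; constructor <;> linarith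
  · rintro ⟨a, b⟩; constructor <;> linarith

theorem strictly_subcritical_iff (hg : 0 < g) (hU : 0 ≤ U.h) :
    U.u ^ 2 < g * U.h ↔ lam1 g U < 0 ∧ 0 < lam2 g U := by
  rw [← cel_sq hg hU, sq_lt_sq, abs_of_nonneg (cel_nonneg g U.h), abs_lt, lam1_eq, lam2_eq]
  constructor
  · rintro ⟨a, b⟩; constructor <;> linarith
  · rintro ⟨a, b⟩; constructor <;> linarith

theorem supercritical_of_lam1 (hg : 0 < g) (hU : 0 ≤ U.h) (h : 0 ≤ lam1 g U) :
    g * U.h ≤ U.u ^ 2 := by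
  rw [lam1_eq] at h; have := cel_nonneg g U.h
  rw [← cel_sq hg hU]; nlinarith

theorem supercritical_of_lam1_pos (hg : 0 < g) (hU : 0 ≤ U.h) (h : 0 < lam1 g U) :
    g * U.h < U.u ^ 2 := by
  rw [lam1_eq] at h; have := cel_nonneg g U.h
  rw [← cel_sq hg hU]; nlinarith

theorem supercritical_of_lam2_neg (hg : 0 < g) (hU : 0 ≤ U.h) (h : lam2 g U < 0) :
    g * U.h < U.u ^ 2 := by
  rw [lam2_eq] at h; have := cel_nonneg g U.h
  rw [← cel_sq hg hU]; nlinarith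

theorem lam1_nonneg_of_supercritical (hg : 0 < g) (hU : 0 ≤ U.h) (hu : 0 ≤ U.u)
    (h : g * U.h ≤ U.u ^ 2) : 0 ≤ lam1 g U := by
  rw [← cel_sq hg hU] at h
  rw [lam1_eq]; linarith [abs_le_of_sq_le_sq' h hu |>.2]

theorem lam1_pos_of_supercritical (hg : 0 < g) (hU : 0 ≤ U.h) (hu : 0 ≤ U.u)
    (h : g * U.h < U.u ^ 2) : 0 < lam1 g U := by
  rw [← cel_sq hg hU] at h
  rw [lam1_eq]; linarith [lt_of_pow_lt_pow_left₀ 2 hu h]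

theorem lam2_neg_of_supercritical (hg : 0 < g) (hU : 0 ≤ U.h) (hu : U.u ≤ 0)
    (h : g * U.h < U.u ^ 2) : lam2 g U < 0 := by
  have := lam1_pos_of_supercritical (U := mirror U) hg hU (by simpa using hu) (by simpa using h)
  simpa using this

end ShallowWater
end

noncomputable section

namespace ShallowWater

/-! ### Wave patterns as lists -/

/-- The waves of the list, each given by its kind and its right state, lead from `U` to `V`; their
speeds are arranged in nondecreasing order and lie between `x` and `b`. -/
def Arranged (g : ℝ) (R : WaveKind → State → State → Prop) :
    State → EReal → List (WaveKind × State) → State → EReal → Prop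
  | U, x, [], V, b => U = V ∧ x ≤ b
  | U, x, (k, W) :: L, V, b => R k U W ∧ x ≤ (speedLeft g k U W : ℝ) ∧
      Arranged g R W (speedRight g k U W : ℝ) L V b

/-- `W` is an admissible value at the speed `ξ` of a profile starting at `U` and consisting of the
waves of the list (no condition at the edges of the waves). -/
def ValueAt (g ξ : ℝ) (W : State) : State → List (WaveKind × State) → Prop
  | U, [] => W = U
  | U, (k, V) :: L => (ξ < speedLeft g k U V → W = U) ∧
      (speedLeft g k U V < ξ → ξ < speedRight g k U V → InFan g k U ξ W) ∧
      (speedRight g k U V < ξ → ValueAt g ξ W V L)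

/-- A wave across which the bottom level does not rise. -/
def IsWaveDown (g : ℝ) (k : WaveKind) (U V : State) : Prop := IsWave g k U V ∧ V.a ≤ U.a

variable {g : ℝ} {R : WaveKind → State → State → Prop} {U V W : State} {x b : EReal}
  {L : List (WaveKind × State)}

theorem Arranged.of_le {x' : EReal} (h : Arranged g R U x L V b) (hx : x' ≤ x) :
    Arranged g R U x' L V b := by
  cases L with
  | nil => exact ⟨h.1, hx.trans h.2⟩
  | cons p L => exact ⟨h.1, hx.trans h.2.1, h.2.2⟩

theorem Arranged.bounds_le (hg : 0 < g) (hR : ∀ k U V, R k U V → IsWave g k U V)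
    (h : Arranged g R U x L V b) : x ≤ b := by
  induction L generalizing U x with
  | nil => exact h.2
  | cons p L ih =>
    exact h.2.1.trans ((EReal.coe_le_coe_iff.2 (speedLeft_le_speedRight hg (hR _ _ _ h.1))).trans
      (ih h.2.2))

/-- Below the speeds of all waves the profile takes the left state. -/
theorem Arranged.valueAt_left (hg : 0 < g) (hR : ∀ k U V, R k U V → IsWave g k U V)
    (h : Arranged g R U x L V b) {ξ : ℝ} (hξ : (ξ : EReal) < x) : ValueAt g ξ U U L := by
  cases L with
  | nil => rfl
  | cons p L =>
    have h1 : ξ < speedLeft g p.1 U p.2 := EReal.coe_lt_coe_iff.1 (hξ.trans_le h.2.1)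
    have h2 := speedLeft_le_speedRight hg (hR _ _ _ h.1)
    exact ⟨fun _ => rfl, fun h3 => absurd h3 (by linarith), fun h3 => absurd h3 (by linarith)⟩

theorem fan_rare1 (hg : 0 < g) (h : IsRare1 g U V) {ξ : ℝ} (h1 : lam1 g U ≤ ξ)
    (h2 : ξ ≤ lam1 g V) : ∃ W, IsRare1 g U W ∧ lam1 g W = ξ := by
  have e := h.eq hg
  rw [lam1_eq] at h1 h2
  have c1 := cel_nonneg g V.h
  set c := (U.u + 2 * cel g U.h - ξ) / 3 with hc
  have hc0 : 0 ≤ c := by rw [hc]; linarith [h2]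
  refine ⟨⟨c ^ 2 / g, ξ + c, U.a⟩, ?_, ?_⟩
  · rw [isRare1_iff hg]
    refine ⟨h.1, by positivity, ?_, rfl, ?_⟩
    · apply le_of_cel_le hg h.1.le
      rw [cel_sq_div hg hc0, hc]; linarith
    · simp only [cel_sq_div hg hc0]; rw [hc]; ring
  · rw [lam1_eq]; simp only [cel_sq_div hg hc0]; ring

theorem fan_rare2 (hg : 0 < g) (h : IsRare2 g U V) {ξ : ℝ} (h2 : lam2 g U < ξ) :
    ∃ W, IsRare2 g U W ∧ lam2 g W = ξ := by
  have e := h.eq hg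
  rw [lam2_eq] at h2
  have c1 := cel_nonneg g U.h
  set c := (ξ - (U.u - 2 * cel g U.h)) / 3 with hc
  have hc0 : 0 < c := by rw [hc]; linarith
  refine ⟨⟨c ^ 2 / g, ξ - c, U.a⟩, ?_, ?_⟩
  · rw [isRare2_iff hg]
    refine ⟨by positivity, h.2.1, ?_, rfl, ?_⟩
    · apply le_of_cel_le hg (by positivity)
      rw [cel_sq_div hg hc0.le, hc]; linarith
    · simp only [cel_sq_div hg hc0.le]; rw [hc]; ring
  · rw [lam2_eq]; simp only [cel_sq_div hg hc0.le]; ring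

theorem exists_inFan (hg : 0 < g) {k : WaveKind} (h : IsWave g k U V) {ξ : ℝ}
    (h1 : speedLeft g k U V < ξ) (h2 : ξ < speedRight g k U V) : ∃ W, InFan g k U ξ W := by
  cases k with
  | shock1 => exact ⟨U, trivial⟩
  | shock2 => exact ⟨U, trivial⟩
  | rare1 => exact fan_rare1 hg h h1.le h2.le
  | rare2 => exact fan_rare2 hg h h1
  | contact => exact ⟨U, trivial⟩
  | dry => exact ⟨U, h.1, rfl⟩

theorem Arranged.exists_value (hg : 0 < g) (hR : ∀ k U V, R k U V → IsWave g k U V)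
    (h : Arranged g R U x L V b) (ξ : ℝ) : ∃ W, ValueAt g ξ W U L := by
  induction L generalizing U x with
  | nil => exact ⟨U, rfl⟩
  | cons p L ih =>
    obtain ⟨k, V'⟩ := p
    have h2 := speedLeft_le_speedRight hg (hR _ _ _ h.1)
    rcases lt_or_ge ξ (speedLeft g k U V') with h3 | h3
    · exact ⟨U, fun _ => rfl, fun h4 => absurd h4 (by linarith), fun h4 => absurd h4 (by linarith)⟩
    rcases lt_or_ge (speedRight g k U V') ξ with h4 | h4
    · obtain ⟨W, hW⟩ := ih h.2.2
      exact ⟨W, fun h5 => absurd h5 (by linarith), fun _ h5 => absurd h5 (by linarith),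
        fun _ => hW⟩
    by_cases h5 : speedLeft g k U V' < ξ ∧ ξ < speedRight g k U V'
    · obtain ⟨W, hW⟩ := exists_inFan hg (hR _ _ _ h.1) h5.1 h5.2
      exact ⟨W, fun h5 => absurd h5 (by linarith), fun _ _ => hW, fun h5 => absurd h5 (by linarith)⟩
    · exact ⟨U, fun h6 => absurd h6 (by linarith), fun h6 h7 => absurd ⟨h6, h7⟩ h5,
        fun h6 => absurd h6 (by linarith)⟩

/-- The states of a list of waves. -/
def stateOf (U : State) : List (WaveKind × State) → ℕ → State
  | _, 0 => U
  | [], _ + 1 => U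
  | p :: L, i + 1 => stateOf p.2 L i

/-- The kinds of a list of waves. -/
def kindOf : List (WaveKind × State) → ℕ → WaveKind
  | [], _ => .dry
  | p :: _, 0 => p.1
  | _ :: L, i + 1 => kindOf L i

@[simp] theorem stateOf_zero (U : State) (L : List (WaveKind × State)) : stateOf U L 0 = U := by
  cases L <;> rfl

theorem Arranged.finish (h : Arranged g R U x L V b) : stateOf U L L.length = V := by
  induction L generalizing U x with
  | nil => exact h.1
  | cons p L ih => exact ih h.2.2

theorem Arranged.wave (h : Arranged g R U x L V b) :
    ∀ i < L.length, R (kindOf L i) (stateOf U L i) (stateOf U L (i + 1)) := by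
  induction L generalizing U x with
  | nil => intro i hi; simp at hi
  | cons p L ih =>
    intro i hi
    cases i with
    | zero => simpa [stateOf, kindOf] using h.1
    | succ i => exact ih h.2.2 i (by simpa using hi)

theorem Arranged.le_speedLeft (hg : 0 < g) (hR : ∀ k U V, R k U V → IsWave g k U V)
    (h : Arranged g R U x L V b) :
    ∀ i < L.length, x ≤ (speedLeft g (kindOf L i) (stateOf U L i) (stateOf U L (i + 1)) : ℝ) := by
  induction L generalizing U x with
  | nil => intro i hi; simp at hi
  | cons p L ih =>
    intro i hi
    cases i with
    | zero => simpa [stateOf, kindOf] using h.2.1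
    | succ i =>
      refine le_trans (h.2.1.trans ?_) (ih h.2.2 i (by simpa using hi))
      exact EReal.coe_le_coe_iff.2 (speedLeft_le_speedRight hg (hR _ _ _ h.1))

theorem Arranged.ordered (hg : 0 < g) (hR : ∀ k U V, R k U V → IsWave g k U V)
    (h : Arranged g R U x L V b) : ∀ i, i + 1 < L.length →
    speedRight g (kindOf L i) (stateOf U L i) (stateOf U L (i + 1)) ≤
      speedLeft g (kindOf L (i + 1)) (stateOf U L (i + 1)) (stateOf U L (i + 2)) := by
  induction L generalizing U x with
  | nil => intro i hi; simp at hi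
  | cons p L ih =>
    intro i hi
    cases i with
    | zero =>
      have := h.2.2.le_speedLeft hg hR 0 (by simpa using hi)
      simpa [stateOf, kindOf] using EReal.coe_le_coe_iff.1 this
    | succ i => exact ih h.2.2 i (by simpa using hi)

theorem Arranged.const (hg : 0 < g) (hR : ∀ k U V, R k U V → IsWave g k U V)
    (h : Arranged g R U x L V b) {ξ : ℝ} {W : State} (hW : ValueAt g ξ W U L) :
    ∀ i ≤ L.length,
      (∀ j, j + 1 = i → speedRight g (kindOf L j) (stateOf U L j) (stateOf U L (j + 1)) < ξ) →
      (i < L.length → ξ < speedLeft g (kindOf L i) (stateOf U L i) (stateOf U L (i + 1))) →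
      W = stateOf U L i := by
  induction L generalizing U x with
  | nil =>
    intro i hi _ _
    obtain rfl : i = 0 := by simpa using hi
    exact hW
  | cons p L ih =>
    intro i hi h1 h2
    cases i with
    | zero => exact hW.1 (by simpa [stateOf, kindOf] using h2 (by simp))
    | succ i =>
      have h3 : speedRight g p.1 U p.2 < ξ := by
        cases i with
        | zero => simpa [stateOf, kindOf] using h1 0 rfl
        | succ i =>
          have h4 := h.2.2.le_speedLeft hg hR i (by simpa using hi)
          have h5 := speedLeft_le_speedRight hg (hR _ _ _ (h.2.2.wave i (by simpa using hi)))
          have h6 := h1 (i + 1) rfl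
          exact (EReal.coe_le_coe_iff.1 h4).trans_lt (h5.trans_lt h6)
      refine ih h.2.2 (hW.2.2 h3) i (by simpa using hi) (fun j hj => ?_) fun hi' => ?_
      · exact h1 (j + 1) (by omega)
      · exact h2 (by simpa using hi')

theorem Arranged.fan (hg : 0 < g) (hR : ∀ k U V, R k U V → IsWave g k U V)
    (h : Arranged g R U x L V b) {ξ : ℝ} {W : State} (hW : ValueAt g ξ W U L) :
    ∀ i < L.length, speedLeft g (kindOf L i) (stateOf U L i) (stateOf U L (i + 1)) < ξ →
      ξ < speedRight g (kindOf L i) (stateOf U L i) (stateOf U L (i + 1)) →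
      InFan g (kindOf L i) (stateOf U L i) ξ W := by
  induction L generalizing U x with
  | nil => intro i hi; simp at hi
  | cons p L ih =>
    intro i hi h1 h2
    cases i with
    | zero =>
      simp only [stateOf, kindOf, stateOf_zero] at h1 h2 ⊢
      exact hW.2.1 h1 h2
    | succ i =>
      have h4 := h.2.2.le_speedLeft hg hR i (by simpa using hi)
      exact ih h.2.2 (hW.2.2 ((EReal.coe_le_coe_iff.1 h4).trans_lt h1)) i (by simpa using hi) h1 h2

/-- When no wave raises the bottom, the total variation of the bottom telescopes to U.a - V.a, so
the variation criterion is automatic. -/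
theorem Arranged.exists_solution (hg : 0 < g) (h : Arranged g (IsWaveDown g) U ⊥ L V ⊤) :
    ∃ v, IsRiemannSolution g U V v := by
  have hR : ∀ k U V, IsWaveDown g k U V → IsWave g k U V := fun _ _ _ h => h.1
  choose v hv using fun ξ => h.exists_value hg hR ξ
  refine ⟨v, L.length, stateOf U L, kindOf L, stateOf_zero _ _, h.finish, fun i hi =>
    (h.wave i hi).1, h.ordered hg hR, ?_, fun i hi ξ => h.const hg hR (hv ξ) i hi,
    fun i hi ξ => h.fan hg hR (hv ξ) i hi⟩
  have e : ∀ i ∈ Finset.range L.length, |(stateOf U L (i + 1)).a - (stateOf U L i).a|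
      = (stateOf U L i).a - (stateOf U L (i + 1)).a := fun i hi => by
    rw [abs_of_nonpos (by linarith [(h.wave i (Finset.mem_range.1 hi)).2]), neg_sub]
  rw [Finset.sum_congr rfl e, Finset.sum_range_sub', h.finish, stateOf_zero, ← neg_sub V.a]
  exact neg_le_abs _

/-- The sum of |Δa| + Δa over the waves is at most |a_R - a_L| + (a_R - a_L) = 0. Each summand is
nonnegative and hence zero. -/
theorem IsWavePattern.isWaveDown {UL UR : State} {n : ℕ} {U : ℕ → State} {k : ℕ → WaveKind}
    {v : ℝ → State} (h : IsWavePattern g UL UR n U k v) (ha : UR.a ≤ UL.a) :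
    ∀ i < n, IsWaveDown g (k i) (U i) (U (i + 1)) := by
  have h1 : ∑ i ∈ Finset.range n, (|(U (i + 1)).a - (U i).a| + ((U (i + 1)).a - (U i).a)) ≤ 0 := by
    rw [Finset.sum_add_distrib, Finset.sum_range_sub (fun i => (U i).a), h.start, h.finish]
    have := h.variation
    rw [abs_of_nonpos (sub_nonpos.2 ha)] at this
    linarith
  have h0 : ∀ i ∈ Finset.range n, 0 ≤ |(U (i + 1)).a - (U i).a| + ((U (i + 1)).a - (U i).a) :=
    fun i _ => by linarith [neg_abs_le ((U (i + 1)).a - (U i).a)]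
  intro i hi
  refine ⟨h.wave i hi, ?_⟩
  have := (Finset.sum_eq_zero_iff_of_nonneg h0).1 (le_antisymm h1 (Finset.sum_nonneg h0)) i
    (Finset.mem_range.2 hi)
  linarith [abs_nonneg ((U (i + 1)).a - (U i).a)]

theorem IsWavePattern.exists_list {UL UR : State} {n : ℕ} {U : ℕ → State} {k : ℕ → WaveKind}
    {v : ℝ → State} (h : IsWavePattern g UL UR n U k v)
    (hR : ∀ i < n, R (k i) (U i) (U (i + 1))) :
    ∃ L, Arranged g R UL ⊥ L UR ⊤ ∧ ∀ ξ, ValueAt g ξ (v ξ) UL L := by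
  -- Induction on the number m of waves still lying to the right of the i-th state, so that the list
  -- is built from its end.
  have key : ∀ m i, i + m = n → ∃ L,
      (∀ x : EReal, (i < n → x ≤ (speedLeft g (k i) (U i) (U (i + 1)) : ℝ)) →
        Arranged g R (U i) x L UR ⊤) ∧
      ∀ ξ, (∀ j, j + 1 = i → speedRight g (k j) (U j) (U (j + 1)) < ξ) →
        ValueAt g ξ (v ξ) (U i) L := by
    intro m
    induction m with
    | zero =>
      intro i hi
      obtain rfl : i = n := by simpa using hi
      exact ⟨[], fun x _ => ⟨h.finish, le_top⟩, fun ξ hξ =>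
        h.const i le_rfl ξ hξ fun h => absurd h (lt_irrefl _)⟩
    | succ m ih =>
      intro i hi
      have hin : i < n := by omega
      obtain ⟨L, h1, h2⟩ := ih (i + 1) (by omega)
      refine ⟨(k i, U (i + 1)) :: L, fun x hx => ⟨hR i hin, hx hin, h1 _ fun hi' =>
        EReal.coe_le_coe_iff.2 (h.ordered i hi')⟩, fun ξ hξ => ⟨fun h3 =>
        h.const i hin.le ξ hξ fun _ => h3, h.fan i hin ξ, fun h3 => h2 ξ ?_⟩⟩
      intro j hj
      obtain rfl : j = i := by omega
      exact h3
  obtain ⟨L, h1, h2⟩ := key n 0 (by simp)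
  rw [h.start] at h1 h2
  exact ⟨L, h1 ⊥ fun _ => bot_le, fun ξ => h2 ξ fun j hj => by omega⟩

theorem IsRiemannSolution.exists_list {UL UR : State} {v : ℝ → State}
    (h : IsRiemannSolution g UL UR v) (ha : UR.a ≤ UL.a) :
    ∃ L, Arranged g (IsWaveDown g) UL ⊥ L UR ⊤ ∧ ∀ ξ, ValueAt g ξ (v ξ) UL L := by
  obtain ⟨n, U, k, h⟩ := h
  exact h.exists_list (h.isWaveDown ha)

/-! ### Reflection of solutions -/

/-- The kind of the reflected wave. -/
def mirrorKind : WaveKind → WaveKind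
  | .shock1 => .shock2
  | .shock2 => .shock1
  | .rare1 => .rare2
  | .rare2 => .rare1
  | .contact => .contact
  | .dry => .dry

theorem IsContact.mirror (hg : 0 < g) (h : IsContact g U V) :
    IsContact g (mirror V) (mirror U) := by
  have he := h.head hg
  have hs := h.side hg
  obtain ⟨h1, h2, h3, -, -⟩ := h
  refine isContact_of_side hg h2 h1 (by simp [h3]) (by simp [he]) ?_
  simpa only [mirror_u, mirror_h, neg_sq, and_comm] using hs

theorem isWave_mirror (hg : 0 < g) {k : WaveKind} (h : IsWave g k U V) :
    IsWave g (mirrorKind k) (mirror V) (mirror U) := by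
  cases k with
  | shock1 => exact isShock2_mirror.2 h
  | shock2 => exact isShock1_mirror.2 h
  | rare1 => exact isRare2_mirror.2 h
  | rare2 => exact isRare1_mirror.2 h
  | contact => exact IsContact.mirror hg h
  | dry => exact ⟨h.2.1, h.1, h.2.2.1.symm, neg_le_neg h.2.2.2⟩

theorem speedLeft_mirror (k : WaveKind) :
    speedLeft g (mirrorKind k) (mirror V) (mirror U) = -speedRight g k U V := by
  cases k <;> simp [mirrorKind, speedLeft, speedRight, shockSpeed_mirror]

theorem speedRight_mirror (k : WaveKind) :
    speedRight g (mirrorKind k) (mirror V) (mirror U) = -speedLeft g k U V := by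
  cases k <;> simp [mirrorKind, speedLeft, speedRight, shockSpeed_mirror]

/-- `InFan` anchors a fan at its left state, which after reflection is the former right state V. The
strict bound of ξ by the right edge separates the heights of W and V strictly, which supplies the
required positive height. -/
theorem inFan_mirror (hg : 0 < g) {k : WaveKind} (h : IsWave g k U V) {ξ : ℝ}
    (h1 : speedLeft g k U V < ξ) (h2 : ξ < speedRight g k U V) (hW : InFan g k U ξ W) :
    InFan g (mirrorKind k) (mirror V) (-ξ) (mirror W) := by
  cases k with
  | shock1 => trivial
  | shock2 => trivial
  | contact => trivial
  | dry => exact ⟨hW.1, hW.2.trans h.2.2.1.symm⟩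
  | rare1 =>
    obtain ⟨hW, rfl⟩ := hW
    refine ⟨isRare2_mirror.2 ?_, by simp⟩
    have hV : IsRare1 g U V := h
    have e := hV.eq hg
    have e' := hW.eq hg
    simp only [speedRight, lam1_eq] at h2
    have hlt : cel g V.h < cel g W.h := by linarith
    have hlt' := lt_of_cel_lt hg hlt
    rw [isRare1_iff hg]
    exact ⟨hV.2.1.trans_lt hlt', hV.2.1, hlt'.le, hV.2.2.2.1.trans hW.2.2.2.1.symm, by linarith⟩
  | rare2 =>
    obtain ⟨hW, rfl⟩ := hW
    refine ⟨isRare1_mirror.2 ?_, by simp⟩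
    have hV : IsRare2 g U V := h
    have e := hV.eq hg
    have e' := hW.eq hg
    simp only [speedRight, lam2_eq] at h2
    have hlt : cel g W.h < cel g V.h := by linarith
    have hlt' := lt_of_cel_lt hg hlt
    rw [isRare2_iff hg]
    exact ⟨hV.1, hW.1.le, hlt'.le, hV.2.2.2.1.trans hW.2.2.2.1.symm, by linarith⟩

/-- Reversing the order of the waves and negating their speeds exchanges the two families. This
reduces rising bottoms to falling ones. -/
theorem IsRiemannSolution.mirror (hg : 0 < g) {UL UR : State} {v : ℝ → State}
    (h : IsRiemannSolution g UL UR v) :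
    IsRiemannSolution g (mirror UR) (mirror UL) fun ξ => mirror (v (-ξ)) := by
  obtain ⟨n, U, k, h⟩ := h
  have idx : ∀ i < n, n - i = (n - 1 - i) + 1 := fun i hi => by omega
  have idx' : ∀ i, n - (i + 1) = n - 1 - i := fun i => by omega
  refine ⟨n, fun i => ShallowWater.mirror (U (n - i)), fun i => mirrorKind (k (n - 1 - i)),
    by simp [h.finish], by simp [h.start], fun i hi => ?_, fun i hi => ?_, ?_, ?_, ?_⟩
  · simp only [idx i hi, idx' i]
    exact isWave_mirror hg (h.wave _ (by omega))
  · have e1 : n - i = (n - 2 - i) + 2 := by omega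
    have e2 : n - (i + 1) = (n - 2 - i) + 1 := by omega
    have e3 : n - (i + 2) = n - 2 - i := by omega
    have e4 : n - 1 - i = (n - 2 - i) + 1 := by omega
    have e5 : n - 1 - (i + 1) = n - 2 - i := by omega
    simp only [e1, e2, e3, e4, e5]
    rw [speedLeft_mirror, speedRight_mirror]
    exact neg_le_neg (h.ordered _ (by omega))
  · have e := Finset.sum_range_reflect (fun i => |(U (i + 1)).a - (U i).a|) n
    have hv := h.variation
    rw [← e] at hv
    simp only [mirror_a]
    rw [abs_sub_comm UL.a]
    refine le_trans (le_of_eq (Finset.sum_congr rfl fun i hi => ?_)) hv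
    rw [idx i (Finset.mem_range.1 hi), idx' i, abs_sub_comm]
  · intro i hi ξ h1 h2
    congr 1
    refine h.const (n - i) (by omega) (-ξ) (fun j hj => ?_) fun hlt => ?_
    · have hin : i < n := by omega
      have := h2 hin
      simp only [idx i hin, idx' i] at this
      obtain rfl : j = n - 1 - i := by omega
      rw [speedLeft_mirror] at this
      linarith
    · obtain ⟨j, rfl⟩ : ∃ j, i = j + 1 := ⟨i - 1, by omega⟩
      have := h1 j rfl
      have e1 : n - j = (n - (j + 1)) + 1 := by omega
      simp only [idx' j, e1] at this
      rw [speedRight_mirror] at this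
      rw [idx' j]
      linarith
  · intro i hi ξ h1 h2
    simp only [idx i hi, idx' i] at h1 h2 ⊢
    rw [speedLeft_mirror] at h1
    rw [speedRight_mirror] at h2
    have := inFan_mirror hg (h.wave (n - 1 - i) (by omega)) (ξ := -ξ) (by linarith) (by linarith)
      (h.fan (n - 1 - i) (by omega) (-ξ) (by linarith) (by linarith))
    rwa [neg_neg] at this

theorem SameSolution.mirror {v w : ℝ → State}
    (h : SameSolution (fun ξ => mirror (v (-ξ))) fun ξ => mirror (w (-ξ))) : SameSolution v w := by
  have := (MeasureTheory.Measure.measurePreserving_neg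
    (MeasureTheory.volume : MeasureTheory.Measure ℝ)).quasiMeasurePreserving.ae h
  filter_upwards [this] with ξ hξ
  simpa using hξ

end ShallowWater
end

noncomputable section

namespace ShallowWater

/-! ### Classical wave patterns: 1-waves, dry zones and 2-waves -/

/-- A wave other than a stationary contact. -/
def IsClassicalWave (g : ℝ) (k : WaveKind) (U V : State) : Prop :=
  IsWave g k U V ∧ k ≠ .contact

/-- The dry state behind the complete 1-rarefaction starting at `U`. -/
def dryRight (g : ℝ) (U : State) : State := ⟨0, U.u + 2 * cel g U.h, U.a⟩

/-- The dry state in front of the complete 2-rarefaction ending at `U`. -/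
def dryLeft (g : ℝ) (U : State) : State := ⟨0, U.u - 2 * cel g U.h, U.a⟩

/-- The classical pattern `L` from `U` to `V` is a 1-wave to the wet state `M` followed by a
2-wave. -/
structure Through (g : ℝ) (U : State) (x : EReal) (L : List (WaveKind × State)) (V : State)
    (b : EReal) (M : State) : Prop where
  left_pos : 0 < U.h
  pos : 0 < M.h
  bottom : M.a = U.a
  bottom_right : V.a = U.a
  onW1 : Psi1 g M U = 0
  onW2 : Phi2 g M V = 0
  left : M = U ∨ x ≤ (speedLeft g (kind1 U M) U M : ℝ) ∧ (speedRight g (kind1 U M) U M : ℝ) ≤ b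
  right : M = V ∨ x ≤ (speedLeft g (kind2 M V) M V : ℝ) ∧ (speedRight g (kind2 M V) M V : ℝ) ≤ b
  value : ∀ᶠ ξ in Filter.cofinite, ∀ W, ValueAt g ξ W U L →
    ValueAt g ξ W U [(kind1 U M, M), (kind2 M V, V)]

/-- The classical pattern `L` from `U` to `V` is a 1-rarefaction, a dry zone and a
2-rarefaction. -/
structure ThroughDry (g : ℝ) (U : State) (x : EReal) (L : List (WaveKind × State)) (V : State)
    (b : EReal) : Prop where
  left_pos : 0 < U.h
  bottom_right : V.a = U.a
  gap : U.u + 2 * cel g U.h ≤ V.u - 2 * cel g V.h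
  left : x ≤ (lam1 g U : ℝ)
  right : (lam2 g V : ℝ) ≤ b
  value : ∀ᶠ ξ in Filter.cofinite, ∀ W, ValueAt g ξ W U L →
    ValueAt g ξ W U [(.rare1, dryRight g U), (.dry, dryLeft g V), (.rare2, V)]

/-- The classical pattern `L` from the dry state `U` to `V` is a dry zone followed by a
2-rarefaction. -/
structure FromDry (g : ℝ) (U : State) (x : EReal) (L : List (WaveKind × State)) (V : State)
    (b : EReal) : Prop where
  dry : U.h = 0
  bottom_right : V.a = U.a
  gap : U.u ≤ V.u - 2 * cel g V.h
  left : x ≤ (U.u : ℝ)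
  right : (lam2 g V : ℝ) ≤ b
  value : ∀ᶠ ξ in Filter.cofinite, ∀ W, ValueAt g ξ W U L →
    ValueAt g ξ W U [(.dry, dryLeft g V), (.rare2, V)]

variable {g : ℝ} {U V W M U' : State} {x b : EReal} {L L' : List (WaveKind × State)} {ξ : ℝ}

theorem lam1_lt_lam2 (hg : 0 < g) (hU : 0 < U.h) : lam1 g U < lam2 g U := by
  rw [lam1_eq, lam2_eq]; linarith [cel_pos hg hU]

theorem velocity_lt_speedLeft_kind2 (hg : 0 < g) (hU : 0 < U.h) (h : IsWave g (kind2 U V) U V) :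
    U.u < speedLeft g (kind2 U V) U V := by
  unfold kind2 at *
  split_ifs at * with hh
  · exact IsShock2.left_lt_speed hg h
  · simp only [speedLeft, lam2_eq]; linarith [cel_pos hg hU]

theorem lam1_lt_speedLeft_kind2 (hg : 0 < g) (hU : 0 < U.h) (h : IsWave g (kind2 U V) U V) :
    lam1 g U < speedLeft g (kind2 U V) U V := by
  have := velocity_lt_speedLeft_kind2 hg hU h
  rw [lam1_eq]; linarith [cel_nonneg g U.h]

theorem speedRight_kind1_lt_velocity (hg : 0 < g) (hV : 0 < V.h) (h : IsWave g (kind1 U V) U V) :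
    speedRight g (kind1 U V) U V < V.u := by
  unfold kind1 at *
  split_ifs at * with hh
  · exact IsShock1.speed_lt_right hg h
  · simp only [speedRight, lam1_eq]; linarith [cel_pos hg hV]

theorem speedLeft_kind1_le (hg : 0 < g) (h : IsWave g (kind1 U V) U V) :
    speedLeft g (kind1 U V) U V ≤ lam1 g U := by
  unfold kind1 at *
  split_ifs at * with hh
  · exact (IsShock1.speed_lt_lam1 hg h).le
  · exact le_rfl

theorem speedLeft_kind2_le (hg : 0 < g) (h : IsWave g (kind2 U V) U V) :
    speedLeft g (kind2 U V) U V ≤ lam2 g U := by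
  unfold kind2 at *
  split_ifs at * with hh
  · exact (IsShock2.speed_lt_lam2 hg h).le
  · exact le_rfl

theorem lam1_le_speedRight_kind1 (hg : 0 < g) (h : IsWave g (kind1 U V) U V) :
    lam1 g V ≤ speedRight g (kind1 U V) U V := by
  unfold kind1 at *
  split_ifs at * with hh
  · exact (IsShock1.lam1_lt_speed hg h).le
  · exact le_rfl

theorem lam2_le_speedRight_kind2 (hg : 0 < g) (h : IsWave g (kind2 U V) U V) :
    lam2 g V ≤ speedRight g (kind2 U V) U V := by
  unfold kind2 at *
  split_ifs at * with hh
  · exact (IsShock2.lam2_lt_speed hg h).le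
  · exact le_rfl

/-! #### Simplification of lists of waves -/

theorem ValueAt.cons_map {k : WaveKind} (h : ValueAt g ξ W U ((k, V) :: L))
    (hL : speedRight g k U V < ξ → ValueAt g ξ W V L → ValueAt g ξ W V L') :
    ValueAt g ξ W U ((k, V) :: L') :=
  ⟨h.1, h.2.1, fun h' => hL h' (h.2.2 h')⟩

theorem valueAt_cons_of_lt {k : WaveKind} (h1 : ξ < speedLeft g k U V)
    (h2 : speedLeft g k U V ≤ speedRight g k U V) : ValueAt g ξ U U ((k, V) :: L) :=
  ⟨fun _ => rfl, fun h => absurd h (by linarith), fun h => absurd h (by linarith)⟩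

theorem ValueAt.insert_rare1 {k : WaveKind} (h : ValueAt g ξ W U ((k, V) :: L))
    (hs : lam1 g U < speedLeft g k U V) : ValueAt g ξ W U ((.rare1, U) :: (k, V) :: L) :=
  ⟨fun h' => h.1 (lt_trans h' hs), fun h1 h2 => absurd h1 (not_lt.2 h2.le), fun _ => h⟩

theorem ValueAt.drop_rare1 {k : WaveKind} (h : ValueAt g ξ W U ((.rare1, U) :: (k, V) :: L))
    (hs : lam1 g U < speedLeft g k U V) (hs' : speedLeft g k U V ≤ speedRight g k U V)
    (hξ : ξ ≠ lam1 g U) : ValueAt g ξ W U ((k, V) :: L) := by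
  rcases lt_or_gt_of_ne hξ with h1 | h1
  · obtain rfl : W = U := h.1 h1
    exact valueAt_cons_of_lt (h1.trans hs) hs'
  · exact h.2.2 h1

theorem ValueAt.merge_rare1 (hg : 0 < g) (h1 : IsRare1 g U U') (h2 : IsRare1 g U' V)
    (hξ : ξ ≠ lam1 g U') (h : ValueAt g ξ W U ((.rare1, U') :: (.rare1, V) :: L)) :
    ValueAt g ξ W U ((.rare1, V) :: L) := by
  have l1 := h1.lam1_le hg
  have l2 := h2.lam1_le hg
  refine ⟨h.1, fun a b => ?_, fun a => (h.2.2 (l2.trans_lt a)).2.2 a⟩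
  rcases lt_or_gt_of_ne hξ with c | c
  · exact h.2.1 a c
  · obtain ⟨h3, h4⟩ := (h.2.2 c).2.1 c b
    exact ⟨h1.trans hg h3, h4⟩

theorem ValueAt.merge_rare2 (hg : 0 < g) (h1 : IsRare2 g U U') (h2 : IsRare2 g U' V)
    (hξ : ξ ≠ lam2 g U') (h : ValueAt g ξ W U ((.rare2, U') :: (.rare2, V) :: L)) :
    ValueAt g ξ W U ((.rare2, V) :: L) := by
  have l1 := h1.lam2_le hg
  have l2 := h2.lam2_le hg
  refine ⟨h.1, fun a b => ?_, fun a => (h.2.2 (l2.trans_lt a)).2.2 a⟩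
  rcases lt_or_gt_of_ne hξ with c | c
  · exact h.2.1 a c
  · obtain ⟨h3, h4⟩ := (h.2.2 c).2.1 c b
    exact ⟨h1.trans hg h3, h4⟩

theorem ValueAt.merge_dry (h1 : IsDryZone U U') (h2 : IsDryZone U' V)
    (hξ : ξ ≠ U'.u) (h : ValueAt g ξ W U ((.dry, U') :: (.dry, V) :: L)) :
    ValueAt g ξ W U ((.dry, V) :: L) := by
  refine ⟨h.1, fun a b => ?_, fun a => (h.2.2 (h2.2.2.2.trans_lt a)).2.2 a⟩
  rcases lt_or_gt_of_ne hξ with c | c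
  · exact h.2.1 a c
  · obtain ⟨h3, h4⟩ := (h.2.2 c).2.1 c b
    exact ⟨h3, h4.trans h1.2.2.1⟩

/-! #### Attaching a wave on the left -/

theorem Through.wave_left (h : Through g U x L V b M) : IsWave g (kind1 U M) U M :=
  isWave_kind1 h.left_pos h.pos.le h.bottom h.onW1

theorem Through.wave_right (hV : 0 < V.h) (h : Through g U x L V b M) :
    IsWave g (kind2 M V) M V :=
  isWave_kind2 h.pos.le hV (h.bottom_right.trans h.bottom.symm) h.onW2

/-- A 1-wave never starts faster than λ₁(U). If all speeds exceed λ₁(U), only the trivial 1-wave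
remains. -/
theorem Through.eq_left_of_lam1_lt (hg : 0 < g) {y : ℝ} (h : Through g U y L V b M)
    (hy : lam1 g U < y) : M = U :=
  h.left.resolve_right fun h' => absurd (EReal.coe_le_coe_iff.1 h'.1)
    (not_le.2 ((speedLeft_kind1_le hg h.wave_left).trans_lt hy))

theorem Through.eq_right_of_lam2_lt (hg : 0 < g) (hV : 0 < V.h) {y : ℝ}
    (h : Through g U y L V b U) (hy : lam2 g U < y) : U = V :=
  h.right.resolve_right fun h' => absurd (EReal.coe_le_coe_iff.1 h'.1)
    (not_le.2 ((speedLeft_kind2_le hg (h.wave_right hV)).trans_lt hy))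

theorem Through.value_trivial (hg : 0 < g) (hV : 0 < V.h) (h : Through g U x L V b U) :
    ∀ᶠ ξ in Filter.cofinite, ∀ W, ValueAt g ξ W U L → ValueAt g ξ W U [(kind2 U V, V)] := by
  filter_upwards [h.value, Filter.eventually_cofinite_ne (lam1 g U)] with ξ h1 h2 W hW
  have h3 := h1 W hW
  rw [kind1_self] at h3
  exact h3.drop_rare1 (lam1_lt_speedLeft_kind2 hg h.left_pos (h.wave_right hV))
    (speedLeft_le_speedRight hg (h.wave_right hV)) h2

/-- A 2-wave alone, regarded as a classical pattern with trivial 1-wave. -/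
theorem Through.of_value (hg : 0 < g) (hU : 0 < U.h) (hV : 0 < V.h) (ha : V.a = U.a)
    (h2 : Phi2 g U V = 0) (hr : U = V ∨ x ≤ (speedLeft g (kind2 U V) U V : ℝ) ∧
      (speedRight g (kind2 U V) U V : ℝ) ≤ b)
    (hv : ∀ᶠ ξ in Filter.cofinite, ∀ W, ValueAt g ξ W U L → ValueAt g ξ W U [(kind2 U V, V)]) :
    Through g U x L V b U := by
  refine ⟨hU, hU, rfl, ha, by simp, h2, Or.inl rfl, hr, ?_⟩
  filter_upwards [hv] with ξ h1 W hW
  rw [kind1_self]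
  exact (h1 W hW).insert_rare1 (lam1_lt_speedLeft_kind2 hg hU (isWave_kind2 hU.le hV ha h2))

/-- Behind the shock λ₁ has dropped below the shock speed, so no further 1-wave can follow. -/
theorem Through.shock1_cons (hg : 0 < g) (hV : 0 < V.h) (hw : IsShock1 g U U')
    (hx : x ≤ (shockSpeed U U' : ℝ)) (hb : (shockSpeed U U' : ℝ) ≤ b)
    (h : Through g U' (shockSpeed U U' : ℝ) L V b M) :
    Through g U x ((.shock1, U') :: L) V b U' := by
  obtain rfl := h.eq_left_of_lam1_lt hg (hw.lam1_lt_speed hg)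
  refine ⟨hw.1, h.pos, hw.2.2.1, h.bottom_right.trans hw.2.2.1, hw.Psi1_eq_zero, h.onW2, Or.inr ?_,
    h.right.imp_right fun h' => ⟨hx.trans h'.1, h'.2⟩, ?_⟩
  · rw [hw.kind1]; exact ⟨hx, hb⟩
  · filter_upwards [h.value_trivial hg hV] with ξ h1 W hW
    rw [hw.kind1]
    exact hW.cons_map fun _ => h1 W

/-- A 1-shock starting at U' is slower than λ₁(U'), hence cannot follow the rarefaction; a second
rarefaction is absorbed into the first, the Riemann invariant being the same. -/
theorem Through.rare1_cons (hg : 0 < g) (hw : IsRare1 g U U')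
    (hx : x ≤ (lam1 g U : ℝ)) (hb : (lam1 g U' : ℝ) ≤ b)
    (h : Through g U' (lam1 g U' : ℝ) L V b M) :
    Through g U x ((.rare1, U') :: L) V b M := by
  have hx' : x ≤ (lam1 g U' : ℝ) := hx.trans (EReal.coe_le_coe_iff.2 (hw.lam1_le hg))
  have hM : IsRare1 g U' M := by
    have := h.wave_left
    rcases h.left with rfl | h'
    · exact isRare1_refl h.left_pos
    · by_contra hc
      unfold kind1 at *
      split_ifs at * with hh
      · exact absurd (EReal.coe_le_coe_iff.1 h'.1) (not_le.2 (IsShock1.speed_lt_lam1 hg this))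
      · exact hc this
  have hUM := hw.trans hg hM
  refine ⟨hw.1, h.pos, hUM.2.2.2.1, h.bottom_right.trans hw.2.2.2.1, hUM.Psi1_eq_zero, h.onW2,
    Or.inr ?_, h.right.imp_right fun h' => ⟨hx'.trans h'.1, h'.2⟩, ?_⟩
  · rw [hUM.kind1]
    refine ⟨hx, ?_⟩
    rcases h.left with rfl | h'
    · exact hb
    · rw [hM.kind1] at h'; exact h'.2
  · filter_upwards [h.value, Filter.eventually_cofinite_ne (lam1 g U')] with ξ h1 h2 W hW
    have h3 := hW.cons_map fun _ => h1 W
    rw [hM.kind1] at h3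
    rw [hUM.kind1]
    exact ValueAt.merge_rare1 hg hw hM h2 h3

theorem ThroughDry.rare1_cons (hg : 0 < g) (hw : IsRare1 g U U')
    (hx : x ≤ (lam1 g U : ℝ)) {y : EReal} (h : ThroughDry g U' y L V b) :
    ThroughDry g U x ((.rare1, U') :: L) V b := by
  have e := hw.eq hg
  have hd : dryRight g U' = dryRight g U := by
    ext
    · rfl
    · exact e
    · exact hw.2.2.2.1
  refine ⟨hw.1, h.bottom_right.trans hw.2.2.2.1, e ▸ h.gap, hx, h.right, ?_⟩
  filter_upwards [h.value, Filter.eventually_cofinite_ne (lam1 g U')] with ξ h1 h2 W hW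
  rw [hd] at h1
  refine ValueAt.merge_rare1 hg hw ?_ h2 (hW.cons_map fun _ => h1 W)
  rw [isRare1_iff hg]
  exact ⟨h.left_pos, le_rfl, h.left_pos.le, hw.2.2.2.1.symm, by simp [dryRight, e]⟩

theorem FromDry.rare1_cons (hg : 0 < g) (hw : IsRare1 g U U')
    (hx : x ≤ (lam1 g U : ℝ)) {y : EReal} (h : FromDry g U' y L V b) :
    ThroughDry g U x ((.rare1, U') :: L) V b := by
  have e := hw.eq hg
  rw [h.dry, cel_zero] at e
  have hd : U' = dryRight g U := by
    ext
    · exact h.dry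
    · simp only [dryRight]; linarith
    · exact hw.2.2.2.1
  refine ⟨hw.1, h.bottom_right.trans hw.2.2.2.1, by linarith [h.gap], hx, h.right, ?_⟩
  filter_upwards [h.value] with ξ h1 W hW
  rw [hd] at h1 hW
  exact hW.cons_map fun _ => h1 W

theorem Through.shock2_cons (hg : 0 < g) (hV : 0 < V.h) (hw : IsShock2 g U U')
    (hx : x ≤ (shockSpeed U U' : ℝ)) (hb : (shockSpeed U U' : ℝ) ≤ b)
    (h : Through g U' (shockSpeed U U' : ℝ) L V b M) :
    Through g U x ((.shock2, U') :: L) V b U := by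
  have l1 := hw.lam2_lt_speed hg
  obtain rfl := h.eq_left_of_lam1_lt hg ((lam1_lt_lam2 hg h.left_pos).trans l1)
  obtain rfl := h.eq_right_of_lam2_lt hg hV l1
  refine Through.of_value hg (hw.1.trans hw.2.1) hV hw.2.2.1 hw.Phi2_eq_zero (Or.inr ?_) ?_
  · rw [hw.kind2]; exact ⟨hx, hb⟩
  · filter_upwards [h.value_trivial hg hV] with ξ h1 W hW
    rw [hw.kind2]
    refine hW.cons_map fun h2 h3 => ?_
    have h4 := h1 W h3
    rw [kind2_self] at h4
    exact h4.2.2 (l1.trans h2)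

theorem Through.isRare2_of_le (hg : 0 < g) (hV : 0 < V.h)
    (h : Through g U (lam2 g U : ℝ) L V b M) : M = U ∧ IsRare2 g U V := by
  obtain rfl := h.eq_left_of_lam1_lt hg (lam1_lt_lam2 hg h.left_pos)
  refine ⟨rfl, ?_⟩
  have := h.wave_right hV
  rcases h.right with rfl | h'
  · exact isRare2_refl hV
  · by_contra hc
    unfold kind2 at *
    split_ifs at * with hh
    · exact absurd (EReal.coe_le_coe_iff.1 h'.1) (not_le.2 (IsShock2.speed_lt_lam2 hg this))
    · exact hc this

theorem Through.rare2_value (hg : 0 < g) (hV : 0 < V.h) (hw : IsRare2 g U U')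
    (h : Through g U' (lam2 g U' : ℝ) L V b M) :
    ∀ᶠ ξ in Filter.cofinite, ∀ W, ValueAt g ξ W U ((.rare2, U') :: L) →
      ValueAt g ξ W U [(.rare2, V)] := by
  obtain ⟨rfl, h'⟩ := h.isRare2_of_le hg hV
  filter_upwards [h.value_trivial hg hV, Filter.eventually_cofinite_ne (lam2 g M)]
    with ξ h1 h2 W hW
  rw [h'.kind2] at h1
  exact ValueAt.merge_rare2 hg hw h' h2 (hW.cons_map fun _ => h1 W)

theorem Through.lam2_le_bound (hg : 0 < g) (hV : 0 < V.h)
    (h : Through g U (lam2 g U : ℝ) L V b M) (hb : (lam2 g U : ℝ) ≤ b) : (lam2 g V : ℝ) ≤ b := by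
  obtain ⟨rfl, h'⟩ := h.isRare2_of_le hg hV
  rcases h.right with rfl | h''
  · exact hb
  · rw [h'.kind2] at h''; exact h''.2

theorem Through.rare2_cons (hg : 0 < g) (hV : 0 < V.h) (hU : 0 < U.h) (hw : IsRare2 g U U')
    (hx : x ≤ (lam2 g U : ℝ)) (hb : (lam2 g U' : ℝ) ≤ b)
    (h : Through g U' (lam2 g U' : ℝ) L V b M) :
    Through g U x ((.rare2, U') :: L) V b U := by
  have hv := h.rare2_value hg hV hw
  have hb' := h.lam2_le_bound hg hV hb
  obtain ⟨rfl, h'⟩ := h.isRare2_of_le hg hV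
  have hUV := hw.trans hg h'
  refine Through.of_value hg hU hV hUV.2.2.2.1 hUV.Phi2_eq_zero (Or.inr ?_) ?_
  · rw [hUV.kind2]; exact ⟨hx, hb'⟩
  · rw [hUV.kind2]; exact hv

theorem Through.rare2_cons_dry (hg : 0 < g) (hV : 0 < V.h) (hU : U.h = 0) (hw : IsRare2 g U U')
    (hx : x ≤ (lam2 g U : ℝ)) (hb : (lam2 g U' : ℝ) ≤ b)
    (h : Through g U' (lam2 g U' : ℝ) L V b M) : FromDry g U x ((.rare2, U') :: L) V b := by
  have hv := h.rare2_value hg hV hw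
  have hb' := h.lam2_le_bound hg hV hb
  obtain ⟨rfl, h'⟩ := h.isRare2_of_le hg hV
  have hUV := hw.trans hg h'
  have e := hUV.eq hg
  rw [hU, cel_zero] at e
  have hl : lam2 g U = U.u := by rw [lam2_eq, hU, cel_zero, add_zero]
  have hd : dryLeft g V = U := by
    ext
    · exact hU.symm
    · simp only [dryLeft]; linarith
    · exact hUV.2.2.2.1
  refine ⟨hU, hUV.2.2.2.1, by linarith, hl ▸ hx, hb', ?_⟩
  filter_upwards [hv] with ξ h1 W hW
  have h2 := h1 W hW
  rw [hd]
  exact ⟨fun h3 => h2.1 (h3.trans_eq hl.symm), fun h3 h4 => absurd h3 (not_lt.2 h4.le), fun _ => h2⟩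

theorem FromDry.dry_cons (hw : IsDryZone U U') (hx : x ≤ (U.u : ℝ)) {y : EReal}
    (h : FromDry g U' y L V b) : FromDry g U x ((.dry, U') :: L) V b := by
  refine ⟨hw.1, h.bottom_right.trans hw.2.2.1, hw.2.2.2.trans h.gap, hx, h.right, ?_⟩
  filter_upwards [h.value, Filter.eventually_cofinite_ne U'.u] with ξ h1 h2 W hW
  exact ValueAt.merge_dry hw ⟨h.dry, rfl, h.bottom_right, h.gap⟩ h2 (hW.cons_map fun _ => h1 W)

/-- Normal form of classical wave patterns. -/
theorem Arranged.classical (hg : 0 < g) (hV : 0 < V.h)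
    (h : Arranged g (IsClassicalWave g) U x L V b) :
    (∃ M, Through g U x L V b M) ∨ ThroughDry g U x L V b ∨ FromDry g U x L V b := by
  -- The normal form of the tail has speeds not below the right edge of the new wave. The Lax
  -- inequalities then leave only the combinations that merge or that are already in normal form.
  induction L generalizing U x with
  | nil =>
    obtain ⟨rfl, hb⟩ := h
    refine Or.inl ⟨U, Through.of_value hg hV hV rfl (by simp) (Or.inl rfl)
      (Filter.Eventually.of_forall ?_)⟩
    intro ξ W hW
    rw [kind2_self]
    exact ⟨fun _ => hW, fun h1 h2 => absurd h1 (not_lt.2 h2.le), fun _ => hW⟩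
  | cons p L ih =>
    obtain ⟨k, U'⟩ := p
    obtain ⟨⟨hw, hk⟩, hx, hr⟩ := h
    have hb := hr.bounds_le hg fun _ _ _ h => h.1
    have IH := ih hr
    cases k with
    | contact => exact absurd rfl hk
    | shock1 =>
      have hw : IsShock1 g U U' := hw
      rcases IH with ⟨M, h⟩ | h | h
      · exact Or.inl ⟨U', h.shock1_cons hg hV hw hx hb⟩
      · exact absurd (EReal.coe_le_coe_iff.1 h.left) (not_le.2 (hw.lam1_lt_speed hg))
      · have := hw.1.trans hw.2.1; rw [h.dry] at this; exact absurd this (lt_irrefl _)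
    | shock2 =>
      have hw : IsShock2 g U U' := hw
      rcases IH with ⟨M, h⟩ | h | h
      · exact Or.inl ⟨U, h.shock2_cons hg hV hw hx hb⟩
      · exact absurd (EReal.coe_le_coe_iff.1 h.left)
          (not_le.2 ((lam1_lt_lam2 hg h.left_pos).trans (hw.lam2_lt_speed hg)))
      · have := hw.1; rw [h.dry] at this; exact absurd this (lt_irrefl _)
    | rare1 =>
      rcases IH with ⟨M, h⟩ | h | h
      · exact Or.inl ⟨M, h.rare1_cons hg hw hx hb⟩
      · exact Or.inr (Or.inl (h.rare1_cons hg hw hx))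
      · exact Or.inr (Or.inl (h.rare1_cons hg hw hx))
    | rare2 =>
      have hw : IsRare2 g U U' := hw
      rcases IH with ⟨M, h⟩ | h | h
      · rcases hw.2.1.eq_or_lt with hU | hU
        · exact Or.inr (Or.inr (h.rare2_cons_dry hg hV hU.symm hw hx hb))
        · exact Or.inl ⟨U, h.rare2_cons hg hV hU hw hx hb⟩
      · exact absurd (EReal.coe_le_coe_iff.1 h.left) (not_le.2 (lam1_lt_lam2 hg h.left_pos))
      · have := hw.1; rw [h.dry] at this; exact absurd this (lt_irrefl _)
    | dry =>
      have hw : IsDryZone U U' := hw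
      rcases IH with ⟨M, h⟩ | h | h
      · have := h.left_pos; rw [hw.2.1] at this; exact absurd this (lt_irrefl _)
      · have := h.left_pos; rw [hw.2.1] at this; exact absurd this (lt_irrefl _)
      · exact Or.inr (Or.inr (h.dry_cons hw hx))

/-! #### Uniqueness of classical patterns -/

/-- Equality of height, discharge and bottom level. -/
def SameValue (V W : State) : Prop := V.h = W.h ∧ V.h * V.u = W.h * W.u ∧ V.a = W.a

theorem IsRare1.eq_of_lam1 (hg : 0 < g) {W₁ W₂ : State} (h1 : IsRare1 g U W₁) (h2 : IsRare1 g U W₂)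
    (h : lam1 g W₁ = lam1 g W₂) : W₁ = W₂ := by
  have e1 := h1.eq hg
  have e2 := h2.eq hg
  rw [lam1_eq, lam1_eq] at h
  refine State.ext (cel_inj hg h1.2.1 h2.2.1 ?_) ?_ (h1.2.2.2.1.trans h2.2.2.2.1.symm) <;> linarith

theorem IsRare2.eq_of_lam2 (hg : 0 < g) {W₁ W₂ : State} (h1 : IsRare2 g U W₁) (h2 : IsRare2 g U W₂)
    (h : lam2 g W₁ = lam2 g W₂) : W₁ = W₂ := by
  have e1 := h1.eq hg
  have e2 := h2.eq hg
  rw [lam2_eq, lam2_eq] at h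
  refine State.ext (cel_inj hg h1.1.le h2.1.le ?_) ?_ (h1.2.2.2.1.trans h2.2.2.2.1.symm) <;>
  linarith

theorem InFan.sameValue (hg : 0 < g) {k : WaveKind} {W₁ W₂ : State} (h : IsWave g k U V)
    (hξ : speedLeft g k U V < ξ) (hξ' : ξ < speedRight g k U V) (h1 : InFan g k U ξ W₁)
    (h2 : InFan g k U ξ W₂) : SameValue W₁ W₂ := by
  cases k with
  | shock1 => exact absurd hξ (not_lt.2 hξ'.le)
  | shock2 => exact absurd hξ (not_lt.2 hξ'.le)
  | contact => exact absurd hξ (not_lt.2 hξ'.le)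
  | rare1 =>
    obtain rfl := h1.1.eq_of_lam1 hg h2.1 (h1.2.trans h2.2.symm)
    exact ⟨rfl, rfl, rfl⟩
  | rare2 =>
    obtain rfl := h1.1.eq_of_lam2 hg h2.1 (h1.2.trans h2.2.symm)
    exact ⟨rfl, rfl, rfl⟩
  | dry => exact ⟨h1.1.trans h2.1.symm, by rw [h1.1, h2.1, zero_mul, zero_mul], h1.2.trans h2.2.symm⟩

theorem Arranged.sameValue (hg : 0 < g) {R : WaveKind → State → State → Prop}
    (hR : ∀ k U V, R k U V → IsWave g k U V) (h : Arranged g R U x L V b) :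
    ∀ᶠ ξ in Filter.cofinite, ∀ W₁ W₂, ValueAt g ξ W₁ U L → ValueAt g ξ W₂ U L →
      SameValue W₁ W₂ := by
  induction L generalizing U x with
  | nil =>
    refine Filter.Eventually.of_forall ?_
    rintro ξ W₁ W₂ rfl rfl
    exact ⟨rfl, rfl, rfl⟩
  | cons p L ih =>
    obtain ⟨k, U'⟩ := p
    filter_upwards [ih h.2.2, Filter.eventually_cofinite_ne (speedLeft g k U U'),
      Filter.eventually_cofinite_ne (speedRight g k U U')] with ξ h1 h2 h3 W₁ W₂ a1 a2
    rcases lt_or_gt_of_ne h2 with h4 | h4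
    · obtain rfl := a1.1 h4
      obtain rfl := a2.1 h4
      exact ⟨rfl, rfl, rfl⟩
    rcases lt_or_gt_of_ne h3 with h5 | h5
    · exact InFan.sameValue hg (hR _ _ _ h.1) h4 h5 (a1.2.1 h4 h5) (a2.2.1 h4 h5)
    · exact h1 W₁ W₂ (a1.2.2 h5) (a2.2.2 h5)

theorem sameValue_two_waves (hg : 0 < g) {k k' : WaveKind} (h : IsWave g k U M)
    (h' : IsWave g k' M V) : ∀ᶠ ξ in Filter.cofinite, ∀ W₁ W₂,
      ValueAt g ξ W₁ U [(k, M), (k', V)] → ValueAt g ξ W₂ U [(k, M), (k', V)] →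
      SameValue W₁ W₂ := by
  filter_upwards [Filter.eventually_cofinite_ne (speedLeft g k U M),
      Filter.eventually_cofinite_ne (speedRight g k U M),
      Filter.eventually_cofinite_ne (speedLeft g k' M V),
      Filter.eventually_cofinite_ne (speedRight g k' M V)] with ξ h1 h2 h3 h4 W₁ W₂ a1 a2
  rcases lt_or_gt_of_ne h1 with c1 | c1
  · obtain rfl := a1.1 c1
    obtain rfl := a2.1 c1
    exact ⟨rfl, rfl, rfl⟩
  rcases lt_or_gt_of_ne h2 with c2 | c2
  · exact InFan.sameValue hg h c1 c2 (a1.2.1 c1 c2) (a2.2.1 c1 c2)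
  replace a1 := a1.2.2 c2
  replace a2 := a2.2.2 c2
  rcases lt_or_gt_of_ne h3 with c3 | c3
  · obtain rfl := a1.1 c3
    obtain rfl := a2.1 c3
    exact ⟨rfl, rfl, rfl⟩
  rcases lt_or_gt_of_ne h4 with c4 | c4
  · exact InFan.sameValue hg h' c3 c4 (a1.2.1 c3 c4) (a2.2.1 c3 c4)
  obtain rfl := a1.2.2 c4
  obtain rfl := a2.2.2 c4
  exact ⟨rfl, rfl, rfl⟩

/-- Along the forward 1-curve u decreases strictly with h, along the backward 2-curve it increases
strictly. -/
theorem wave_curves_unique (hg : 0 < g) {M M' : State} (hU : 0 < U.h) (hV : 0 < V.h)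
    (h0 : 0 < M.h) (h0' : 0 < M'.h) (ha : M.a = M'.a) (h1 : Psi1 g M U = 0) (h2 : Phi2 g M V = 0)
    (h1' : Psi1 g M' U = 0) (h2' : Phi2 g M' V = 0) : M = M' := by
  rw [Psi1_eq] at h1 h1'
  rw [Phi2_eq] at h2 h2'
  have hh : M.h = M'.h := by
    rcases lt_trichotomy M.h M'.h with h | h | h
    · linarith [jump_strictMono hg hU h0.le h, jump_strictMono hg hV h0.le h]
    · exact h
    · linarith [jump_strictMono hg hU h0'.le h, jump_strictMono hg hV h0'.le h]
  exact State.ext hh (by rw [hh] at h1; linarith) ha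

theorem no_dry_of_wet (hg : 0 < g) (hU : 0 < U.h) (hV : 0 < V.h)
    (h0 : 0 < M.h) (h1 : Psi1 g M U = 0) (h2 : Phi2 g M V = 0) :
    V.u - 2 * cel g V.h < U.u + 2 * cel g U.h := by
  rw [Psi1_eq] at h1
  rw [Phi2_eq] at h2
  have k1 := jump_strictMono hg hU le_rfl h0
  have k2 := jump_strictMono hg hV le_rfl h0
  rw [jump_of_le hg hU.le] at k1
  rw [jump_of_le hg hV.le] at k2
  rw [cel_zero] at k1 k2
  linarith

theorem ThroughDry.isWave1 (hg : 0 < g) (hU : 0 < U.h) : IsWave g .rare1 U (dryRight g U) := by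
  change IsRare1 g U _
  rw [isRare1_iff hg]
  exact ⟨hU, le_rfl, hU.le, rfl, by simp [dryRight]⟩

theorem isRare2_dryLeft (hg : 0 < g) (hV : 0 < V.h) : IsRare2 g (dryLeft g V) V := by
  rw [isRare2_iff hg]
  exact ⟨hV, le_rfl, hV.le, rfl, by simp [dryLeft]⟩

/-- A wet middle state and a dry zone exclude each other by `no_dry_of_wet`. In either case the end
states fix the normal form, hence the profile outside finitely many speeds; inside a dry zone only
height, discharge and bottom are compared. -/
theorem Arranged.classical_unique (hg : 0 < g) {x' b' : EReal} (hU : 0 < U.h) (hV : 0 < V.h)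
    (h : Arranged g (IsClassicalWave g) U x L V b)
    (h' : Arranged g (IsClassicalWave g) U x' L' V b') :
    ∀ᶠ ξ in Filter.cofinite, ∀ W₁ W₂, ValueAt g ξ W₁ U L → ValueAt g ξ W₂ U L' →
      SameValue W₁ W₂ := by
  rcases h.classical hg hV with ⟨M, k⟩ | k | k <;>
  rcases h'.classical hg hV with ⟨M', k'⟩ | k' | k'
  · obtain rfl : M = M' := wave_curves_unique hg hU hV k.pos k'.pos (k.bottom.trans k'.bottom.symm)
      k.onW1 k.onW2 k'.onW1 k'.onW2
    filter_upwards [k.value, k'.value, sameValue_two_waves hg k.wave_left (k.wave_right hV)]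
      with ξ h1 h2 h3 W₁ W₂ a1 a2 using h3 W₁ W₂ (h1 W₁ a1) (h2 W₂ a2)
  · exact absurd k'.gap (not_le.2 (no_dry_of_wet hg hU hV k.pos k.onW1 k.onW2))
  · exact absurd k'.dry hU.ne'
  · exact absurd k.gap (not_le.2 (no_dry_of_wet hg hU hV k'.pos k'.onW1 k'.onW2))
  · have A : Arranged g (IsWave g) U ⊥
        [(.rare1, dryRight g U), (.dry, dryLeft g V), (.rare2, V)] V ⊤ := by
      refine ⟨ThroughDry.isWave1 hg hU, bot_le, ⟨rfl, rfl, k.bottom_right, k.gap⟩, ?_,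
        isRare2_dryLeft hg hV, ?_, rfl, le_top⟩ <;>
      simp [speedLeft, speedRight, lam1_eq, lam2_eq, dryRight, dryLeft]
    filter_upwards [k.value, k'.value, A.sameValue hg fun _ _ _ h => h]
      with ξ h1 h2 h3 W₁ W₂ a1 a2 using h3 W₁ W₂ (h1 W₁ a1) (h2 W₂ a2)
  · exact absurd k'.dry hU.ne'
  · exact absurd k.dry hU.ne'
  · exact absurd k.dry hU.ne'
  · exact absurd k.dry hU.ne'

end ShallowWater
end

noncomputable section

namespace ShallowWater

/-! ### Stationary shocks -/

variable {g : ℝ} {U V W M X Y Z : State} {x b : EReal} {L L' : List (WaveKind × State)} {ξ : ℝ}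

/-- The squared mass flux through a shock is symmetric in the two heights. For a stationary shock
this is the relation between conjugate depths. -/
theorem IsShock1.flux_sq (hg : 0 < g) (h : IsShock1 g U V) :
    (U.h * (U.u - shockSpeed U V)) ^ 2 = g * U.h * V.h * (U.h + V.h) / 2 := by
  have h2 := h.1.trans h.2.1
  rw [h.speed_left hg]
  have c0 := cel_pos hg h.1
  have e0 := cel_sq hg h.1.le
  have e1 := cel_sq hg h2.le
  have z := celMean_sq g V.h U.h
  rw [e0, e1] at z
  rw [sub_sub_cancel, mul_pow, mul_pow, div_pow, z, e0, e1]
  have := h.1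
  field_simp
  ring

theorem IsShock1.discharge_sub (h : IsShock1 g U V) :
    V.h * V.u - U.h * U.u = shockSpeed U V * (V.h - U.h) := by
  rw [shockSpeed, div_mul_cancel₀ _ (sub_ne_zero.2 h.2.1.ne')]

theorem IsShock2.discharge_sub (h : IsShock2 g U V) :
    V.h * V.u - U.h * U.u = shockSpeed U V * (V.h - U.h) := by
  rw [shockSpeed, div_mul_cancel₀ _ (sub_ne_zero.2 h.2.1.ne)]

theorem specEnergy_sub_conjugate {q a c : ℝ} (ha : 0 < a) (hc : 0 < c)
    (h : q ^ 2 = g * a * c * (a + c) / 2) :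
    specEnergy g q a - specEnergy g q c = g * (c - a) ^ 3 / (4 * a * c) := by
  rw [specEnergy, specEnergy, h]; field_simp; ring

theorem conjugate_height_le {a c a' c' : ℝ} (ha : 0 < a) (hc : 0 < c)
    (h : a * c * (a + c) = a' * c' * (a' + c')) (haa : a ≤ a') : c' ≤ c := by
  by_contra hlt
  rw [not_le] at hlt
  have : a * c * (a + c) < a' * c' * (a' + c') :=
    mul_lt_mul'' (mul_lt_mul' haa hlt hc.le (by linarith)) (by linarith) (by positivity)
      (by positivity)
  linarith

/-- The loss of energy in a stationary shock grows with its strength. -/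
theorem conjugate_loss_le {a c a' c' : ℝ} (hg : 0 < g) (ha : 0 < a) (hc : 0 < c) (hac' : a' ≤ c')
    (h : a * c * (a + c) = a' * c' * (a' + c')) (haa : a ≤ a') :
    g * (c' - a') ^ 3 / (4 * a' * c') ≤ g * (c - a) ^ 3 / (4 * a * c) := by
  have ha' : 0 < a' := ha.trans_le haa
  have hc' : 0 < c' := ha'.trans_le hac'
  have hcc := conjugate_height_le ha hc h haa
  have hp : a * c ≤ a' * c' := by
    by_contra hlt
    rw [not_le] at hlt
    have hs : a + c < a' + c' := by
      by_contra hs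
      rw [not_lt] at hs
      have : a' * c' * (a' + c') < a * c * (a + c) :=
        mul_lt_mul hlt hs (by positivity) (by positivity)
      linarith
    nlinarith
  apply div_le_div₀
  · have : 0 ≤ c - a := by linarith
    positivity
  · gcongr
  · positivity
  · linarith

/-- The height is the positive root c of c(c + h) = 2hu²/g, that is, of the conjugate depth relation
from `IsShock1.flux_sq` at speed zero. -/
theorem sharpHeight_spec (hg : 0 < g) (hU : 0 < U.h) (hu : U.u ≠ 0) : 0 < sharpHeight g U ∧
    (U.h * U.u) ^ 2 = g * U.h * sharpHeight g U * (U.h + sharpHeight g U) / 2 := by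
  have hp : 0 < 8 * U.h * U.u ^ 2 / g := by positivity
  have hlt : U.h < √(U.h ^ 2 + 8 * U.h * U.u ^ 2 / g) := by
    rw [Real.lt_sqrt hU.le]; linarith
  have hs : √(U.h ^ 2 + 8 * U.h * U.u ^ 2 / g) ^ 2 = U.h ^ 2 + 8 * U.h * U.u ^ 2 / g :=
    Real.sq_sqrt (by positivity)
  refine ⟨by rw [sharpHeight]; linarith, ?_⟩
  have e : √(U.h ^ 2 + 8 * U.h * U.u ^ 2 / g) = 2 * sharpHeight g U + U.h := by
    rw [sharpHeight]; ring
  rw [e] at hs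
  have e2 : sharpHeight g U * (sharpHeight g U + U.h) = 2 * U.h * U.u ^ 2 / g := by
    have : 8 * U.h * U.u ^ 2 / g = 4 * (2 * U.h * U.u ^ 2 / g) := by ring
    rw [this] at hs; linarith
  have : g * U.h * sharpHeight g U * (U.h + sharpHeight g U) / 2
      = g * U.h / 2 * (sharpHeight g U * (sharpHeight g U + U.h)) := by ring
  rw [this, e2]
  field_simp

theorem lt_sharpHeight (hg : 0 < g) (hU : 0 < U.h) (h : g * U.h < U.u ^ 2) :
    U.h < sharpHeight g U := by
  have hu : U.u ≠ 0 := by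
    rintro e; rw [e] at h; have : 0 < g * U.h := by positivity
    norm_num at h; linarith
  obtain ⟨h1, h2⟩ := sharpHeight_spec hg hU hu
  by_contra hle
  rw [not_lt] at hle
  have : (U.h * U.u) ^ 2 ≤ g * U.h * U.h * (U.h + U.h) / 2 := by rw [h2]; gcongr
  nlinarith [mul_pos hU hU]

theorem sharp_discharge (h : sharpHeight g U ≠ 0) :
    (sharp g U).h * (sharp g U).u = U.h * U.u := by
  simp only [sharp]; field_simp

/-- The state `U^#` is reached from a supercritical state by a stationary 1-shock. -/
theorem isShock1_sharp (hg : 0 < g) (hU : 0 < U.h) (h : 0 < lam1 g U) :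
    IsShock1 g U (sharp g U) ∧ shockSpeed U (sharp g U) = 0 := by
  have hlt := lt_sharpHeight hg hU (supercritical_of_lam1_pos hg hU.le h)
  rw [lam1_eq] at h
  have hu : 0 < U.u := by linarith [cel_pos hg hU]
  obtain ⟨h1, h2⟩ := sharpHeight_spec hg hU hu.ne'
  refine ⟨⟨hU, hlt, rfl, ?_⟩, ?_⟩
  · simp only [sharp]
    have e : shockJump g (sharpHeight g U) U.h = U.u - U.u * U.h / sharpHeight g U := by
      rw [shockJump, mul_right_comm, ← Real.sqrt_mul (by positivity)]
      have e1 : g / 2 * (1 / sharpHeight g U + 1 / U.h)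
          = (U.u / sharpHeight g U) ^ 2 := by
        rw [mul_pow] at h2
        field_simp
        nlinarith
      rw [e1, Real.sqrt_sq (by positivity)]
      field_simp
    rw [e]; ring
  · rw [shockSpeed, sharp_discharge h1.ne', sub_self, zero_div]

/-- The state conjugate to a supercritical state has less energy. -/
theorem energy_sharp_lt (hg : 0 < g) (hU : 0 < U.h) (h : 0 < lam1 g U) :
    energy g (sharp g U) < energy g U := by
  obtain ⟨h1, h2⟩ := isShock1_sharp hg hU h
  exact h1.energy_lt hg h2.ge

/-! ### Decomposition of a solution at speed zero -/

/-- An elementary wave of speed zero between wet states, along which the bottom does not rise. -/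
def ZeroStep (g : ℝ) (X Z : State) : Prop :=
  IsContact g X Z ∧ Z.a ≤ X.a ∨ IsShock1 g X Z ∧ shockSpeed X Z = 0 ∨
    IsShock2 g X Z ∧ shockSpeed X Z = 0

/-- Finitely many waves of speed zero. -/
def Chain (g : ℝ) : State → State → Prop := Relation.ReflTransGen (ZeroStep g)

/-- A rarefaction whose edges both have speed zero is trivial, and a dry zone between wet states
cannot be squeezed into speed zero, so only stationary shocks survive. -/
theorem Arranged.zero_chain (hg : 0 < g) (hU : 0 < U.h) (hV : 0 < V.h)
    (h : Arranged g (IsClassicalWave g) U 0 L V 0) : Chain g U V := by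
  rcases h.classical hg hV with ⟨M, k⟩ | k | k
  · have w1 := k.wave_left
    have w2 := k.wave_right hV
    have c1 : Chain g U M := by
      rcases k.left with rfl | ⟨l1, l2⟩
      · exact Relation.ReflTransGen.refl
      unfold kind1 at *
      split_ifs at * with hh
      · exact Relation.ReflTransGen.single (Or.inr (Or.inl ⟨w1, le_antisymm
          (EReal.coe_le_coe_iff.1 l2) (EReal.coe_le_coe_iff.1 l1)⟩))
      · have w1 : IsRare1 g U M := w1
        have l1 : 0 ≤ lam1 g U := EReal.coe_le_coe_iff.1 l1
        have l2 : lam1 g M ≤ 0 := EReal.coe_le_coe_iff.1 l2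
        have l3 := w1.lam1_le hg
        obtain rfl := (isRare1_refl k.left_pos).eq_of_lam1 hg w1 (by linarith)
        exact Relation.ReflTransGen.refl
    have c2 : Chain g M V := by
      rcases k.right with rfl | ⟨l1, l2⟩
      · exact Relation.ReflTransGen.refl
      unfold kind2 at *
      split_ifs at * with hh
      · exact Relation.ReflTransGen.single (Or.inr (Or.inr ⟨w2, le_antisymm
          (EReal.coe_le_coe_iff.1 l2) (EReal.coe_le_coe_iff.1 l1)⟩))
      · have w2 : IsRare2 g M V := w2
        have l1 : 0 ≤ lam2 g M := EReal.coe_le_coe_iff.1 l1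
        have l2 : lam2 g V ≤ 0 := EReal.coe_le_coe_iff.1 l2
        have l3 := w2.lam2_le hg
        obtain rfl := (isRare2_refl k.pos).eq_of_lam2 hg w2 (by linarith)
        exact Relation.ReflTransGen.refl
    exact c1.trans c2
  · have l1 : 0 ≤ lam1 g U := EReal.coe_le_coe_iff.1 k.left
    have l2 : lam2 g V ≤ 0 := EReal.coe_le_coe_iff.1 k.right
    have := k.gap
    rw [lam1_eq] at l1
    rw [lam2_eq] at l2
    linarith [cel_pos hg hU, cel_pos hg hV]
  · exact absurd k.dry hU.ne'

theorem Arranged.bottom_le (h : Arranged g (IsWaveDown g) U x L V b) : V.a ≤ U.a := by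
  induction L generalizing U x with
  | nil => rw [h.1]
  | cons p L ih => exact (ih h.2.2).trans h.1.2

/-- Since the bottom never rises and ends at its initial level, it stays constant, so every contact
is trivial and can be deleted. Speed zero is excluded because the deleted contacts sit there. -/
theorem Arranged.exists_classical (hg : 0 < g) (h : Arranged g (IsWaveDown g) U x L V b)
    (ha : V.a = U.a) : ∃ L', Arranged g (IsClassicalWave g) U x L' V b ∧
      ∀ ξ W, ξ ≠ 0 → ValueAt g ξ W U L → ValueAt g ξ W U L' := by
  induction L generalizing U x with
  | nil => exact ⟨[], h, fun ξ W _ h => h⟩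
  | cons p L ih =>
    obtain ⟨k, U'⟩ := p
    have ha' : V.a = U'.a := le_antisymm h.2.2.bottom_le (by rw [ha]; exact h.1.2)
    obtain ⟨L', h1, h2⟩ := ih h.2.2 ha'
    by_cases hk : k = .contact
    · subst hk
      obtain rfl : U' = U := IsContact.eq_of_bottom_eq hg h.1.1 (ha'.symm.trans ha)
      refine ⟨L', h1.of_le h.2.1, fun ξ W hξ hW => ?_⟩
      rcases lt_or_gt_of_ne hξ with c | c
      · obtain rfl := hW.1 c
        exact h1.valueAt_left hg (fun _ _ _ h => h.1) (EReal.coe_lt_coe_iff.2 c)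
      · exact h2 ξ W hξ (hW.2.2 c)
    · exact ⟨(k, U') :: L', ⟨⟨h.1.1, hk⟩, h.2.1, h1⟩, fun ξ W hξ hW =>
        hW.cons_map fun _ => h2 ξ W hξ⟩

/-- Contacts have speed zero, so by the ordering everything between the first and the last of them
has speed zero too. The waves outside this block are classical. -/
theorem Arranged.split_at_zero (hg : 0 < g)
    (h : Arranged g (IsWaveDown g) U x L V b) :
    Arranged g (IsClassicalWave g) U x L V b ∨ ∃ X Y L₁ L₃, 0 < X.h ∧ 0 < Y.h ∧
      Arranged g (IsClassicalWave g) U x L₁ X 0 ∧ Chain g X Y ∧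
      Arranged g (IsClassicalWave g) Y 0 L₃ V b ∧
      (∀ ξ W, ξ < 0 → ValueAt g ξ W U L → ValueAt g ξ W U L₁) ∧
      ∀ ξ W, 0 < ξ → ValueAt g ξ W U L → ValueAt g ξ W Y L₃ := by
  induction L generalizing U x with
  | nil => exact Or.inl h
  | cons p L ih =>
    obtain ⟨k, U'⟩ := p
    by_cases hk : k = .contact
    · subst hk
      have hc : IsContact g U U' := h.1.1
      have st : Chain g U U' := Relation.ReflTransGen.single (Or.inl ⟨hc, h.1.2⟩)
      right
      rcases ih h.2.2 with h1 | ⟨X, Y, L₁, L₃, hX, hY, h1, h2, h3, -, h5⟩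
      · exact ⟨U, U', [], L, hc.1, hc.2.1, ⟨rfl, h.2.1⟩, st, h1, fun ξ W hξ hW => hW.1 hξ,
          fun ξ W hξ hW => hW.2.2 hξ⟩
      · exact ⟨U, Y, [], L₃, hc.1, hY, ⟨rfl, h.2.1⟩,
          (st.trans (h1.zero_chain hg hc.2.1 hX)).trans h2, h3, fun ξ W hξ hW => hW.1 hξ,
          fun ξ W hξ hW => h5 ξ W hξ (hW.2.2 hξ)⟩
    · rcases ih h.2.2 with h1 | ⟨X, Y, L₁, L₃, hX, hY, h1, h2, h3, h4, h5⟩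
      · exact Or.inl ⟨⟨h.1.1, hk⟩, h.2.1, h1⟩
      · have hs : speedRight g k U U' ≤ 0 :=
          EReal.coe_le_coe_iff.1 (h1.bounds_le hg fun _ _ _ h => h.1)
        exact Or.inr ⟨X, Y, (k, U') :: L₁, L₃, hX, hY, ⟨⟨h.1.1, hk⟩, h.2.1, h1⟩, h2, h3,
          fun ξ W hξ hW => hW.cons_map fun _ => h4 ξ W hξ,
          fun ξ W hξ hW => h5 ξ W hξ (hW.2.2 (hs.trans_lt hξ))⟩

/-! ### States joined by waves of speed zero -/

/-- When the bottom does not rise, the energy does not fall. The critical state has the least energy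
for its discharge, so it cannot be reached from a strictly supercritical one. -/
theorem IsContact.supercritical (hg : 0 < g) (h : IsContact g U V) (ha : V.a ≤ U.a)
    (hU : g * U.h < U.u ^ 2) : g * V.h < V.u ^ 2 := by
  have he := h.head hg
  rcases h.side hg with ⟨h1, -⟩ | ⟨-, h1⟩
  · exact absurd hU (not_lt.2 h1)
  · refine lt_of_le_of_ne h1 fun hc => ?_
    have := height_eq_of_energy_le_critical hg h.2.1 h.1 h.2.2.1.symm hc.symm (by nlinarith)
    have hu := velocity_eq_of_height h.2.1 h.2.2.1.symm this
    rw [this, hu] at hU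
    exact hU.ne hc

theorem IsContact.subcritical (hg : 0 < g) (h : IsContact g U V) (ha : V.a ≤ U.a)
    (hU : U.u ^ 2 < g * U.h) : V.u ^ 2 < g * V.h := by
  have he := h.head hg
  rcases h.side hg with ⟨-, h1⟩ | ⟨h1, -⟩
  · refine lt_of_le_of_ne h1 fun hc => ?_
    have := height_eq_of_energy_le_critical hg h.2.1 h.1 h.2.2.1.symm hc (by nlinarith)
    have hu := velocity_eq_of_height h.2.1 h.2.2.1.symm this
    rw [this, hu] at hU
    exact hU.ne hc
  · exact absurd hU (not_lt.2 h1)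

theorem velocity_pos_of_discharge (hU : 0 < U.h) (hV : 0 < V.h) (hq : V.h * V.u = U.h * U.u)
    (hu : 0 < U.u) : 0 < V.u := by
  have : 0 < V.h * V.u := by rw [hq]; positivity
  exact pos_of_mul_pos_right this hV.le

theorem velocity_neg_of_discharge (hU : 0 < U.h) (hV : 0 < V.h) (hq : V.h * V.u = U.h * U.u)
    (hu : U.u < 0) : V.u < 0 := by
  have := velocity_pos_of_discharge (U := mirror U) (V := mirror V) hU hV (by simp [hq])
    (by simpa using hu)
  simpa using this

theorem lam1_pos_iff (hg : 0 < g) (hU : 0 < U.h) :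
    0 < lam1 g U ↔ 0 < U.u ∧ g * U.h < U.u ^ 2 :=
  ⟨fun h => ⟨by rw [lam1_eq] at h; linarith [cel_pos hg hU], supercritical_of_lam1_pos hg hU.le h⟩,
    fun h => lam1_pos_of_supercritical hg hU.le h.1.le h.2⟩

theorem lam2_neg_iff (hg : 0 < g) (hU : 0 < U.h) :
    lam2 g U < 0 ↔ U.u < 0 ∧ g * U.h < U.u ^ 2 :=
  ⟨fun h => ⟨by rw [lam2_eq] at h; linarith [cel_pos hg hU], supercritical_of_lam2_neg hg hU.le h⟩,
    fun h => lam2_neg_of_supercritical hg hU.le h.1.le h.2⟩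

/-- The state `Y` arises from `X` through a stationary 1-shock inside a composite wave of speed
zero. -/
def LossyChain (g : ℝ) (X Y : State) : Prop :=
  ∃ S T, IsShock1 g S T ∧ shockSpeed S T = 0 ∧ 0 < lam1 g S ∧ S.h * S.u = X.h * X.u ∧
    energy g S + g * S.a = energy g X + g * X.a ∧ Y.a ≤ S.a ∧
    energy g Y + g * Y.a = energy g T + g * S.a

/-- The possible right states of a chain of waves of speed zero. -/
def ChainType (g : ℝ) (X Y : State) : Prop :=
  lam2 g Y < 0 ∨ (0 ≤ lam2 g X ∧ Y.u ^ 2 ≤ g * Y.h ∧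
      energy g Y + g * Y.a = energy g X + g * X.a) ∨
    (lam1 g X = 0 ∧ 0 < lam1 g Y ∧ energy g Y + g * Y.a = energy g X + g * X.a) ∨
    (lam1 g X = 0 ∧ Y.u ^ 2 < g * Y.h ∧ LossyChain g X Y)

/-- Only a critical state Y has contacts to both sides. The next step shows that such a Y on the
lossless subcritical branch agrees with X in height and velocity, so X is itself critical: a jet can
start only on C₊. -/
theorem ChainType.contact (hg : 0 < g) (hX : 0 < X.h) (hq : Y.h * Y.u = X.h * X.u)
    (ha : Y.a ≤ X.a) (h : ChainType g X Y) (hc : IsContact g Y Z) (haZ : Z.a ≤ Y.a) :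
    ChainType g X Z := by
  have hY := hc.1
  have hZ := hc.2.1
  have he := hc.head hg
  rcases h with h | ⟨h1, h2, h3⟩ | ⟨h1, h2, h3⟩ | ⟨h1, h2, S, T, k1, k2, k3, k4, k5, k6, k7⟩
  · left
    rw [lam2_neg_iff hg hY] at h
    rw [lam2_neg_iff hg hZ]
    exact ⟨velocity_neg_of_discharge hY hZ hc.2.2.1 h.1, hc.supercritical hg haZ h.2⟩
  · rcases hc.side hg with ⟨-, s⟩ | ⟨s1, s2⟩
    · exact Or.inr (Or.inl ⟨h1, s, he.trans h3⟩)
    · have hcrit : Y.u ^ 2 = g * Y.h := le_antisymm h2 s1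
      -- The bottom at Y is no higher than at X, hence the energy at X is at most that at Y, which
      -- is already minimal for the common discharge.
      have hh := height_eq_of_energy_le_critical hg hY hX hq.symm hcrit (by nlinarith)
      have hu := velocity_eq_of_height hY hq.symm hh
      rcases s2.eq_or_lt with s2 | s2
      · exact Or.inr (Or.inl ⟨h1, s2.ge, he.trans h3⟩)
      rcases lt_trichotomy Y.u 0 with c | c | c
      · exact Or.inl ((lam2_neg_iff hg hZ).2 ⟨velocity_neg_of_discharge hY hZ hc.2.2.1 c, s2⟩)
      · rw [c] at hcrit; have : 0 < g * Y.h := by positivity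
        norm_num at hcrit; rcases hcrit with e | e <;> rw [e] at this <;> simp at this
      · refine Or.inr (Or.inr (Or.inl ⟨?_, (lam1_pos_iff hg hZ).2
          ⟨velocity_pos_of_discharge hY hZ hc.2.2.1 c, s2⟩, he.trans h3⟩))
        rw [lam1_eq, hh, hu, cel, ← hcrit, Real.sqrt_sq c.le, sub_self]
  · rw [lam1_pos_iff hg hY] at h2
    exact Or.inr (Or.inr (Or.inl ⟨h1, (lam1_pos_iff hg hZ).2
      ⟨velocity_pos_of_discharge hY hZ hc.2.2.1 h2.1, hc.supercritical hg haZ h2.2⟩,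
      he.trans h3⟩))
  · exact Or.inr (Or.inr (Or.inr ⟨h1, hc.subcritical hg haZ h2, S, T, k1, k2, k3, k4, k5,
      haZ.trans k6, he.trans k7⟩))

/-- A stationary 1-shock requires λ₁(Y) > 0, which singles out the jet; behind the shock the flow is
strictly subcritical, so at most one such shock occurs. -/
theorem ChainType.shock1 (hg : 0 < g) (hY : 0 < Y.h) (hq : Y.h * Y.u = X.h * X.u)
    (h : ChainType g X Y) (hs : IsShock1 g Y Z) (h0 : shockSpeed Y Z = 0) :
    ChainType g X Z := by
  have hl : 0 < lam1 g Y := h0 ▸ hs.speed_lt_lam1 hg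
  have hZ := hs.1.trans hs.2.1
  have hlt := lam1_lt_lam2 hg hY
  rcases h with h | ⟨h1, h2, h3⟩ | ⟨h1, h2, h3⟩ | ⟨h1, h2, -⟩
  · linarith
  · exact absurd ((subcritical_iff hg hY.le).1 h2).1 (not_le.2 hl)
  · refine Or.inr (Or.inr (Or.inr ⟨h1, ?_, Y, Z, hs, h0, hl, hq, h3, hs.2.2.1.le,
      by rw [hs.2.2.1]⟩))
    have hqZ := hs.discharge_sub
    rw [h0, zero_mul, sub_eq_zero] at hqZ
    have hu := velocity_pos_of_discharge hY hZ hqZ ((lam1_pos_iff hg hY).1 hl).1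
    rw [strictly_subcritical_iff hg hZ.le]
    refine ⟨h0 ▸ hs.lam1_lt_speed hg, ?_⟩
    rw [lam2_eq]; linarith [cel_nonneg g Z.h]
  · exact absurd ((strictly_subcritical_iff hg hY.le).1 h2).1.le (not_le.2 hl)

/-- A stationary 2-shock ends with λ₂ < 0, and further zero-speed waves never leave that region. The
other types follow by adding contacts and 1-shocks one at a time. -/
theorem Chain.classify (hg : 0 < g) (hX : 0 < X.h) (hl : lam1 g X ≤ 0) (h : Chain g X Y) :
    0 < Y.h ∧ Y.a ≤ X.a ∧ Y.h * Y.u = X.h * X.u ∧ ChainType g X Y := by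
  induction h with
  | refl =>
    refine ⟨hX, le_rfl, rfl, ?_⟩
    rcases lt_or_ge (lam2 g X) 0 with h | h
    · exact Or.inl h
    · exact Or.inr (Or.inl ⟨h, (subcritical_iff hg hX.le).2 ⟨hl, h⟩, rfl⟩)
  | @tail Y Z _ hs ih =>
    obtain ⟨h1, h2, h3, h4⟩ := ih
    rcases hs with ⟨hc, ha⟩ | ⟨hc, h0⟩ | ⟨hc, h0⟩
    · exact ⟨hc.2.1, ha.trans h2, hc.2.2.1.trans h3, h4.contact hg hX h3 h2 hc ha⟩
    · have hq := hc.discharge_sub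
      rw [h0, zero_mul, sub_eq_zero] at hq
      exact ⟨hc.1.trans hc.2.1, hc.2.2.1.le.trans h2, hq.trans h3, h4.shock1 hg h1 h3 hc h0⟩
    · have hq := hc.discharge_sub
      rw [h0, zero_mul, sub_eq_zero] at hq
      exact ⟨hc.1, hc.2.2.1.le.trans h2, hq.trans h3, Or.inl (h0 ▸ hc.lam2_lt_speed hg)⟩

end ShallowWater
end

noncomputable section

namespace ShallowWater

/-! ### Left states at speed zero -/

variable {g : ℝ} {UL UR X Y X' Y' J M : State} {x b : EReal} {L L' : List (WaveKind × State)}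
  {v w : ℝ → State}

/-- The states with `λ₁ ≤ 0 ≤ λ₂` that can be reached from `UL` by classical waves of nonpositive
speed. -/
def LeftState (g : ℝ) (UL X : State) : Prop :=
  0 < X.h ∧ X.a = UL.a ∧ lam1 g X ≤ 0 ∧ 0 ≤ lam2 g X ∧ (Psi1 g X UL = 0 ∨ lam2 g X = 0 ∧
    ((∃ M, 0 < M.h ∧ Psi1 g M UL = 0 ∧ IsRare2 g M X) ∨
      UL.u + 2 * cel g UL.h ≤ X.u - 2 * cel g X.h))

/-- `X` has smaller discharge and larger energy than `Y`. -/
def Ahead (g : ℝ) (X Y : State) : Prop := X.h * X.u < Y.h * Y.u ∧ energy g Y < energy g X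

theorem Ahead.trans (h : Ahead g X Y) (h' : Ahead g Y M) : Ahead g X M :=
  ⟨h.1.trans h'.1, h'.2.trans h.2⟩

/-- If a 2-wave is present, its right edge has nonpositive speed, so λ₂(X) ≤ 0. Together with λ₂(X)
≥ 0 this puts X on C₋ and rules out a 2-shock. -/
theorem Arranged.leftState (hg : 0 < g) (hU : 0 < UL.h) (hX : 0 < X.h) (hl : lam1 g UL < 0)
    (h : Arranged g (IsClassicalWave g) UL x L X 0) :
    X.a = UL.a ∧ lam1 g X ≤ 0 ∧ (0 ≤ lam2 g X → LeftState g UL X) := by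
  have hlt := lam1_lt_lam2 hg hX
  rcases h.classical hg hX with ⟨M, k⟩ | k | k
  · refine ⟨k.bottom_right, ?_⟩
    rcases k.right with rfl | ⟨-, r⟩
    · have l1 : lam1 g M ≤ 0 := by
        rcases k.left with rfl | ⟨-, r⟩
        · exact hl.le
        · exact (lam1_le_speedRight_kind1 hg k.wave_left).trans (EReal.coe_le_coe_iff.1 r)
      exact ⟨l1, fun h2 => ⟨hX, k.bottom_right, l1, h2, Or.inl k.onW1⟩⟩
    · have w2 := k.wave_right hX
      have r : speedRight g (kind2 M X) M X ≤ 0 := EReal.coe_le_coe_iff.1 r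
      have l2 := (lam2_le_speedRight_kind2 hg w2).trans r
      refine ⟨by linarith, fun h2 => ⟨hX, k.bottom_right, by linarith, h2, Or.inr
        ⟨le_antisymm l2 h2, Or.inl ⟨M, k.pos, k.onW1, ?_⟩⟩⟩⟩
      unfold kind2 at *
      split_ifs at * with hh
      · exact absurd (IsShock2.lam2_lt_speed hg w2) (not_lt.2 (r.trans h2))
      · exact w2
  · have l2 : lam2 g X ≤ 0 := EReal.coe_le_coe_iff.1 k.right
    exact ⟨k.bottom_right, by linarith, fun h2 => ⟨hX, k.bottom_right, by linarith, h2,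
      Or.inr ⟨le_antisymm l2 h2, Or.inr k.gap⟩⟩⟩
  · exact absurd k.dry hU.ne'

theorem W1_trichotomy (hg : 0 < g) (hU : 0 < UL.h) (hl : lam1 g UL < 0) (hX : 0 < X.h)
    (hY : 0 < Y.h) (ha : X.a = Y.a) (pX : Psi1 g X UL = 0) (pY : Psi1 g Y UL = 0)
    (lX : lam1 g X ≤ 0) (lY : lam1 g Y ≤ 0) : X = Y ∨ Ahead g X Y ∨ Ahead g Y X := by
  rcases lt_trichotomy X.h Y.h with h | h | h
  · exact Or.inr (Or.inr (W1_compare hg hU hl pY pX hX.le h lX))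
  · left
    refine State.ext h ?_ ha
    rw [Psi1_eq] at pX pY
    rw [h] at pX; linarith
  · exact Or.inr (Or.inl (W1_compare hg hU hl pX pY hY.le h lY))

theorem lam2_antitone_W1 (hg : 0 < g) (hU : 0 < UL.h) (pX : Psi1 g X UL = 0)
    (pY : Psi1 g Y UL = 0) (h : X.h ≤ Y.h) :
    lam2 g Y + (cel g Y.h - cel g X.h) ≤ lam2 g X := by
  rw [Psi1_eq] at pX pY
  rw [lam2_eq, lam2_eq]
  linarith [jump_steep hg hU h]

/-- The critical states on `C₋` are ordered by their heights. -/
theorem CMinus_compare (hg : 0 < g) (hX : 0 < X.h) (hY : 0 < Y.h) (ha : X.a = Y.a)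
    (lX : lam2 g X = 0) (lY : lam2 g Y = 0) (h : cel g Y.h ≤ cel g X.h) :
    X = Y ∨ Ahead g X Y := by
  rw [lam2_eq] at lX lY
  have c1 := cel_pos hg hX
  have c2 := cel_pos hg hY
  rcases h.eq_or_lt with h | h
  · exact Or.inl (State.ext (cel_inj hg hX.le hY.le h.symm) (by linarith) ha)
  · right
    have hh := lt_of_cel_lt hg h
    have e1 : X.u = -cel g X.h := by linarith
    have e2 : Y.u = -cel g Y.h := by linarith
    rw [Ahead, energy, energy, e1, e2, neg_sq, neg_sq, cel_sq hg hX.le, cel_sq hg hY.le]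
    constructor
    · have := mul_lt_mul'' hh h hY.le c2.le
      linarith
    · nlinarith

theorem exists_W1_CMinus (hg : 0 < g) (hU : 0 < UL.h) (hX : 0 < X.h) (pX : Psi1 g X UL = 0)
    (pY : Psi1 g Y UL = 0) (lX : 0 ≤ lam2 g X) (lY : lam2 g Y ≤ 0) (h : X.h ≤ Y.h) :
    ∃ K : State, X.h ≤ K.h ∧ K.h ≤ Y.h ∧ 0 < K.h ∧ K.a = UL.a ∧ Psi1 g K UL = 0 ∧
      lam2 g K = 0 := by
  rw [Psi1_eq] at pX pY
  rw [lam2_eq] at lX lY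
  have hc : ContinuousOn (fun h => UL.u - jump g h UL.h + cel g h) (Set.Icc X.h Y.h) :=
    ((continuous_const.sub (continuous_jump hg hU)).add (continuous_cel g)).continuousOn
  obtain ⟨k, hk, e⟩ := intermediate_value_Icc' h hc (show (0 : ℝ) ∈ _ from
    ⟨by linarith, by linarith⟩)
  exact ⟨⟨k, UL.u - jump g k UL.h, UL.a⟩, hk.1, hk.2, hX.trans_le hk.1, rfl,
    by rw [Psi1_eq]; ring, e⟩

/-- A left state ending a 2-rarefaction lies on C₋ and is compared with Y through the point K where
the 1-wave curve crosses C₋. A dry gap cannot occur: `jump_steep` would make λ₂ negative on the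
whole 1-wave curve. -/
theorem LeftState.trichotomy_mixed (hg : 0 < g) (hU : 0 < UL.h) (hl : lam1 g UL < 0)
    (hX : LeftState g UL X) (hY : LeftState g UL Y) (lX : lam2 g X = 0)
    (hN : (∃ M, 0 < M.h ∧ Psi1 g M UL = 0 ∧ IsRare2 g M X) ∨
      UL.u + 2 * cel g UL.h ≤ X.u - 2 * cel g X.h)
    (pY : Psi1 g Y UL = 0) : X = Y ∨ Ahead g X Y := by
  obtain ⟨hX0, aX, l1X, -, -⟩ := hX
  obtain ⟨hY0, aY, l1Y, l2Y, -⟩ := hY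
  rcases hN with ⟨M, hM, pM, hr⟩ | hgap
  · have e := hr.eq hg
    have l2M : lam2 g M ≤ 0 := lX ▸ hr.lam2_le hg
    have hle : Y.h ≤ M.h := by
      by_contra hlt
      rw [not_le] at hlt
      have := lam2_antitone_W1 hg hU pM pY hlt.le
      linarith [cel_lt_cel hg hM.le hlt]
    obtain ⟨K, k1, k2, k3, k4, k5, k6⟩ := exists_W1_CMinus hg hU hY0 pY pM l2Y l2M hle
    have l1K : lam1 g K ≤ 0 := by linarith [lam1_lt_lam2 hg k3]
    have A : X = K ∨ Ahead g X K := by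
      refine CMinus_compare hg hX0 k3 (aX.trans k4.symm) lX k6 ?_
      rw [Psi1_eq] at pM k5
      rw [lam2_eq] at lX k6
      have := jump_steep hg hU k2
      have := cel_le_cel hg k2
      linarith
    have B : K = Y ∨ Ahead g K Y := by
      rcases k1.eq_or_lt with h | h
      · left
        refine State.ext h.symm ?_ (k4.trans aY.symm)
        rw [Psi1_eq] at pY k5
        rw [h] at pY; linarith
      · exact Or.inr (W1_compare hg hU hl k5 pY hY0.le h l1Y)
    rcases A with rfl | A
    · exact B
    · rcases B with rfl | B
      · exact Or.inr A
      · exact Or.inr (A.trans B)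
  · exfalso
    rw [Psi1_eq] at pY
    rw [lam2_eq] at lX l2Y
    have := jump_steep hg hU hY0.le
    rw [jump_of_le hg hU.le, cel_zero] at this
    linarith [cel_pos hg hX0, cel_pos hg hY0]

/-- Discharge and energy are strictly ordered, in opposite senses, along the left states. -/
theorem LeftState.trichotomy (hg : 0 < g) (hU : 0 < UL.h) (hl : lam1 g UL < 0)
    (hX : LeftState g UL X) (hY : LeftState g UL Y) : X = Y ∨ Ahead g X Y ∨ Ahead g Y X := by
  have ha : X.a = Y.a := hX.2.1.trans hY.2.1.symm
  rcases hX.2.2.2.2 with pX | ⟨lX, nX⟩ <;> rcases hY.2.2.2.2 with pY | ⟨lY, nY⟩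
  · exact W1_trichotomy hg hU hl hX.1 hY.1 ha pX pY hX.2.2.1 hY.2.2.1
  · rcases hY.trichotomy_mixed hg hU hl hX lY nY pX with h | h
    · exact Or.inl h.symm
    · exact Or.inr (Or.inr h)
  · exact (hX.trichotomy_mixed hg hU hl hY lX nX pY).imp_right Or.inl
  · rcases le_total (cel g Y.h) (cel g X.h) with h | h
    · exact (CMinus_compare hg hX.1 hY.1 ha lX lY h).imp_right Or.inl
    · rcases CMinus_compare hg hY.1 hX.1 ha.symm lY lX h with h | h
      · exact Or.inl h.symm
      · exact Or.inr (Or.inr h)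

/-- The critical left state on `C₊` has the largest discharge. -/
theorem LeftState.critical_top (hg : 0 < g) (hU : 0 < UL.h) (hl : lam1 g UL < 0)
    (hX : LeftState g UL X) (lX : lam1 g X = 0) (hY : LeftState g UL Y) :
    X = Y ∨ Ahead g Y X := by
  have pX : Psi1 g X UL = 0 := by
    rcases hX.2.2.2.2 with h | h
    · exact h
    · linarith [lam1_lt_lam2 hg hX.1, h.1]
  have hu : 0 < X.u := by rw [lam1_eq] at lX; linarith [cel_pos hg hX.1]
  rcases hY.2.2.2.2 with pY | ⟨lY, -⟩
  · rcases lt_trichotomy X.h Y.h with h | h | h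
    · exact Or.inr (W1_compare hg hU hl pY pX hX.1.le h lX.le)
    · left
      refine State.ext h ?_ (hX.2.1.trans hY.2.1.symm)
      rw [Psi1_eq] at pX pY
      rw [h] at pX; linarith
    · exfalso
      rw [Psi1_eq] at pX pY
      have := jump_mono hg hU h.le
      have h1 := hY.2.2.1
      rw [lam1_eq] at h1 lX
      linarith [cel_lt_cel hg hY.1.le h]
  · rcases hX.trichotomy hg hU hl hY with h | h | h
    · exact Or.inl h
    · exfalso
      have h1 := h.1
      have : 0 < X.h * X.u := mul_pos hX.1 hu
      rw [lam2_eq] at lY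
      have : Y.u < 0 := by linarith [cel_pos hg hY.1]
      nlinarith [hY.1]
    · exact Or.inr h

/-! ### Right states at speed zero -/

/-- `v` consists of a classical pattern from `UL` to `X` with nonpositive speeds and a classical
pattern from `Y` to `UR` with nonnegative speeds. -/
def IsSplit (g : ℝ) (UL UR : State) (v : ℝ → State) (X Y : State) : Prop :=
  ∃ L₁ L₃, Arranged g (IsClassicalWave g) UL ⊥ L₁ X 0 ∧
    Arranged g (IsClassicalWave g) Y 0 L₃ UR ⊤ ∧
    (∀ᶠ ξ in Filter.cofinite, ξ < 0 → ValueAt g ξ (v ξ) UL L₁) ∧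
    ∀ᶠ ξ in Filter.cofinite, 0 < ξ → ValueAt g ξ (v ξ) Y L₃

theorem sameSolution_of_cofinite (h : ∀ᶠ ξ in Filter.cofinite, SameValue (v ξ) (w ξ)) :
    SameSolution v w := by
  rw [Filter.eventually_cofinite] at h
  exact MeasureTheory.measure_mono_null (fun ξ hξ => hξ) (h.measure_zero _)

theorem IsSplit.unique (hg : 0 < g) (hU : 0 < UL.h) (hR : 0 < UR.h) (hX : 0 < X.h) (hY : 0 < Y.h)
    (h : IsSplit g UL UR v X Y) (h' : IsSplit g UL UR w X Y) : SameSolution v w := by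
  obtain ⟨L₁, L₃, a1, a2, a3, a4⟩ := h
  obtain ⟨L₁', L₃', b1, b2, b3, b4⟩ := h'
  apply sameSolution_of_cofinite
  filter_upwards [a3, a4, b3, b4, a1.classical_unique hg hU hX b1, a2.classical_unique hg hY hR b2,
    Filter.eventually_cofinite_ne 0] with ξ h1 h2 h3 h4 h5 h6 h7
  rcases lt_or_gt_of_ne h7 with h8 | h8
  · exact h5 _ _ (h1 h8) (h3 h8)
  · exact h6 _ _ (h2 h8) (h4 h8)

/-- The supercritical state `Y` can be joined to `UR` by classical waves of nonnegative speed, the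
first of which is not a stationary shock. -/
def JetRight (g : ℝ) (UR Y : State) : Prop :=
  (∃ M, 0 < M.h ∧ Psi1 g M Y = 0 ∧ Phi2 g M UR = 0 ∧ (Y.h < M.h → 0 < shockSpeed Y M)) ∨
    Y.u + 2 * cel g Y.h ≤ UR.u - 2 * cel g UR.h

/-- The possible states on both sides of speed zero, for a falling bottom. -/
def SplitType (g : ℝ) (UR X Y : State) : Prop :=
  (energy g Y + g * Y.a = energy g X + g * X.a ∧ Y.u ^ 2 < g * Y.h ∧ Phi2 g Y UR = 0) ∨
    (lam1 g X = 0 ∧ Y.u ^ 2 < g * Y.h ∧ Phi2 g Y UR = 0 ∧ LossyChain g X Y) ∨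
    (lam1 g X = 0 ∧ energy g Y + g * Y.a = energy g X + g * X.a ∧ 0 < lam1 g Y ∧ JetRight g UR Y)

/-- A stationary shock at the head of the right pattern is stripped off and counted with the waves
of speed zero. Otherwise the same solution could be split in two ways. -/
theorem Through.tail (hR : 0 < UR.h) (h : Through g Y 0 L UR ⊤ M)
    (hs : IsShock1 g Y M) (h0 : shockSpeed Y M = 0) :
    ∃ L', Arranged g (IsClassicalWave g) M 0 L' UR ⊤ ∧
      ∀ᶠ ξ in Filter.cofinite, ∀ W, 0 < ξ → ValueAt g ξ W Y L → ValueAt g ξ W M L' := by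
  have w2 := h.wave_right hR
  have hv : ∀ᶠ ξ in Filter.cofinite, ∀ W, 0 < ξ → ValueAt g ξ W Y L →
      ValueAt g ξ W M [(kind2 M UR, UR)] := by
    filter_upwards [h.value] with ξ h1 W hξ hW
    have h2 := h1 W hW
    rw [hs.kind1] at h2
    exact h2.2.2 (h0.trans_lt hξ)
  rcases h.right with rfl | ⟨h1, -⟩
  · refine ⟨[], ⟨rfl, le_top⟩, ?_⟩
    filter_upwards [hv, Filter.eventually_cofinite_ne (lam2 g M)] with ξ h1 h2 W hξ hW
    have h3 := h1 W hξ hW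
    rw [kind2_self] at h3
    rcases lt_or_gt_of_ne h2 with h4 | h4
    · exact h3.1 h4
    · exact h3.2.2 h4
  · refine ⟨[(kind2 M UR, UR)], ⟨⟨w2, ?_⟩, h1, rfl, le_top⟩, hv⟩
    unfold kind2; split_ifs <;> simp

/-- If λ₂(Y) < 0, both families leave Y with negative speed, so Y would be U_R, contradicting
λ₂(U_R) > 0. In the smooth case strict subcriticality comes from the strict fall of the bottom,
which strictly raises the energy. -/
theorem IsRiemannSolution.exists_split (hg : 0 < g) (hU : 0 < UL.h) (hR : 0 < UR.h)
    (hl : lam1 g UL < 0) (hr : 0 < lam2 g UR) (ha : UR.a < UL.a)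
    (h : IsRiemannSolution g UL UR v) :
    ∃ X Y, IsSplit g UL UR v X Y ∧ LeftState g UL X ∧ 0 < Y.h ∧ Y.a = UR.a ∧
      Y.h * Y.u = X.h * X.u ∧ SplitType g UR X Y := by
  obtain ⟨L, hL, hv⟩ := h.exists_list ha.le
  rcases hL.split_at_zero hg with h1 | ⟨X, Y, L₁, L₃, hX, hY, h1, h2, h3, h4, h5⟩
  · exfalso
    rcases h1.classical hg hR with ⟨M, k⟩ | k | k
    · exact ha.ne k.bottom_right
    · exact ha.ne k.bottom_right
    · exact ha.ne k.bottom_right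
  obtain ⟨aX, lX, hLS⟩ := h1.leftState hg hU hX hl
  obtain ⟨-, -, hq, hT⟩ := h2.classify hg hX lX
  have hYa : Y.a = UR.a := by
    rcases h3.classical hg hR with ⟨M, k⟩ | k | k
    · exact k.bottom_right.symm
    · exact k.bottom_right.symm
    · exact k.bottom_right.symm
  have hsp : IsSplit g UL UR v X Y := ⟨L₁, L₃, h1, h3,
    Filter.Eventually.of_forall fun ξ hξ => h4 ξ _ hξ (hv ξ),
    Filter.Eventually.of_forall fun ξ hξ => h5 ξ _ hξ (hv ξ)⟩
  have onW2 : lam1 g Y < 0 → Phi2 g Y UR = 0 := by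
    intro hlt
    rcases h3.classical hg hR with ⟨M, k⟩ | k | k
    · rcases k.left with rfl | ⟨l, -⟩
      · exact k.onW2
      · have l : 0 ≤ speedLeft g (kind1 Y M) Y M := EReal.coe_le_coe_iff.1 l
        linarith [speedLeft_kind1_le hg k.wave_left]
    · have := k.left
      exact absurd (EReal.coe_le_coe_iff.1 k.left) (not_le.2 hlt)
    · exact absurd k.dry hY.ne'
  rcases hT with c | ⟨c1, c2, c3⟩ | ⟨c1, c2, c3⟩ | ⟨c1, c2, c3⟩
  · exfalso
    have hlt : lam1 g Y < 0 := (lam1_lt_lam2 hg hY).trans c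
    rcases h3.classical hg hR with ⟨M, k⟩ | k | k
    · obtain rfl : M = Y := by
        rcases k.left with h | ⟨l, -⟩
        · exact h
        · have l : 0 ≤ speedLeft g (kind1 Y M) Y M := EReal.coe_le_coe_iff.1 l
          linarith [speedLeft_kind1_le hg k.wave_left]
      rcases k.right with rfl | ⟨l, -⟩
      · linarith
      · have l : 0 ≤ speedLeft g (kind2 M UR) M UR := EReal.coe_le_coe_iff.1 l
        linarith [speedLeft_kind2_le hg (k.wave_right hR)]
    · exact absurd (EReal.coe_le_coe_iff.1 k.left) (not_le.2 hlt)
    · exact absurd k.dry hY.ne'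
  · refine ⟨X, Y, hsp, hLS c1, hY, hYa, hq, Or.inl ?_⟩
    have c4 : Y.u ^ 2 < g * Y.h := by
      refine lt_of_le_of_ne c2 fun hc => ?_
      have := energy_critical_le hg hY hX hq.symm hc
      rw [hYa, aX] at c3
      nlinarith
    exact ⟨c3, c4, onW2 ((strictly_subcritical_iff hg hY.le).1 c4).1⟩
  · have hLX := hLS (by linarith [lam1_lt_lam2 hg hX])
    rcases h3.classical hg hR with ⟨M, k⟩ | k | k
    · by_cases hs : Y.h < M.h ∧ shockSpeed Y M = 0
      · have w1 : IsShock1 g Y M := by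
          have := k.wave_left
          rwa [kind1, if_pos hs.1] at this
        obtain ⟨L', m1, m2⟩ := k.tail hR w1 hs.2
        have hqM := w1.discharge_sub
        rw [hs.2, zero_mul, sub_eq_zero] at hqM
        have huM := velocity_pos_of_discharge hY k.pos hqM ((lam1_pos_iff hg hY).1 c2).1
        refine ⟨X, M, ⟨L₁, L', h1, m1, hsp.choose_spec.choose_spec.2.2.1.mono ?_, ?_⟩, hLX, k.pos,
          k.bottom.trans hYa, hqM.trans hq, Or.inr (Or.inl ⟨c1, ?_, k.onW2, Y, M, w1, hs.2, c2, hq,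
            c3, k.bottom.le, by rw [k.bottom]⟩)⟩
        · exact fun ξ _ hξ => h4 ξ _ hξ (hv ξ)
        · filter_upwards [m2] with ξ n1 hξ using n1 _ hξ (h5 ξ _ hξ (hv ξ))
        · rw [strictly_subcritical_iff hg k.pos.le]
          refine ⟨hs.2 ▸ w1.lam1_lt_speed hg, ?_⟩
          rw [lam2_eq]; linarith [cel_nonneg g M.h]
      · refine ⟨X, Y, hsp, hLX, hY, hYa, hq, Or.inr (Or.inr ⟨c1, c3, c2, Or.inl
          ⟨M, k.pos, k.onW1, k.onW2, fun hlt => ?_⟩⟩)⟩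
        rcases k.left with rfl | ⟨l, -⟩
        · exact absurd hlt (lt_irrefl _)
        · have l : 0 ≤ speedLeft g (kind1 Y M) Y M := EReal.coe_le_coe_iff.1 l
          rw [kind1, if_pos hlt] at l
          exact lt_of_le_of_ne l fun h => hs ⟨hlt, h.symm⟩
    · exact ⟨X, Y, hsp, hLX, hY, hYa, hq, Or.inr (Or.inr ⟨c1, c3, c2, Or.inr k.gap⟩)⟩
    · exact absurd k.dry hY.ne'
  · exact ⟨X, Y, hsp, hLS (by linarith [lam1_lt_lam2 hg hX]), hY, hYa, hq,
      Or.inr (Or.inl ⟨c1, c2, onW2 ((strictly_subcritical_iff hg hY.le).1 c2).1, c3⟩)⟩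

/-! ### Comparison of two solutions -/

/-- On the backward 2-wave curve neither of two subcritical states is ahead of the other. -/
theorem W2_not_ahead (hg : 0 < g) (hR : 0 < UR.h) (hr : 0 < lam2 g UR) (hY : 0 < Y.h)
    (hY' : 0 < Y'.h) (sY : 0 ≤ lam2 g Y) (sY' : 0 ≤ lam2 g Y') (pY : Phi2 g Y UR = 0)
    (pY' : Phi2 g Y' UR = 0) (hq : Y.h * Y.u ≤ Y'.h * Y'.u) (he : energy g Y' < energy g Y) :
    False := by
  rcases lt_trichotomy Y.h Y'.h with h | h | h
  · linarith [(W2_compare hg hR hr pY' pY hY.le h sY).2.2]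
  · rw [Phi2_eq] at pY pY'
    rw [h] at pY
    have hu : Y.u = Y'.u := by linarith
    rw [energy, energy, h, hu] at he
    exact lt_irrefl _ he
  · linarith [(W2_compare hg hR hr pY pY' hY'.le h sY').2.1]

/-- The energy at the end of a composite wave with a stationary shock inside. -/
theorem LossyChain.energy_lt (hg : 0 < g) (h : LossyChain g X Y) :
    energy g Y + g * Y.a < energy g X + g * X.a := by
  obtain ⟨S, T, h1, h2, -, -, h5, -, h7⟩ := h
  linarith [h1.energy_lt hg h2.ge]

theorem Phi2_velocity_ge (hg : 0 < g) (hR : 0 < UR.h) (hY : 0 ≤ Y.h) (h : Phi2 g Y UR = 0) :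
    UR.u - 2 * cel g UR.h + 2 * cel g Y.h ≤ Y.u := by
  rw [Phi2_eq] at h
  have := jump_steep hg hR hY
  rw [jump_of_le hg hR.le, cel_zero] at this
  linarith

theorem energy_lt_of_height_le (hg : 0 < g) (hJ : 0 < J.h) (sY : Y.u ^ 2 ≤ g * Y.h)
    (lJ : 0 < lam1 g J) (h : Y.h ≤ J.h) : energy g Y < energy g J := by
  have := supercritical_of_lam1_pos hg hJ.le lJ
  rw [energy, energy]
  nlinarith

theorem IsRare1.velocity_ge (hg : 0 < g) {U V : State} (h : IsRare1 g U V) : U.u ≤ V.u := by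
  linarith [h.eq hg, cel_le_cel hg h.2.2.1]

theorem isRare1_of_Psi1 {U V : State} (hU : 0 < U.h) (hV : 0 ≤ V.h) (h : Psi1 g V U = 0)
    (hle : V.h ≤ U.h) : IsRare1 g U ⟨V.h, V.u, U.a⟩ := by
  rw [Psi1, if_neg (not_lt.2 hle)] at h
  exact ⟨hU, hV, hle, rfl, h⟩

theorem isShock1_of_Psi1 {U V : State} (hU : 0 < U.h) (h : Psi1 g V U = 0)
    (hlt : U.h < V.h) : IsShock1 g U ⟨V.h, V.u, U.a⟩ := by
  rw [Psi1, if_pos hlt] at h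
  exact ⟨hU, hlt, rfl, h⟩

/-- Let M be the middle state behind the jet J. If M is shallower than Y, the increase of discharge
and velocity along the 2-curve contradicts the assumed discharges or, through a small height of Y,
the energies. If M is at least as deep, then either the shock from J to M has dissipated too much
energy, or Y.h ≤ J.h and the subcritical Y has less energy than J. -/
theorem JetRight.not_smooth (hg : 0 < g) (hR : 0 < UR.h) (hr : 0 < lam2 g UR) (hJ : 0 < J.h)
    (lJ : 0 < lam1 g J) (h : JetRight g UR J) (hY : 0 < Y.h) (sY : Y.u ^ 2 < g * Y.h)
    (pY : Phi2 g Y UR = 0) (hq : Y.h * Y.u ≤ J.h * J.u) (he : energy g J ≤ energy g Y) :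
    False := by
  have lY := (strictly_subcritical_iff hg hY.le).1 sY
  have huJ := ((lam1_pos_iff hg hJ).1 lJ).1
  rcases h with ⟨M, hM, p1, p2, hs⟩ | hgap
  · have l2M : J.h < M.h → 0 < lam2 g M ∧ J.h * J.u < M.h * M.u := by
      intro hlt
      have w := isShock1_of_Psi1 hJ p1 hlt
      have hs' := hs hlt
      have hq := w.discharge_sub
      have hpos : 0 < shockSpeed J M * (M.h - J.h) := mul_pos hs' (sub_pos.2 hlt)
      have e : shockSpeed J ⟨M.h, M.u, J.a⟩ = shockSpeed J M := rfl
      rw [e] at hq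
      simp only at hq
      have hqM : J.h * J.u < M.h * M.u := by linarith
      refine ⟨?_, hqM⟩
      have : 0 < M.u := pos_of_mul_pos_right ((mul_pos hJ huJ).trans hqM) hM.le
      rw [lam2_eq]; linarith [cel_nonneg g M.h]
    rcases lt_or_ge M.h Y.h with c | c
    · rcases lt_or_ge J.h M.h with d | d
      · have := (W2_compare hg hR hr pY p2 hM.le c (l2M d).1.le).2.1
        linarith [(l2M d).2]
      · have w := (isRare1_of_Psi1 hJ hM.le p1 d).velocity_ge hg
        simp only at w
        have l2 : 0 ≤ lam2 g M := by rw [lam2_eq]; linarith [cel_nonneg g M.h]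
        have hu := (W2_compare hg hR hr pY p2 hM.le c l2).1
        have : Y.h ≤ J.h := by
          by_contra hlt
          rw [not_le] at hlt
          have := mul_lt_mul'' hlt (w.trans_lt hu) hJ.le huJ.le
          linarith
        linarith [energy_lt_of_height_le hg hJ sY.le lJ this]
    · rcases lt_or_ge J.h M.h with d | d
      · have w := (isShock1_of_Psi1 hJ p1 d).energy_lt hg (hs d).le
        have e : energy g (⟨M.h, M.u, J.a⟩ : State) = energy g M := rfl
        rw [e] at w
        rcases c.eq_or_lt with c | c
        · have : Y.u = M.u := by
            rw [Phi2_eq] at pY p2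
            rw [c] at pY; linarith
          have : energy g Y = energy g M := by rw [energy, energy, c, this]
          linarith
        · linarith [(W2_compare hg hR hr p2 pY hY.le c lY.2.le).2.2]
      · linarith [energy_lt_of_height_le hg hJ sY.le lJ (c.trans d)]
  · have := Phi2_velocity_ge hg hR hY.le pY
    have h1 := lY.1
    rw [lam1_eq] at h1
    linarith [cel_nonneg g Y.h, cel_nonneg g J.h]

/-- The shock inside the chain is no stronger than a stationary shock at the jet J itself, so Y is
at least as deep as J^#. A 1-shock of positive speed from J ends at M shallower than J^# with
discharge above that of J; since Y has the discharge of J, monotonicity along the 2-curve is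
violated. A rarefaction fails similarly. -/
theorem JetRight.not_lossy (hg : 0 < g) (hR : 0 < UR.h) (hr : 0 < lam2 g UR) (hJ : 0 < J.h)
    (lJ : 0 < lam1 g J) (h : JetRight g UR J) (hY : 0 < Y.h) (sY : Y.u ^ 2 < g * Y.h)
    (pY : Phi2 g Y UR = 0) (hqJ : J.h * J.u = X.h * X.u)
    (heJ : energy g J + g * J.a = energy g X + g * X.a) (hq : Y.h * Y.u = X.h * X.u)
    (ha : Y.a = J.a) (hlossy : LossyChain g X Y) : False := by
  have lY := (strictly_subcritical_iff hg hY.le).1 sY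
  have huJ := ((lam1_pos_iff hg hJ).1 lJ).1
  have hJlt := lt_sharpHeight hg hJ (supercritical_of_lam1_pos hg hJ.le lJ)
  obtain ⟨hp, hsp⟩ := sharpHeight_spec hg hJ huJ.ne'
  obtain ⟨S, T, s1, s2, s3, s4, s5, s6, s7⟩ := hlossy
  have hS := s1.1
  have hT := s1.1.trans s1.2.1
  have hqT := s1.discharge_sub
  rw [s2, zero_mul, sub_eq_zero] at hqT
  have fS := s1.flux_sq hg
  rw [s2, sub_zero, s4] at fS
  rw [hqJ] at hsp
  -- S and J have the same head and S stands on the higher bottom, so S has the smaller energy,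
  -- hence the larger height on the supercritical branch.
  have hSJ : J.h ≤ S.h := by
    have cJ := supercritical_of_lam1_pos hg hJ.le lJ
    have cS := supercritical_of_lam1_pos hg hS.le s3
    by_contra hlt
    rw [not_le] at hlt
    have e : energy g S ≤ energy g J := by nlinarith
    rw [energy_eq_specEnergy hS.ne', energy_eq_specEnergy hJ.ne', hqJ, s4] at e
    rw [← not_le, ← discharge_sq_le_iff hJ, hqJ, not_le] at cJ
    exact absurd (specEnergy_lt_of_supercritical hg hS cJ.le hlt) (not_lt.2 e)
  have loss : energy g S - energy g T ≤ energy g J - specEnergy g (X.h * X.u) (sharpHeight g J) := by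
    rw [energy_eq_specEnergy hS.ne', energy_eq_specEnergy hT.ne', energy_eq_specEnergy hJ.ne', hqJ,
      hqT, s4, specEnergy_sub_conjugate hS hT fS, specEnergy_sub_conjugate hJ hp hsp]
    refine conjugate_loss_le hg hJ hp s1.2.1.le ?_ hSJ
    have : g * (J.h * sharpHeight g J * (J.h + sharpHeight g J)) = g * (S.h * T.h * (S.h + T.h)) := by
      linarith
    exact mul_left_cancel₀ hg.ne' this
  have eY : specEnergy g (X.h * X.u) (sharpHeight g J) ≤ specEnergy g (X.h * X.u) Y.h := by
    rw [← hq, ← energy_eq_specEnergy hY.ne', hq]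
    rw [ha] at s7
    linarith
  have hYs : sharpHeight g J ≤ Y.h := by
    by_contra hlt
    rw [not_le] at hlt
    rw [← not_le, ← le_discharge_sq_iff hY, hq, not_le] at sY
    exact absurd (specEnergy_lt_of_subcritical hg hY sY.le hlt) (not_lt.2 eY)
  rcases h with ⟨M, hM, p1, p2, hs⟩ | hgap
  · rcases lt_or_ge J.h M.h with d | d
    · have w := isShock1_of_Psi1 hJ p1 d
      have hqM := w.discharge_sub
      have f := w.flux_sq hg
      have e : shockSpeed J ⟨M.h, M.u, J.a⟩ = shockSpeed J M := rfl
      have hlt := w.speed_lt_lam1 hg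
      rw [e] at hqM f hlt
      simp only at hqM f
      have hs' := hs d
      have hpos : 0 < shockSpeed J M * (M.h - J.h) := mul_pos hs' (sub_pos.2 d)
      have huM : 0 < M.u :=
        pos_of_mul_pos_right ((mul_pos hJ huJ).trans (by linarith : J.h * J.u < M.h * M.u)) hM.le
      have hMs : M.h < sharpHeight g J := by
        by_contra hge
        rw [not_lt] at hge
        have f2 : (J.h * (J.u - shockSpeed J M)) ^ 2 < (J.h * J.u) ^ 2 := by
          rw [lam1_eq] at hlt
          have : 0 < J.u - shockSpeed J M := by linarith [cel_nonneg g J.h]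
          have h3 : J.u - shockSpeed J M < J.u := by linarith
          gcongr
        rw [f, hqJ, hsp] at f2
        have : g * J.h * sharpHeight g J * (J.h + sharpHeight g J) / 2
          ≤ g * J.h * M.h * (J.h + M.h) / 2 := by gcongr
        linarith
      have l2 : 0 ≤ lam2 g M := by rw [lam2_eq]; linarith [cel_nonneg g M.h]
      have := (W2_compare hg hR hr pY p2 hM.le (hMs.trans_le hYs) l2).2.1
      linarith
    · have w := (isRare1_of_Psi1 hJ hM.le p1 d).velocity_ge hg
      simp only at w
      have l2 : 0 ≤ lam2 g M := by rw [lam2_eq]; linarith [cel_nonneg g M.h]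
      have hu := (W2_compare hg hR hr pY p2 hM.le (by linarith) l2).1
      have := mul_lt_mul'' (hJlt.trans_le hYs) (w.trans_lt hu) hJ.le huJ.le
      linarith
  · have := Phi2_velocity_ge hg hR hY.le pY
    have h1 := lY.1
    rw [lam1_eq] at h1
    linarith [cel_nonneg g Y.h, cel_nonneg g J.h]

/-- Jets and lossy flows both start at the left state on C₊, which has the largest discharge and the
least energy. This orders every mixed pair, and each order is refuted on the 2-curve by
`W2_not_ahead`, `JetRight.not_smooth` or `JetRight.not_lossy`. -/
theorem SplitType.eq (hg : 0 < g) (hU : 0 < UL.h) (hR : 0 < UR.h)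
    (hl : lam1 g UL < 0) (hr : 0 < lam2 g UR) (hX : LeftState g UL X) (hX' : LeftState g UL X')
    (hY : 0 < Y.h) (hY' : 0 < Y'.h) (aY : Y.a = UR.a) (aY' : Y'.a = UR.a)
    (hq : Y.h * Y.u = X.h * X.u) (hq' : Y'.h * Y'.u = X'.h * X'.u)
    (h : SplitType g UR X Y) (h' : SplitType g UR X' Y') : X = X' ∧ Y = Y' := by
  have aYY : Y.a = Y'.a := aY.trans aY'.symm
  have top : ∀ {X X'}, LeftState g UL X → LeftState g UL X' → lam1 g X = 0 →
      X'.h * X'.u ≤ X.h * X.u ∧ energy g X ≤ energy g X' ∧ X.a = X'.a := by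
    intro X X' hX hX' lX
    refine ⟨?_, ?_, hX.2.1.trans hX'.2.1.symm⟩ <;>
    rcases hX.critical_top hg hU hl lX hX' with rfl | h
    · exact le_rfl
    · exact h.1.le
    · exact le_rfl
    · exact h.2.le
  have top_eq : lam1 g X = 0 → lam1 g X' = 0 → X = X' := by
    intro l l'
    rcases hX.critical_top hg hU hl l hX' with h | h
    · exact h
    rcases hX'.critical_top hg hU hl l' hX with h1 | h1
    · exact h1.symm
    · exact absurd h.1 (not_lt.2 h1.1.le)
  have sub2 : ∀ {Y : State}, 0 < Y.h → Y.u ^ 2 < g * Y.h → 0 ≤ lam2 g Y := fun hY h =>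
    ((strictly_subcritical_iff hg hY.le).1 h).2.le
  rcases h with ⟨e, s, p⟩ | ⟨l, s, p, hc⟩ | ⟨l, e, s, j⟩ <;>
  rcases h' with ⟨e', s', p'⟩ | ⟨l', s', p', hc'⟩ | ⟨l', e', s', j'⟩
  · have aXX : X.a = X'.a := hX.2.1.trans hX'.2.1.symm
    rcases hX.trichotomy hg hU hl hX' with rfl | h | h
    · refine ⟨rfl, eq_of_side hg hY' hY (hq.trans hq'.symm) ?_ aYY (Or.inl ⟨s'.le, s.le⟩)⟩
      rw [aYY] at e; linarith
    · refine (W2_not_ahead hg hR hr hY hY' (sub2 hY s) (sub2 hY' s') p p' ?_ ?_).elim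
      · rw [hq, hq']; exact h.1.le
      · rw [aYY, aXX] at e; linarith [h.2]
    · refine (W2_not_ahead hg hR hr hY' hY (sub2 hY' s') (sub2 hY s) p' p ?_ ?_).elim
      · rw [hq, hq']; exact h.1.le
      · rw [aYY, aXX] at e; linarith [h.2]
  · obtain ⟨t1, t2, t3⟩ := top hX' hX l'
    refine (W2_not_ahead hg hR hr hY hY' (sub2 hY s) (sub2 hY' s') p p' (by linarith) ?_).elim
    have := hc'.energy_lt hg
    rw [aYY] at e
    rw [t3] at this; linarith
  · obtain ⟨t1, t2, t3⟩ := top hX' hX l'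
    refine (j'.not_smooth hg hR hr hY' s' hY s p (by linarith) ?_).elim
    rw [aYY] at e
    rw [t3] at e'; linarith
  · obtain ⟨t1, t2, t3⟩ := top hX hX' l
    refine (W2_not_ahead hg hR hr hY' hY (sub2 hY' s') (sub2 hY s) p' p (by linarith) ?_).elim
    have := hc.energy_lt hg
    rw [← aYY] at e'
    rw [t3] at this; linarith
  · obtain rfl := top_eq l l'
    refine ⟨rfl, ?_⟩
    have hh : Y.h = Y'.h := by
      rcases lt_trichotomy Y.h Y'.h with h | h | h
      · linarith [(W2_compare hg hR hr p' p hY.le h (sub2 hY s)).2.1]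
      · exact h
      · linarith [(W2_compare hg hR hr p p' hY'.le h (sub2 hY' s')).2.1]
    exact State.ext hh (velocity_eq_of_height hY' (hq.trans hq'.symm) hh) aYY
  · obtain rfl := top_eq l l'
    exact (j'.not_lossy hg hR hr hY' s' hY s p hq' e' hq aYY hc).elim
  · obtain ⟨t1, t2, t3⟩ := top hX hX' l
    refine (j.not_smooth hg hR hr hY s hY' s' p' (by linarith) ?_).elim
    rw [aYY] at e
    rw [t3] at e; linarith
  · obtain rfl := top_eq l l'
    exact (j.not_lossy hg hR hr hY s hY' s' p' hq e hq' aYY.symm hc').elim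
  · obtain rfl := top_eq l l'
    refine ⟨rfl, eq_of_side hg hY' hY (hq.trans hq'.symm) ?_ aYY
      (Or.inr ⟨supercritical_of_lam1 hg hY'.le s'.le, supercritical_of_lam1 hg hY.le s.le⟩)⟩
    rw [aYY] at e; linarith

theorem atMostOne_of_falling (hg : 0 < g) (hU : 0 < UL.h) (hR : 0 < UR.h) (hl : lam1 g UL < 0)
    (hr : 0 < lam2 g UR) (ha : UR.a ≤ UL.a) : AtMostOneSolution g UL UR := by
  intro v w hv hw
  rcases ha.eq_or_lt with ha | ha
  · obtain ⟨L, h1, h2⟩ := hv.exists_list ha.le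
    obtain ⟨L', h1', h2'⟩ := hw.exists_list ha.le
    obtain ⟨N, k1, k2⟩ := h1.exists_classical hg ha
    obtain ⟨N', k1', k2'⟩ := h1'.exists_classical hg ha
    apply sameSolution_of_cofinite
    filter_upwards [k1.classical_unique hg hU hR k1', Filter.eventually_cofinite_ne 0]
      with ξ c1 c2 using c1 _ _ (k2 ξ _ c2 (h2 ξ)) (k2' ξ _ c2 (h2' ξ))
  · obtain ⟨X, Y, a1, a2, a3, a4, a5, a6⟩ := hv.exists_split hg hU hR hl hr ha
    obtain ⟨X', Y', b1, b2, b3, b4, b5, b6⟩ := hw.exists_split hg hU hR hl hr ha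
    obtain ⟨rfl, rfl⟩ := a6.eq hg hU hR hl hr a2 b2 a3 b3 a4 b4 a5 b5 b6
    exact a1.unique hg hU hR a2.1 a3 b1

/-- Uniqueness for a left state with negative first and a right state with positive second
characteristic speed. -/
theorem atMostOneSolution (hg : 0 < g) (hU : 0 < UL.h) (hR : 0 < UR.h) (hl : lam1 g UL < 0)
    (hr : 0 < lam2 g UR) : AtMostOneSolution g UL UR := by
  rcases le_total UR.a UL.a with ha | ha
  · exact atMostOne_of_falling hg hU hR hl hr ha
  · intro v w hv hw
    exact SameSolution.mirror (atMostOne_of_falling (UL := mirror UR) (UR := mirror UL) hg hR hU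
      (by rw [lam1_mirror]; linarith) (by rw [lam2_mirror]; linarith) ha _ _ (hv.mirror hg)
      (hw.mirror hg))

end ShallowWater
end

noncomputable section

namespace ShallowWater

/-! ### Concatenation of waves -/

variable {g : ℝ} {U V W M S X Y UL UR : State} {x y b : EReal}

/-- `U` (left) and `V` (right) are joined by waves with speeds between `x` and `b` across which the
bottom level does not rise. -/
def Joined (g : ℝ) (U : State) (x : EReal) (V : State) (b : EReal) : Prop :=
  ∃ L, Arranged g (IsWaveDown g) U x L V b

theorem Joined.refl (U : State) (h : x ≤ b) : Joined g U x U b := ⟨[], rfl, h⟩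

theorem Joined.trans (h : Joined g U x V y) (h' : Joined g V y W b) : Joined g U x W b := by
  obtain ⟨L, hL⟩ := h
  induction L generalizing U x with
  | nil =>
    obtain ⟨rfl, hx⟩ := hL
    obtain ⟨L', hL'⟩ := h'
    exact ⟨L', hL'.of_le hx⟩
  | cons p L ih =>
    obtain ⟨k, Z⟩ := p
    obtain ⟨h1, h2, h3⟩ := hL
    obtain ⟨L'', h''⟩ := ih h3
    exact ⟨(k, Z) :: L'', h1, h2, h''⟩

theorem IsWave.joined {k : WaveKind} (h : IsWave g k U V) (ha : V.a ≤ U.a)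
    (hx : x ≤ (speedLeft g k U V : ℝ)) (hb : (speedRight g k U V : ℝ) ≤ b) : Joined g U x V b :=
  ⟨[(k, V)], ⟨h, ha⟩, hx, rfl, hb⟩

theorem IsContact.joined (h : IsContact g U V) (ha : V.a ≤ U.a) : Joined g U 0 V 0 :=
  IsWave.joined (k := .contact) h ha le_rfl le_rfl

theorem Joined.exists_solution (hg : 0 < g) (h : Joined g U ⊥ V ⊤) :
    ∃ v, IsRiemannSolution g U V v :=
  h.choose_spec.exists_solution hg

theorem joined_middle (hg : 0 < g) (hU : 0 < U.h) (hV : 0 < V.h) (hM : 0 < M.h) (ha : V.a = U.a)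
    (hMa : M.a = U.a) (h1 : Psi1 g M U = 0) (h2 : Phi2 g M V = 0)
    (hx : x ≤ (speedLeft g (kind1 U M) U M : ℝ)) (hb : (speedRight g (kind2 M V) M V : ℝ) ≤ b) :
    Joined g U x V b := by
  have w1 := isWave_kind1 hU hM.le hMa h1
  have w2 := isWave_kind2 hM.le hV (ha.trans hMa.symm) h2
  exact (w1.joined hMa.le hx le_rfl).trans (w2.joined (ha.trans hMa.symm).le
    (EReal.coe_le_coe_iff.2 ((speedRight_kind1_lt_velocity hg hM w1).trans
      (velocity_lt_speedLeft_kind2 hg hM w2)).le) hb)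

theorem joined_dry (hg : 0 < g) (hU : 0 < U.h) (hV : 0 < V.h) (ha : V.a = U.a)
    (hgap : U.u + 2 * cel g U.h ≤ V.u - 2 * cel g V.h) (hx : x ≤ (lam1 g U : ℝ))
    (hb : (lam2 g V : ℝ) ≤ b) : Joined g U x V b := by
  have w1 := ThroughDry.isWave1 hg hU
  have w2 : IsWave g .dry (dryRight g U) (dryLeft g V) := ⟨rfl, rfl, ha, hgap⟩
  have w3 : IsWave g .rare2 (dryLeft g V) V := isRare2_dryLeft hg hV
  have e1 : lam1 g (dryRight g U) = (dryRight g U).u := by simp [lam1_eq, dryRight]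
  have e2 : lam2 g (dryLeft g V) = (dryLeft g V).u := by simp [lam2_eq, dryLeft]
  exact ((w1.joined le_rfl hx le_rfl).trans
    (w2.joined ha.le (EReal.coe_le_coe_iff.2 e1.le) le_rfl)).trans
    (w3.joined le_rfl (EReal.coe_le_coe_iff.2 e2.ge) hb)

/-- The forward 1-wave curve of `U` meets the backward 2-wave curve of `V`. -/
theorem exists_middle (hg : 0 < g) (hU : 0 < U.h) (hV : 0 < V.h) {H : ℝ} (hH : 0 ≤ H)
    (h0 : V.u - 2 * cel g V.h < U.u + 2 * cel g U.h)
    (h1 : U.u - jump g H U.h - V.u - jump g H V.h ≤ 0) :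
    ∃ M : State, 0 < M.h ∧ M.h ≤ H ∧ M.a = U.a ∧ Psi1 g M U = 0 ∧ Phi2 g M V = 0 := by
  have hc : ContinuousOn (fun h => U.u - jump g h U.h - V.u - jump g h V.h) (Set.Icc 0 H) :=
    (((continuous_const.sub (continuous_jump hg hU)).sub continuous_const).sub
      (continuous_jump hg hV)).continuousOn
  have j1 := jump_of_le hg hU.le
  have j2 := jump_of_le hg hV.le
  rw [cel_zero] at j1 j2
  obtain ⟨m, hm, e⟩ := intermediate_value_Icc' hH hc (show (0 : ℝ) ∈ _ from
    ⟨h1, by rw [j1, j2]; linarith⟩)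
  simp only at e
  have hm0 : 0 < m := by
    refine hm.1.lt_of_ne fun h => ?_
    rw [← h, j1, j2] at e
    linarith
  refine ⟨⟨m, U.u - jump g m U.h, U.a⟩, hm0, hm.2, rfl, ?_, ?_⟩
  · rw [Psi1_eq]; ring
  · rw [Phi2_eq]; linarith

theorem joined_of_flat (hg : 0 < g) (hU : 0 < U.h) (hV : 0 < V.h) (ha : V.a = U.a) :
    Joined g U ⊥ V ⊤ := by
  rcases le_or_gt (U.u + 2 * cel g U.h) (V.u - 2 * cel g V.h) with h | h
  · exact joined_dry hg hU hV ha h bot_le le_top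
  -- At celerity y, `jump_steep` makes both jumps so large that the 1-curve has fallen below the
  -- 2-curve.
  · set y := cel g U.h + cel g V.h + |U.u| + |V.u| with hy
    have cU := cel_nonneg g U.h
    have cV := cel_nonneg g V.h
    have aU := abs_nonneg U.u
    have aV := abs_nonneg V.u
    have hy0 : 0 ≤ y := by positivity
    have hc := cel_sq_div hg hy0
    have k1 := jump_steep hg hU (le_of_cel_le hg (by positivity)
      (show cel g U.h ≤ cel g (y ^ 2 / g) by rw [hc]; linarith))
    have k2 := jump_steep hg hV (le_of_cel_le hg (by positivity)
      (show cel g V.h ≤ cel g (y ^ 2 / g) by rw [hc]; linarith))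
    rw [jump_self] at k1 k2
    rw [hc] at k1 k2
    obtain ⟨M, m1, -, m3, m4, m5⟩ := exists_middle (U := U) (V := V) hg hU hV
      (H := y ^ 2 / g) (by positivity) h (by
        have := le_abs_self U.u
        have := neg_abs_le V.u
        linarith)
    exact joined_middle hg hU hV m1 ha m3 m4 m5 bot_le le_top

/-! ### Intermediate values along curves of stationary contacts -/

/-- An intermediate value theorem on an implicit graph, without proving the root continuous. The
projections of {F ≥ 0} and {F ≤ 0} are closed and cover the interval, so they share a parameter;
uniqueness of the root identifies the two points above it. -/
theorem exists_zero_of_unique_root {a b : ℝ} {C : Set (ℝ × ℝ)} (hC : IsCompact C)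
    {F : ℝ × ℝ → ℝ} (hF : ContinuousOn F C) (ex : ∀ t ∈ Set.Icc a b, ∃ y, (t, y) ∈ C)
    (un : ∀ t y y', (t, y) ∈ C → (t, y') ∈ C → y = y')
    (pa : ∃ t ∈ Set.Icc a b, ∃ y, (t, y) ∈ C ∧ 0 ≤ F (t, y))
    (pb : ∃ t ∈ Set.Icc a b, ∃ y, (t, y) ∈ C ∧ F (t, y) ≤ 0) :
    ∃ t ∈ Set.Icc a b, ∃ y, (t, y) ∈ C ∧ F (t, y) = 0 := by
  have k1 : IsCompact (C ∩ F ⁻¹' Set.Ici 0) :=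
    hC.of_isClosed_subset (hF.preimage_isClosed_of_isClosed hC.isClosed isClosed_Ici)
      Set.inter_subset_left
  have k2 : IsCompact (C ∩ F ⁻¹' Set.Iic 0) :=
    hC.of_isClosed_subset (hF.preimage_isClosed_of_isClosed hC.isClosed isClosed_Iic)
      Set.inter_subset_left
  obtain ⟨t1, ht1, y1, c1, f1⟩ := pa
  obtain ⟨t2, ht2, y2, c2, f2⟩ := pb
  obtain ⟨t, ht, ⟨⟨t', y⟩, ⟨cy, fy⟩, rfl⟩, ⟨⟨t'', y'⟩, ⟨cy', fy'⟩, e⟩⟩ :=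
    isPreconnected_closed_iff.1 (isPreconnected_Icc (a := a) (b := b)) _ _
      (k1.image continuous_fst).isClosed (k2.image continuous_fst).isClosed
      (fun t ht => by
        obtain ⟨y, hy⟩ := ex t ht
        rcases le_total 0 (F (t, y)) with h | h
        · exact Or.inl ⟨_, ⟨hy, h⟩, rfl⟩
        · exact Or.inr ⟨_, ⟨hy, h⟩, rfl⟩)
      ⟨t1, ht1, _, ⟨c1, f1⟩, rfl⟩ ⟨t2, ht2, _, ⟨c2, f2⟩, rfl⟩
  simp only at e
  subst e
  obtain rfl := un _ _ _ cy cy'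
  exact ⟨_, ht, y, cy, le_antisymm fy' fy⟩

theorem exists_subcritical_root (hg : 0 < g) {q l E : ℝ} (hl : 0 < l)
    (hE : specEnergy g q l ≤ E) : ∃ y, l ≤ y ∧ specEnergy g q y = E := by
  have hle : l ≤ E / g := by
    rw [le_div_iff₀ hg]
    unfold specEnergy at hE
    have : 0 ≤ q ^ 2 / (2 * l ^ 2) := by positivity
    linarith
  have hc : ContinuousOn (specEnergy g q) (Set.Icc l (E / g)) := by
    unfold specEnergy
    refine ContinuousOn.add (continuousOn_const.div (by fun_prop) fun y hy => ?_) (by fun_prop)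
    have := hl.trans_le hy.1
    positivity
  obtain ⟨y, hy, e⟩ := intermediate_value_Icc hle hc (show E ∈ _ from ⟨hE, by
    unfold specEnergy
    have : 0 ≤ q ^ 2 / (2 * (E / g) ^ 2) := by positivity
    have : g * (E / g) = E := by field_simp
    linarith⟩)
  exact ⟨y, hy.1, e⟩

theorem subcritical_root_unique (hg : 0 < g) {q l y y' : ℝ} (hl : 0 < l) (hq : q ^ 2 ≤ g * l ^ 3)
    (hy : l ≤ y) (hy' : l ≤ y') (e : specEnergy g q y = specEnergy g q y') : y = y' := by
  have aux : ∀ {z}, l ≤ z → q ^ 2 ≤ g * z ^ 3 := fun {z} hz => hq.trans (by gcongr)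
  rcases lt_trichotomy y y' with h | h | h
  · exact absurd e (specEnergy_lt_of_subcritical hg (hl.trans_le hy) (aux hy) h).ne
  · exact h
  · exact absurd e (specEnergy_lt_of_subcritical hg (hl.trans_le hy') (aux hy') h).ne'

/-- A curve of subcritical states, given by discharge and energy, meets the backward 2-wave curve
of a state if it starts above and ends below it. -/
theorem exists_root_on_W2 (hg : 0 < g) {u₀ h₀ a b : ℝ} (hh : 0 < h₀) (hab : a ≤ b)
    {q E l : ℝ → ℝ} (cq : Continuous q) (cE : Continuous E) (cl : Continuous l)
    (hl : ∀ t ∈ Set.Icc a b, 0 < l t) (hq : ∀ t ∈ Set.Icc a b, q t ^ 2 ≤ g * l t ^ 3)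
    (hE : ∀ t ∈ Set.Icc a b, specEnergy g (q t) (l t) ≤ E t) {ya yb : ℝ}
    (la : l a ≤ ya) (ea : specEnergy g (q a) ya = E a) (fa : 0 ≤ q a / ya - u₀ - jump g ya h₀)
    (lb : l b ≤ yb) (eb : specEnergy g (q b) yb = E b) (fb : q b / yb - u₀ - jump g yb h₀ ≤ 0) :
    ∃ t ∈ Set.Icc a b, ∃ y, l t ≤ y ∧ specEnergy g (q t) y = E t ∧
      q t / y - u₀ - jump g y h₀ = 0 := by
  obtain ⟨B, hB⟩ := isCompact_Icc.exists_bound_of_continuousOn (s := Set.Icc a b) cE.continuousOn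
  -- The energy equation is cleared of denominators so that C is closed in the plane. It is bounded
  -- because gy ≤ E.
  set C : Set (ℝ × ℝ) := {p | p.1 ∈ Set.Icc a b ∧ l p.1 ≤ p.2 ∧
    q p.1 ^ 2 + 2 * g * p.2 ^ 3 = 2 * E p.1 * p.2 ^ 2} with hCdef
  have key : ∀ {t y : ℝ}, t ∈ Set.Icc a b → l t ≤ y →
      (specEnergy g (q t) y = E t ↔ q t ^ 2 + 2 * g * y ^ 3 = 2 * E t * y ^ 2) := by
    intro t y ht hy
    have hy0 : 0 < y := (hl t ht).trans_le hy
    unfold specEnergy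
    constructor
    · intro h
      rw [← h]; field_simp
    · intro h
      field_simp
      linarith
  have hCc : IsClosed C := by
    refine (isClosed_Icc.preimage continuous_fst).inter (IsClosed.inter ?_ ?_)
    · exact isClosed_le (cl.comp continuous_fst) continuous_snd
    · exact isClosed_eq (by fun_prop) (by fun_prop)
  have hCk : IsCompact C := by
    refine ((isCompact_Icc (a := a) (b := b)).prod (isCompact_Icc (a := (0 : ℝ))
      (b := B / g))).of_isClosed_subset hCc ?_
    rintro ⟨t, y⟩ ⟨h1, h2, h3⟩
    have hy0 : 0 < y := (hl t h1).trans_le h2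
    refine ⟨h1, hy0.le, ?_⟩
    rw [← key h1 h2] at h3
    have hb := (le_abs_self _).trans (hB t h1)
    unfold specEnergy at h3
    simp only at h3 ⊢
    rw [le_div_iff₀ hg]
    have : 0 ≤ q t ^ 2 / (2 * y ^ 2) := by positivity
    linarith
  have hF : ContinuousOn (fun p : ℝ × ℝ => q p.1 / p.2 - u₀ - jump g p.2 h₀) C := by
    have cj := (continuous_jump hg hh).comp (continuous_snd (X := ℝ) (Y := ℝ))
    refine ((ContinuousOn.div (by fun_prop) (by fun_prop) fun p hp => ?_).sub
      continuousOn_const).sub cj.continuousOn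
    exact ((hl _ hp.1).trans_le hp.2.1).ne'
  have ia : a ∈ Set.Icc a b := ⟨le_rfl, hab⟩
  have ib : b ∈ Set.Icc a b := ⟨hab, le_rfl⟩
  obtain ⟨t, ht, y, ⟨-, h2, h3⟩, f⟩ := exists_zero_of_unique_root hCk hF
    (fun t ht => by
      obtain ⟨y, h1, h2⟩ := exists_subcritical_root hg (hl t ht) (hE t ht)
      exact ⟨y, ht, h1, (key ht h1).1 h2⟩)
    (fun t y y' h h' => subcritical_root_unique hg (hl t h.1) (hq t h.1) h.2.1 h'.2.1
      (((key h.1 h.2.1).2 h.2.2).trans ((key h'.1 h'.2.1).2 h'.2.2).symm))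
    ⟨a, ia, ya, ⟨ia, la, (key ia la).1 ea⟩, fa⟩ ⟨b, ib, yb, ⟨ib, lb, (key ib lb).1 eb⟩, fb⟩
  exact ⟨t, ht, y, h2, (key ht h2).2 h3, f⟩

theorem sq_le_of_discharge {q h : ℝ} (hh : 0 < h) (hq : q ^ 2 ≤ g * h ^ 3) :
    (q / h) ^ 2 ≤ g * h := by
  rw [div_pow, div_le_iff₀ (by positivity)]
  linarith

/-- The state with given height, discharge and bottom level. -/
def ofDischarge (h q a : ℝ) : State := ⟨h, q / h, a⟩

theorem ofDischarge_discharge {h q a : ℝ} (hh : h ≠ 0) :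
    (ofDischarge h q a).h * (ofDischarge h q a).u = q := by
  simp only [ofDischarge]; field_simp

theorem energy_ofDischarge {h q a : ℝ} (hh : h ≠ 0) :
    energy g (ofDischarge h q a) = specEnergy g q h := by
  rw [energy_eq_specEnergy hh, ofDischarge_discharge hh]; rfl

/-- The subcritical stationary contact to a lower bottom level. -/
theorem exists_subcritical_contact (hg : 0 < g) (hX : 0 < X.h) (sX : X.u ^ 2 ≤ g * X.h) {a : ℝ}
    (ha : a ≤ X.a) : ∃ Y : State, X.h ≤ Y.h ∧ Y.a = a ∧ Y.u ^ 2 ≤ g * Y.h ∧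
      Y.h * Y.u = X.h * X.u ∧ energy g Y + g * Y.a = energy g X + g * X.a ∧ IsContact g X Y := by
  obtain ⟨y, h1, h2⟩ := exists_subcritical_root hg (q := X.h * X.u)
    (E := energy g X + g * (X.a - a)) hX (by
      rw [← energy_eq_specEnergy hX.ne']
      have := mul_nonneg hg.le (sub_nonneg.2 ha)
      linarith)
  have hy : 0 < y := hX.trans_le h1
  have hq := (discharge_sq_le_iff hX).2 sX
  have k1 := ofDischarge_discharge (q := X.h * X.u) (a := a) hy.ne'
  have k2 : energy g (ofDischarge y (X.h * X.u) a) + g * a = energy g X + g * X.a := by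
    rw [energy_ofDischarge hy.ne', h2]; ring
  have k3 : (ofDischarge y (X.h * X.u) a).u ^ 2 ≤ g * (ofDischarge y (X.h * X.u) a).h :=
    sq_le_of_discharge hy (hq.trans (by gcongr))
  exact ⟨ofDischarge y (X.h * X.u) a, h1, rfl, k3, k1, k2,
    isContact_of_subcritical hg hX hy k1 k2 sX k3⟩

/-- The supercritical stationary contact to a lower bottom level. -/
theorem exists_supercritical_contact (hg : 0 < g) (hX : 0 < X.h) (hu : 0 < X.u)
    (sX : g * X.h ≤ X.u ^ 2) {a : ℝ} (ha : a < X.a) : ∃ Y : State, 0 < Y.h ∧ Y.h < X.h ∧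
      Y.a = a ∧ 0 < lam1 g Y ∧ Y.h * Y.u = X.h * X.u ∧
      energy g Y + g * Y.a = energy g X + g * X.a ∧ IsContact g X Y := by
  set q := X.h * X.u with hq
  have hq0 : 0 < q := by positivity
  set E := energy g X + g * (X.a - a) with hE
  have hd : 0 < g * (X.a - a) := mul_pos hg (sub_pos.2 ha)
  have hXE : specEnergy g q X.h < E := by
    rw [hq, ← energy_eq_specEnergy hX.ne']
    linarith
  have hE0 : 0 < E := lt_trans (by unfold specEnergy; positivity) hXE
  -- The height z is small enough that the kinetic term q²/(2z²) alone reaches E.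
  obtain ⟨z, hz, hzX, hzE⟩ : ∃ z, 0 < z ∧ z ≤ X.h ∧ E ≤ specEnergy g q z := by
    have hsq : 0 < √(q ^ 2 / (2 * E)) := Real.sqrt_pos.2 (by positivity)
    refine ⟨min X.h √(q ^ 2 / (2 * E)), lt_min hX hsq, min_le_left _ _, ?_⟩
    set z := min X.h √(q ^ 2 / (2 * E)) with hz
    have hz0 : 0 < z := lt_min hX hsq
    have h1 : z ^ 2 ≤ q ^ 2 / (2 * E) := by
      calc z ^ 2 ≤ √(q ^ 2 / (2 * E)) ^ 2 := by gcongr; exact min_le_right _ _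
        _ = q ^ 2 / (2 * E) := Real.sq_sqrt (by positivity)
    rw [le_div_iff₀ (by positivity)] at h1
    have h2 : E ≤ q ^ 2 / (2 * z ^ 2) := by
      rw [le_div_iff₀ (by positivity)]; linarith
    unfold specEnergy
    have := mul_pos hg hz0
    linarith
  have hc : ContinuousOn (specEnergy g q) (Set.Icc z X.h) := by
    unfold specEnergy
    refine ContinuousOn.add (continuousOn_const.div (by fun_prop) fun y hy => ?_) (by fun_prop)
    have := hz.trans_le hy.1
    positivity
  obtain ⟨y, hy, e⟩ := intermediate_value_Icc' hzX hc (show E ∈ _ from ⟨hXE.le, hzE⟩)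
  have hy0 : 0 < y := hz.trans_le hy.1
  have hyX : y < X.h := by
    refine hy.2.lt_of_ne fun h => ?_
    rw [h] at e
    linarith
  have k1 := ofDischarge_discharge (q := q) (a := a) hy0.ne'
  have k2 : energy g (ofDischarge y q a) + g * a = energy g X + g * X.a := by
    rw [energy_ofDischarge hy0.ne', e]; ring
  have hsup := (le_discharge_sq_iff hX).2 sX
  have k3 : g * (ofDischarge y q a).h < (ofDischarge y q a).u ^ 2 := by
    change g * y < (q / y) ^ 2
    rw [div_pow, lt_div_iff₀ (by positivity)]
    calc g * y * y ^ 2 = g * y ^ 3 := by ring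
      _ < g * X.h ^ 3 := by gcongr
      _ ≤ q ^ 2 := hsup
  refine ⟨ofDischarge y q a, hy0, hyX, rfl, lam1_pos_of_supercritical hg hy0.le ?_ k3, k1, k2,
    isContact_of_supercritical hg hX hy0 k1 k2 sX k3.le⟩
  exact (div_pos hq0 hy0).le

end ShallowWater
end

noncomputable section

namespace ShallowWater

variable {g : ℝ} {U V W M K S X Y Z P Q UL UR : State} {x y b : EReal}

/-! ### Zero-speed shocks in a stationary flow -/

theorem velocity_pos_of_lam1 (hg : 0 < g) (hS : 0 < S.h) (h : 0 ≤ lam1 g S) : 0 < S.u := by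
  rw [lam1_eq] at h
  linarith [cel_pos hg hS]

/-- On C₊ the stationary shock degenerates. This lets λ₁ = 0 be treated together with λ₁ > 0. -/
theorem sharp_eq_self (hg : 0 < g) (hS : 0 < S.h) (h : lam1 g S = 0) : sharp g S = S := by
  have e : S.u ^ 2 = g * S.h := by
    rw [← cel_sq hg hS.le]
    rw [lam1_eq] at h
    rw [sub_eq_zero.1 h]
  have k : sharpHeight g S = S.h := by
    have : S.h ^ 2 + 8 * S.h * S.u ^ 2 / g = (3 * S.h) ^ 2 := by rw [e]; field_simp; ring
    rw [sharpHeight, this, Real.sqrt_sq (by positivity)]; ring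
  have := hS.ne'
  refine State.ext k ?_ rfl
  simp only [sharp, k]
  field_simp

theorem sharp_spec (hg : 0 < g) (hS : 0 < S.h) (h : 0 ≤ lam1 g S) : 0 < (sharp g S).h ∧
    (sharp g S).h * (sharp g S).u = S.h * S.u ∧ lam1 g (sharp g S) ≤ 0 ∧ 0 < (sharp g S).u ∧
    Joined g S 0 (sharp g S) 0 := by
  have hu := velocity_pos_of_lam1 hg hS h
  have hp : 0 < (sharp g S).h := (sharpHeight_spec hg hS hu.ne').1
  have hq := sharp_discharge hp.ne'
  refine ⟨hp, hq, ?_, ?_, ?_⟩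
  · rcases h.eq_or_lt with h | h
    · rw [sharp_eq_self hg hS h.symm, ← h]
    · obtain ⟨h1, h2⟩ := isShock1_sharp hg hS h
      exact h2 ▸ (h1.lam1_lt_speed hg).le
  · have : 0 < (sharp g S).h * (sharp g S).u := hq ▸ mul_pos hS hu
    exact pos_of_mul_pos_right this hp.le
  · rcases h.eq_or_lt with h | h
    · rw [sharp_eq_self hg hS h.symm]
      exact Joined.refl _ le_rfl
    · obtain ⟨h1, h2⟩ := isShock1_sharp hg hS h
      exact IsWave.joined (k := .shock1) h1 le_rfl (EReal.coe_le_coe_iff.2 h2.ge)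
        (EReal.coe_le_coe_iff.2 h2.le)

theorem subcritical_of_lam1 (hg : 0 < g) (hS : 0 < S.h) (h : lam1 g S ≤ 0) (hu : 0 ≤ S.u) :
    S.u ^ 2 ≤ g * S.h :=
  (subcritical_iff hg hS.le).2 ⟨h, by rw [lam2_eq]; linarith [cel_pos hg hS]⟩

/-- The velocity `u - √(g h)` of characteristics decreases along the forward 1-wave curve. -/
theorem lam_antitone_W1 (hg : 0 < g) (hU : 0 < U.h) (pX : Psi1 g X U = 0) (pY : Psi1 g Y U = 0)
    (h : Y.h ≤ X.h) :
    lam1 g X ≤ lam1 g Y - 3 * (cel g X.h - cel g Y.h) ∧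
      lam2 g X ≤ lam2 g Y - (cel g X.h - cel g Y.h) := by
  rw [Psi1_eq] at pX pY
  rw [lam1_eq, lam1_eq, lam2_eq, lam2_eq]
  have := jump_steep hg hU h
  constructor <;> linarith

theorem IsShock1.speed_antitone (hg : 0 < g) (hV : IsShock1 g U V) (hW : IsShock1 g U W)
    (h : V.h ≤ W.h) : shockSpeed U W ≤ shockSpeed U V := by
  rw [hV.speed_left hg, hW.speed_left hg]
  have c := cel_pos hg hV.1
  have k1 := cel_le_cel hg h
  have k2 : celMean g V.h U.h ≤ celMean g W.h U.h := by
    unfold celMean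
    have := cel_nonneg g V.h
    gcongr
  have := celMean_nonneg g V.h U.h
  have := cel_nonneg g W.h
  gcongr

/-- Ends of the part with `λ₁ ≤ 0` of the forward 1-wave curve: a state on it or at its start with
`λ₁ ≥ 0`, and the state behind the zero-speed shock. -/
theorem exists_upper_state (hg : 0 < g) (hU : 0 < UL.h) (h0 : 0 < UL.u + 2 * cel g UL.h) :
    ∃ S : State, 0 < S.h ∧ S.a = UL.a ∧ 0 ≤ lam1 g S ∧ Joined g UL ⊥ S 0 ∧
      Psi1 g (sharp g S) UL = 0 ∧ ∀ X : State, (sharp g S).h ≤ X.h → X.a = UL.a →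
        Psi1 g X UL = 0 → lam1 g X ≤ 0 → Joined g UL ⊥ X 0 := by
  rcases le_or_gt (lam1 g UL) 0 with hl | hl
  -- On C₊ the invariant u + 2√(gh) is three times the celerity.
  · set c := (UL.u + 2 * cel g UL.h) / 3 with hc
    have hc0 : 0 < c := by positivity
    set S : State := ⟨c ^ 2 / g, c, UL.a⟩ with hS
    have hcel : cel g S.h = c := cel_sq_div hg hc0.le
    have hS0 : 0 < S.h := by change 0 < c ^ 2 / g; positivity
    have hl1 : lam1 g S = 0 := by
      rw [lam1_eq, hcel]
      exact sub_self c
    have hr : IsRare1 g UL S := by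
      refine (isRare1_iff hg).2 ⟨hU, hS0.le, le_of_cel_le hg hU.le ?_, rfl, ?_⟩
      · rw [hcel, hc]
        rw [lam1_eq] at hl
        linarith
      · rw [hcel]
        change c + 2 * c = _
        rw [hc]; ring
    refine ⟨S, hS0, rfl, hl1.ge, IsWave.joined (k := .rare1) hr le_rfl bot_le
      (EReal.coe_le_coe_iff.2 hl1.le), ?_, fun X hX aX pX lX => ?_⟩
    · rw [sharp_eq_self hg hS0 hl1]
      exact hr.Psi1_eq_zero
    · rw [sharp_eq_self hg hS0 hl1] at hX
      have hX0 := hS0.trans_le hX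
      have w := isWave_kind1 hU hX0.le aX pX
      refine w.joined aX.le bot_le (EReal.coe_le_coe_iff.2 ?_)
      unfold kind1 at w ⊢
      split_ifs at w ⊢ with hh
      · exact (IsShock1.speed_lt_lam1 hg w).le.trans hl
      · exact lX
  · obtain ⟨h1, h2⟩ := isShock1_sharp hg hU hl
    refine ⟨UL, hU, rfl, hl.le, Joined.refl _ bot_le, h1.Psi1_eq_zero, fun X hX aX pX _ => ?_⟩
    have hlt := h1.2.1.trans_le hX
    have w := isWave_kind1 hU (hU.trans hlt).le aX pX
    refine w.joined aX.le bot_le (EReal.coe_le_coe_iff.2 ?_)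
    unfold kind1 at w ⊢
    rw [if_pos hlt] at w ⊢
    exact h2 ▸ h1.speed_antitone hg w hX

/-- A state with `λ₂ ≥ 0` on the backward 2-wave curve is joined to its end by positive speeds. -/
theorem joined_right (hg : 0 < g) (hR : 0 < UR.h) (hY : 0 < Y.h) (ha : UR.a = Y.a)
    (hp : Phi2 g Y UR = 0) (hl : 0 ≤ lam2 g Y)
    (hs : Y.u ≤ 0 → UR.h < Y.h → 0 ≤ shockSpeed Y UR) : Joined g Y 0 UR ⊤ := by
  have w := isWave_kind2 hY.le hR ha hp
  refine w.joined ha.le (EReal.coe_le_coe_iff.2 ?_) le_top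
  rcases le_or_gt Y.u 0 with hu | hu
  · unfold kind2 at w ⊢
    split_ifs at w ⊢ with hh
    · exact hs hu hh
    · exact hl
  · exact (hu.trans (velocity_lt_speedLeft_kind2 hg hY w)).le

/-- The part of the composite curve coming from subcritical states of the forward 1-wave curve. -/
theorem joined_smooth (hg : 0 < g) (hU : 0 < UL.h) (hR : 0 < UR.h) (ha : UR.a < UL.a)
    (hP : 0 < P.h) (pP : Psi1 g P UL = 0) (lP : lam1 g P ≤ 0) (hPK : P.h ≤ K.h)
    (aK : K.a = UL.a) (aP : P.a = UL.a)
    (pK : Psi1 g K UL = 0) (lK : 0 ≤ lam2 g K)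
    (hX : ∀ X : State, P.h ≤ X.h → X.a = UL.a → Psi1 g X UL = 0 → lam1 g X ≤ 0 →
      Joined g UL ⊥ X 0)
    {Po Ko : State} (cP : IsContact g P Po) (aPo : Po.a = UR.a) (sPo : Po.u ^ 2 ≤ g * Po.h)
    (cK : IsContact g K Ko) (aKo : Ko.a = UR.a) (sKo : Ko.u ^ 2 ≤ g * Ko.h)
    (fP : 0 ≤ Phi2 g Po UR) (fK : Phi2 g Ko UR ≤ 0)
    (hs : ∀ Y ∈ W1a g UL UR.a, Y ∈ G2minus g → Phi2 g Y UR = 0 → UR.h < Y.h →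
      0 ≤ shockSpeed Y UR) : Joined g UL ⊥ UR ⊤ := by
  have hK := hP.trans_le hPK
  set X : ℝ → State := fun h => ⟨h, UL.u - jump g h UL.h, UL.a⟩ with hXdef
  have cj := continuous_jump hg hU
  have pX : ∀ h, Psi1 g (X h) UL = 0 := fun h => by rw [Psi1_eq]; simp only [hXdef]; ring
  have eqX : ∀ Z : State, Z.a = UL.a → Psi1 g Z UL = 0 → X Z.h = Z := fun Z aZ pZ => by
    refine State.ext rfl ?_ aZ.symm
    rw [Psi1_eq] at pZ
    simp only [hXdef]
    linarith
  have sX : ∀ h ∈ Set.Icc P.h K.h, lam1 g (X h) ≤ 0 ∧ (X h).u ^ 2 ≤ g * (X h).h := by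
    intro h hh
    have h0 : 0 < h := hP.trans_le hh.1
    have k1 := (lam_antitone_W1 hg hU (pX h) pP hh.1).1
    have k2 := (lam_antitone_W1 hg hU pK (pX h) hh.2).2
    have c1 : cel g P.h ≤ cel g (X h).h := cel_le_cel hg hh.1
    have c2 : cel g (X h).h ≤ cel g K.h := cel_le_cel hg hh.2
    have l1 : lam1 g (X h) ≤ 0 := by linarith
    exact ⟨l1, (subcritical_iff hg h0.le).2 ⟨l1, by linarith⟩⟩
  have root : ∀ Z Zo : State, Z.a = UL.a → Psi1 g Z UL = 0 → IsContact g Z Zo →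
      Zo.a = UR.a → Z.u ^ 2 ≤ g * Z.h → Zo.u ^ 2 ≤ g * Zo.h →
      Z.h ≤ Zo.h ∧ specEnergy g (Z.h * (X Z.h).u) Zo.h
        = energy g (X Z.h) + g * (UL.a - UR.a) ∧ Z.h * (X Z.h).u / Zo.h = Zo.u := by
    intro Z Zo aZ pZ cZ aZo sZ sZo
    rw [eqX Z aZ pZ]
    have hd := cZ.head hg
    rw [aZo, aZ] at hd
    have hlt : g * UR.a < g * UL.a := mul_lt_mul_of_pos_left ha hg
    have h1 := cZ.1
    have h2 := cZ.2.1
    refine ⟨?_, ?_, ?_⟩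
    · exact height_le_of_energy_le hg h1 h2 cZ.2.2.1 sZo (by linarith)
    · rw [← cZ.2.2.1, ← energy_eq_specEnergy h2.ne']
      linarith
    · rw [← cZ.2.2.1]; field_simp
  have sP : P.u ^ 2 ≤ g * P.h := by
    have := (sX P.h ⟨le_rfl, hPK⟩).2
    rwa [eqX P aP pP] at this
  have sK : K.u ^ 2 ≤ g * K.h := by
    have := (sX K.h ⟨hPK, le_rfl⟩).2
    rwa [eqX K aK pK] at this
  obtain ⟨a1, a2, a3⟩ := root P Po aP pP cP aPo sP sPo
  obtain ⟨b1, b2, b3⟩ := root K Ko aK pK cK aKo sK sKo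
  -- The parameter h is the height on the 1-wave curve. A subcritical contact to a lower bottom
  -- deepens the flow, so the root is sought above h itself.
  obtain ⟨h, hh, y, hy, e, f⟩ := exists_root_on_W2 hg (u₀ := UR.u) hR hPK
    (q := fun h => h * (X h).u) (E := fun h => energy g (X h) + g * (UL.a - UR.a)) (l := id)
    (continuous_id.mul (continuous_const.sub cj))
    (by
      have : Continuous fun h => (X h).u := continuous_const.sub cj
      unfold energy
      exact (((this.pow 2).div_const 2).add (continuous_const.mul continuous_id)).add
        continuous_const)
    continuous_id (fun h hh => hP.trans_le hh.1)
    (fun h hh => (discharge_sq_le_iff (U := X h) (hP.trans_le hh.1)).2 (sX h hh).2)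
    (fun h hh => by
      have h0 : 0 < h := hP.trans_le hh.1
      have := energy_eq_specEnergy (g := g) (U := X h) h0.ne'
      have := mul_pos hg (sub_pos.2 ha)
      simp only [id]
      change specEnergy g ((X h).h * (X h).u) (X h).h ≤ _
      linarith)
    a1 a2 (by rw [a3]; exact fP) b1 b2 (by rw [b3]; exact fK)
  have h0 : 0 < h := hP.trans_le hh.1
  have hd := mul_pos hg (sub_pos.2 ha)
  have hq := (discharge_sq_le_iff (U := X h) h0).2 (sX h hh).2
  have hE : energy g (X h) = specEnergy g (h * (X h).u) h := energy_eq_specEnergy h0.ne'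
  have hlt : h < y := by
    refine lt_of_le_of_ne hy fun hc => ?_
    rw [← (show h = y from hc), hE] at e
    linarith
  have hy0 : 0 < y := h0.trans hlt
  set Y := ofDischarge y (h * (X h).u) UR.a with hYdef
  have qY : Y.h * Y.u = (X h).h * (X h).u := ofDischarge_discharge hy0.ne'
  have eY : energy g Y + g * Y.a = energy g (X h) + g * (X h).a := by
    rw [hYdef, energy_ofDischarge hy0.ne']
    rw [e]
    change _ + g * UR.a = _ + g * UL.a
    ring
  have sY : Y.u ^ 2 < g * Y.h := by
    change ((h * (X h).u) / y) ^ 2 < g * y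
    rw [div_pow, div_lt_iff₀ (by positivity)]
    calc (h * (X h).u) ^ 2 ≤ g * h ^ 3 := hq
      _ < g * y ^ 3 := by gcongr
      _ = g * y * y ^ 2 := by ring
  have cY := isContact_of_subcritical hg h0 hy0 qY eY (sX h hh).2 sY.le
  have lY := (strictly_subcritical_iff hg hy0.le).1 sY
  refine ((hX (X h) hh.1 rfl (pX h) (sX h hh).1).trans (cY.joined ha.le)).trans
    (joined_right hg hR hy0 rfl f lY.2.le fun hu hlt => ?_)
  exact hs Y ⟨rfl, X h, ⟨h0, rfl, pX h⟩, (sX h hh).1, cY⟩ ⟨⟨hy0, lY⟩, hu⟩ f hlt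

end ShallowWater
end

/-! ### Composite curves through a stationary shock, and existence over a falling bottom -/

noncomputable section

namespace ShallowWater

variable {g : ℝ} {U V W M K Ko S T To S₂ X Y Z UL UR : State} {x y b : EReal}

theorem continuousOn_sharpHeight (q a : ℝ) :
    ContinuousOn (fun h => sharpHeight g (ofDischarge h q a)) (Set.Ioi 0) := by
  have h1 : ContinuousOn (fun h : ℝ => q / h) (Set.Ioi 0) :=
    continuousOn_const.div continuousOn_id fun h hh => ne_of_gt hh
  have h2 : ContinuousOn (fun h : ℝ => √(h ^ 2 + 8 * h * (q / h) ^ 2 / g)) (Set.Ioi 0) :=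
    ((continuousOn_id.pow 2).add (((continuousOn_const.mul continuousOn_id).mul
      (h1.pow 2)).div_const g)).sqrt
  exact (continuousOn_id.neg.add h2).div_const 2

theorem discharge_sub_jump_lt (hg : 0 < g) {q h₀ h h' : ℝ} (hq : 0 ≤ q) (h0 : 0 < h₀) (hh : 0 < h)
    (hlt : h < h') : q / h' - jump g h' h₀ < q / h - jump g h h₀ := by
  have k1 := jump_strictMono hg h0 hh.le hlt
  have k2 : q / h' ≤ q / h := by gcongr
  linarith

/-- The part of the composite curve coming from a zero-speed shock between two stationary
contacts. -/
theorem joined_lossy (hg : 0 < g) (hR : 0 < UR.h) (hS : 0 < S.h) (lS : 0 ≤ lam1 g S)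
    (h₂ : 0 < S₂.h) (lt₂ : S₂.h < S.h) (a₂ : S₂.a = UR.a) (l₂ : 0 < lam1 g S₂)
    (q₂ : S₂.h * S₂.u = S.h * S.u) (e₂ : energy g S₂ + g * S₂.a = energy g S + g * S.a)
    (hTo : 0 < To.h) (aTo : To.a = UR.a)
    (qTo : To.h * To.u = S.h * S.u) (eTo : energy g To + g * To.a = energy g (sharp g S) + g * S.a)
    (fT : Phi2 g To UR ≤ 0) (fP : 0 ≤ Phi2 g (sharp g S₂) UR) : Joined g S 0 UR ⊤ := by
  have huS := velocity_pos_of_lam1 hg hS lS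
  obtain ⟨hP, qP, lP, uP, -⟩ := sharp_spec hg h₂ l₂.le
  set P := sharp g S₂ with hPdef
  have aP : P.a = UR.a := a₂
  set q := S.h * S.u with hq
  have hq0 : 0 < q := mul_pos hS huS
  have vel : ∀ V : State, 0 < V.h → V.h * V.u = q → V.u = q / V.h := fun V hV e => by
    rw [← e]; field_simp
  have vTo := vel To hTo qTo
  have vP := vel P hP (qP.trans q₂)
  have sP : P.u ^ 2 ≤ g * P.h := subcritical_of_lam1 hg hP lP uP.le
  have hqP : q ^ 2 ≤ g * P.h ^ 3 := by
    rw [← q₂, ← qP]; exact (discharge_sq_le_iff hP).2 sP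
  rw [Phi2_eq, vTo] at fT
  rw [Phi2_eq, vP] at fP
  have hle : P.h ≤ To.h := by
    by_contra hlt
    have := discharge_sub_jump_lt hg hq0.le hR hTo (not_le.1 hlt)
    linarith
  have cF : ContinuousOn (fun h => q / h - UR.u - jump g h UR.h) (Set.Icc P.h To.h) :=
    ((continuousOn_const.div continuousOn_id fun h hh => (hP.trans_le hh.1).ne').sub
      continuousOn_const).sub (continuous_jump hg hR).continuousOn
  obtain ⟨y, hy, fy⟩ := intermediate_value_Icc' hle cF (show (0 : ℝ) ∈ _ from ⟨fT, fP⟩)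
  -- The final state Y is fixed first: all flows on this arc have discharge q, so Y is where the
  -- hyperbola hu = q meets the 2-curve. The position of the shock is found afterwards.
  have hy0 : 0 < y := hP.trans_le hy.1
  set Y := ofDischarge y q UR.a with hYdef
  have qY : Y.h * Y.u = q := ofDischarge_discharge hy0.ne'
  have hqy : q ^ 2 ≤ g * y ^ 3 := hqP.trans (by gcongr; exact hy.1)
  have sY : Y.u ^ 2 ≤ g * Y.h := sq_le_of_discharge hy0 hqy
  -- Z h is the state of height h on the stationary curve through S; its bottom level is determined
  -- by the head.
  set Z : ℝ → State := fun h => ofDischarge h q (S.a + (energy g S - specEnergy g q h) / g) with hZ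
  have eqZ : ∀ V : State, 0 < V.h → V.h * V.u = q →
      energy g V + g * V.a = energy g S + g * S.a → Z V.h = V := fun V hV qV eV => by
    refine State.ext rfl (vel V hV qV).symm ?_
    rw [energy_eq_specEnergy hV.ne', qV] at eV
    change S.a + (energy g S - specEnergy g q V.h) / g = V.a
    field_simp
    linarith
  have eZ : ∀ h, 0 < h → energy g (Z h) + g * (Z h).a = energy g S + g * S.a := fun h hh => by
    rw [hZ, energy_ofDischarge hh.ne']
    change _ + g * (S.a + (energy g S - specEnergy g q h) / g) = _
    field_simp
    ring
  have qZ : ∀ h, 0 < h → (Z h).h * (Z h).u = q := fun h hh => ofDischarge_discharge hh.ne'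
  have supS := (le_discharge_sq_iff hS).2 (supercritical_of_lam1 hg hS.le lS)
  have lZ : ∀ h, 0 < h → h ≤ S.h → 0 ≤ lam1 g (Z h) := fun h h0 hh => by
    refine lam1_nonneg_of_supercritical hg h0.le (div_pos hq0 h0).le ?_
    refine (le_discharge_sq_iff (U := Z h) h0).1 ?_
    rw [qZ h h0]
    exact le_trans (by change g * h ^ 3 ≤ g * S.h ^ 3; gcongr) supS
  have cG : ContinuousOn (fun h => energy g (sharp g (Z h)) + g * (Z h).a)
      (Set.Icc S₂.h S.h) := by
    have hsub : Set.Icc S₂.h S.h ⊆ Set.Ioi 0 := fun h hh => h₂.trans_le hh.1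
    have c1 := (continuousOn_sharpHeight (g := g) q 0).mono hsub
    have c2 : ContinuousOn (fun h : ℝ => q / h) (Set.Icc S₂.h S.h) :=
      continuousOn_const.div continuousOn_id fun h hh => ne_of_gt (hsub hh)
    have c3 : ContinuousOn (fun h => specEnergy g q h) (Set.Icc S₂.h S.h) := by
      unfold specEnergy
      refine ContinuousOn.add (continuousOn_const.div (by fun_prop) fun h hh => ?_) (by fun_prop)
      have := hsub hh
      rw [Set.mem_Ioi] at this
      positivity
    refine ContinuousOn.add (ContinuousOn.add (((ContinuousOn.div (c2.mul continuousOn_id) c1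
      fun h hh => ?_).pow 2).div_const 2) (continuousOn_const.mul c1))
      (continuousOn_const.mul (continuousOn_const.add ((continuousOn_const.sub c3).div_const g)))
    exact (sharp_spec hg (S := Z h) (hsub hh) (lZ h (hsub hh) hh.2)).1.ne'
  have eS := eqZ S hS rfl rfl
  have eS₂ := eqZ S₂ h₂ q₂ e₂
  -- The head behind a shock placed at Z h runs from that of P (shock after the whole fall of the
  -- bottom) to that of To (shock before it), and the head of Y lies between them.
  obtain ⟨h, hh, e⟩ := intermediate_value_Icc lt₂.le cG
    (show energy g Y + g * Y.a ∈ _ from by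
      rw [eS, eS₂, ← eTo, aTo, a₂, ← hPdef, energy_ofDischarge hy0.ne',
        energy_eq_specEnergy hP.ne', qP, q₂, energy_eq_specEnergy hTo.ne', qTo]
      change _ + _ ≤ _ + g * UR.a ∧ _ + g * UR.a ≤ _ + _
      have k1 := specEnergy_le_of_subcritical hg hP hqP hy.1
      have k2 := specEnergy_le_of_subcritical hg hy0 hqy hy.2
      exact ⟨by linarith, by linarith⟩)
  simp only at e
  have h0 : 0 < h := h₂.trans_le hh.1
  have lZh := lZ h h0 hh.2
  have supZ := supercritical_of_lam1 hg (U := Z h) h0.le lZh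
  have cZ : IsContact g S (Z h) := isContact_of_supercritical hg hS h0 (qZ h h0) (eZ h h0)
    (supercritical_of_lam1 hg hS.le lS) supZ
  have aZ : (Z h).a ≤ S.a := by
    have k := specEnergy_le_of_supercritical hg h0 supS hh.2
    rw [← hq, ← energy_eq_specEnergy hS.ne'] at k
    change S.a + (energy g S - specEnergy g q h) / g ≤ S.a
    have : (energy g S - specEnergy g q h) / g ≤ 0 :=
      div_nonpos_of_nonpos_of_nonneg (by linarith) hg.le
    linarith
  have aZ' : UR.a ≤ (Z h).a := by
    have k := specEnergy_le_of_supercritical hg (q := q) h₂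
      (by rw [← qZ h h0]; exact (le_discharge_sq_iff (U := Z h) h0).2 supZ) hh.1
    have k2 := eZ h h0
    rw [hZ, energy_ofDischarge h0.ne'] at k2
    rw [energy_eq_specEnergy h₂.ne', q₂, a₂] at e₂
    refine le_of_mul_le_mul_left ?_ hg
    change specEnergy g q h + g * (Z h).a = _ at k2
    linarith
  obtain ⟨s1, s2, s3, s4, s5⟩ := sharp_spec hg (S := Z h) h0 lZh
  have cY : IsContact g (sharp g (Z h)) Y := isContact_of_subcritical hg s1 hy0
    (qY.trans ((s2.trans (qZ h h0)).symm)) e.symm (subcritical_of_lam1 hg s1 s3 s4.le) sY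
  have uY : 0 < Y.u := div_pos hq0 hy0
  exact (((cZ.joined aZ).trans s5).trans (cY.joined aZ')).trans
    (joined_right hg hR hy0 rfl fy ((subcritical_iff hg hy0.le).1 sY).2
      fun hu => absurd uY (not_lt.2 hu))

/-- The part of the composite curve coming from 1-waves of nonnegative speed. -/
theorem joined_jet (hg : 0 < g) (hR : 0 < UR.h) (h₂ : 0 < S₂.h) (a₂ : S₂.a = UR.a)
    (l₂ : 0 < lam1 g S₂) (fP : Phi2 g (sharp g S₂) UR ≤ 0) : Joined g S₂ 0 UR ⊤ := by
  obtain ⟨s1, s2⟩ := isShock1_sharp hg h₂ l₂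
  have s3 := s1.Psi1_eq_zero
  rcases le_or_gt (S₂.u + 2 * cel g S₂.h) (UR.u - 2 * cel g UR.h) with h | h
  · exact joined_dry hg h₂ hR a₂.symm h (EReal.coe_le_coe_iff.2 l₂.le) le_top
  · rw [Psi1_eq] at s3
    rw [Phi2_eq] at fP
    obtain ⟨M, m1, m2, m3, m4, m5⟩ := exists_middle hg h₂ hR (h₂.trans s1.2.1).le h
      (by linarith)
    refine joined_middle hg h₂ hR m1 a₂.symm m3 m4 m5 (EReal.coe_le_coe_iff.2 ?_) le_top
    have w := isWave_kind1 h₂ m1.le m3 m4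
    unfold kind1 at w ⊢
    split_ifs at w ⊢ with hh
    · exact s2 ▸ IsShock1.speed_antitone hg w s1 m2
    · exact l₂.le

/-- Solutions over a falling bottom, when the composite curve starts below the 2-wave curve. -/
theorem joined_of_lower_state (hg : 0 < g) (hU : 0 < UL.h) (hR : 0 < UR.h) (ha : UR.a < UL.a)
    (hK : 0 < K.h) (aK : K.a = UL.a) (pK : Psi1 g K UL = 0) (lK : lam2 g K = 0)
    (cK : IsContact g K Ko) (aKo : Ko.a = UR.a) (sKo : Ko.u ^ 2 ≤ g * Ko.h)
    (fK : Phi2 g Ko UR ≤ 0)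
    (hs : ∀ Y ∈ W1a g UL UR.a, Y ∈ G2minus g → Phi2 g Y UR = 0 → UR.h < Y.h →
      0 ≤ shockSpeed Y UR) : Joined g UL ⊥ UR ⊤ := by
  have h0 : 0 < UL.u + 2 * cel g UL.h := by
    have := jump_steep hg hU hK.le
    rw [jump_of_le hg hU.le, cel_zero] at this
    rw [Psi1_eq] at pK
    rw [lam2_eq] at lK
    linarith [cel_pos hg hK]
  obtain ⟨S, hS, aS, lS, jS, pT, jX⟩ := exists_upper_state hg hU h0
  obtain ⟨hT, qT, lT, uT, jT⟩ := sharp_spec hg hS lS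
  have sT := subcritical_of_lam1 hg hT lT uT.le
  obtain ⟨To, t1, t2, t3, t4, t5, t6⟩ := exists_subcritical_contact hg hT sT (a := UR.a)
    (by change UR.a ≤ S.a; rw [aS]; exact ha.le)
  have hTK : (sharp g S).h ≤ K.h := by
    by_contra hlt
    have h1 := (lam_antitone_W1 hg hU pT pK (not_le.1 hlt).le).2
    have h2 := cel_le_cel hg (not_le.1 hlt).le
    rw [lK, lam2_eq] at h1
    linarith [cel_pos hg hT]
  -- The sign at To, where the first two arcs join, and then at S₂^#, where the last two join,
  -- selects the arc that is used.
  rcases le_or_gt 0 (Phi2 g To UR) with fT | fT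
  · exact joined_smooth hg hU hR ha hT pT lT hTK aK aS pK lK.ge jX t6 t2 t3 cK aKo sKo fT fK hs
  · refine jS.trans ?_
    obtain ⟨S₂, s1, s2, s3, s4, s5, s6, s7⟩ := exists_supercritical_contact hg hS
      (velocity_pos_of_lam1 hg hS lS) (supercritical_of_lam1 hg hS.le lS) (a := UR.a)
      (by rw [aS]; exact ha)
    rcases le_total 0 (Phi2 g (sharp g S₂) UR) with fP | fP
    · exact joined_lossy hg hR hS lS s1 s2 s3 s4 s5 s6 (hT.trans_le t1) t2 (t4.trans qT) t5
        fT.le fP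
    · exact (s7.joined (by rw [s3, aS]; exact ha.le)).trans (joined_jet hg hR s1 s3 s4 fP)

end ShallowWater
end

/-! ### Contacts starting on C₋, rising bottoms, and the impossibility of the case of three
solutions -/

noncomputable section

namespace ShallowWater

variable {g : ℝ} {K Ko UL UR X Y : State}

/-- The state with `λ₂ = 0` and celerity `x`. -/
def criticalState (g x a : ℝ) : State := ⟨x ^ 2 / g, -x, a⟩

theorem joined_criticalState (hg : 0 < g) (hU : 0 < UL.h) {x : ℝ} (hx : 0 < x)
    (h : 0 ≤ -x - UL.u + jump g (x ^ 2 / g) UL.h) :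
    Joined g UL ⊥ (criticalState g x UL.a) 0 := by
  set X := criticalState g x UL.a with hX
  have hX0 : 0 < X.h := by change 0 < x ^ 2 / g; positivity
  have hc : cel g X.h = x := cel_sq_div hg hx.le
  have hl : lam2 g X = 0 := by
    rw [lam2_eq, hc]
    exact neg_add_cancel x
  rcases le_or_gt (UL.u + 2 * cel g UL.h) (X.u - 2 * cel g X.h) with h1 | h1
  · exact joined_dry hg hU hX0 rfl h1 bot_le (EReal.coe_le_coe_iff.2 hl.le)
  · obtain ⟨M, m1, m2, m3, m4, m5⟩ := exists_middle hg hU hX0 hX0.le h1 (by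
      rw [jump_self]
      change UL.u - jump g (x ^ 2 / g) UL.h - -x - 0 ≤ 0
      linarith)
    refine joined_middle hg hU hX0 m1 rfl m3 m4 m5 bot_le (EReal.coe_le_coe_iff.2 ?_)
    rw [kind2, if_neg (not_lt.2 m2)]
    exact hl.le

/-- Solutions whose stationary contact starts at a state with `λ₂ = 0` not on the forward 1-wave
curve. -/
theorem joined_of_critical (hg : 0 < g) (hU : 0 < UL.h) (hR : 0 < UR.h) (ha : UR.a < UL.a)
    (hr : 0 < lam2 g UR) {x₀ y₀ : ℝ} (hx₀ : 0 ≤ x₀)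
    (h₀ : 0 ≤ -x₀ - UL.u + jump g (x₀ ^ 2 / g) UL.h)
    (l₀ : x₀ ^ 2 / g + (UL.a - UR.a) / 2 ≤ y₀)
    (e₀ : specEnergy g (-x₀ ^ 3 / g) y₀ = 3 / 2 * x₀ ^ 2 + g * (UL.a - UR.a))
    (f₀ : 0 < -x₀ ^ 3 / g / y₀ - UR.u - jump g y₀ UR.h) : Joined g UL ⊥ UR ⊤ := by
  set d := UL.a - UR.a with hd
  have hd0 : 0 < d := sub_pos.2 ha
  -- The offset d/2 keeps the lower bound positive at t = 0, where the critical height vanishes, and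
  -- is still small enough for the specific energy at the bound not to exceed the prescribed one.
  have hl : ∀ t : ℝ, 0 < t ^ 2 / g + d / 2 := fun t => by positivity
  have hq : ∀ t : ℝ, (-t ^ 3 / g) ^ 2 ≤ g * (t ^ 2 / g + d / 2) ^ 3 := fun t => by
    calc (-t ^ 3 / g) ^ 2 = g * (t ^ 2 / g) ^ 3 := by field_simp
      _ ≤ _ := by gcongr; linarith
  have hE : ∀ t : ℝ, specEnergy g (-t ^ 3 / g) (t ^ 2 / g + d / 2) ≤ 3 / 2 * t ^ 2 + g * d := by
    intro t
    have k : (-t ^ 3 / g) ^ 2 / (2 * (t ^ 2 / g + d / 2) ^ 2) ≤ t ^ 2 / 2 := by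
      rw [div_le_iff₀ (by have := hl t; positivity)]
      calc (-t ^ 3 / g) ^ 2 = t ^ 2 / 2 * (2 * (t ^ 2 / g) ^ 2) := by field_simp
        _ ≤ _ := by gcongr; linarith
    have k2 : g * (t ^ 2 / g + d / 2) = t ^ 2 + g * d / 2 := by field_simp
    have := mul_pos hg hd0
    unfold specEnergy
    linarith
  -- At this celerity the jump is at least 2(x₀ + |u_R|), while the velocity after the contact is
  -- nonpositive, so the end of the curve lies below or on the 2-curve.
  set b := x₀ + |UR.u| + cel g UR.h with hb
  have cR := cel_nonneg g UR.h
  have hab : x₀ ≤ b := by have := abs_nonneg UR.u; linarith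
  obtain ⟨yb, b1, b2⟩ := exists_subcritical_root hg (hl b) (hE b)
  have hyb : 0 < yb := (hl b).trans_le b1
  have fb : -b ^ 3 / g / yb - UR.u - jump g yb UR.h ≤ 0 := by
    have hcb : b ≤ cel g yb := by
      rw [← cel_sq_div hg (hx₀.trans hab)]
      exact cel_le_cel hg (by linarith)
    have hRb : UR.h ≤ yb := le_of_cel_le hg hyb.le (by have := abs_nonneg UR.u; linarith)
    have k := jump_steep hg hR hRb
    rw [jump_self] at k
    have k2 : -b ^ 3 / g / yb ≤ 0 := by
      rw [neg_div, neg_div, neg_nonpos]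
      have := hx₀.trans hab
      positivity
    have := neg_abs_le UR.u
    have := abs_nonneg UR.u
    linarith
  obtain ⟨x, hx, y, hy, e, f⟩ := exists_root_on_W2 hg (u₀ := UR.u) hR hab
    (q := fun t => -t ^ 3 / g) (E := fun t => 3 / 2 * t ^ 2 + g * d)
    (l := fun t => t ^ 2 / g + d / 2) (by fun_prop) (by fun_prop) (by fun_prop)
    (fun t _ => hl t) (fun t _ => hq t) (fun t _ => hE t) l₀ e₀ f₀.le b1 b2 fb
  have hy0 : 0 < y := (hl x).trans_le hy
  -- x = 0 would force x = x₀ and y = y₀, where the function is strictly positive.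
  have hx0 : 0 < x := by
    refine (hx₀.trans hx.1).lt_of_ne fun h => ?_
    obtain rfl : x₀ = x := le_antisymm hx.1 (h ▸ hx₀)
    obtain rfl := subcritical_root_unique hg (hl x₀) (hq x₀) hy l₀ (e.trans e₀.symm)
    linarith
  have hX : 0 ≤ -x - UL.u + jump g (x ^ 2 / g) UL.h := by
    have k := jump_steep hg hU (show x₀ ^ 2 / g ≤ x ^ 2 / g by gcongr; exact hx.1)
    rw [cel_sq_div hg hx0.le, cel_sq_div hg hx₀] at k
    linarith [hx.1]
  set X := criticalState g x UL.a
  set Y := ofDischarge y (-x ^ 3 / g) UR.a with hY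
  have hX0 : 0 < X.h := by change 0 < x ^ 2 / g; positivity
  have sY : Y.u ^ 2 ≤ g * Y.h := sq_le_of_discharge hy0 ((hq x).trans (by
    have := hl x
    gcongr))
  have c : IsContact g X Y := by
    refine isContact_of_subcritical hg hX0 hy0 ?_ ?_ ?_ sY
    · rw [ofDischarge_discharge hy0.ne']
      change _ = x ^ 2 / g * -x
      ring
    · rw [hY, energy_ofDischarge hy0.ne', e]
      change 3 / 2 * x ^ 2 + g * d + g * UR.a = (-x) ^ 2 / 2 + g * (x ^ 2 / g) + g * UL.a
      rw [hd]; field_simp; ring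
    · change (-x) ^ 2 ≤ g * (x ^ 2 / g)
      rw [neg_sq]; field_simp; rfl
  refine ((joined_criticalState hg hU hx0 hX).trans (c.joined ha.le)).trans
    (joined_right hg hR hy0 rfl f ((subcritical_iff hg hy0.le).1 sY).2 fun _ hlt => ?_)
  exact (hr.trans (IsShock2.lam2_lt_speed (U := Y) hg (by
    have w := isWave_kind2 (U := Y) hy0.le hR rfl f
    rwa [kind2, if_pos hlt] at w))).le

/-- Over a falling bottom there are solutions if the water at rest behind the dry limit of the
composite curve lies above the backward 2-wave curve. -/
theorem joined_of_rest (hg : 0 < g) (hU : 0 < UL.h) (hR : 0 < UR.h) (ha : UR.a < UL.a)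
    (hr : 0 < lam2 g UR) (h : UR.u + jump g (UL.a - UR.a) UR.h < 0) : Joined g UL ⊥ UR ⊤ := by
  have hd0 : 0 < UL.a - UR.a := sub_pos.2 ha
  -- If the 1-rarefaction to the dry state ends with nonpositive velocity, the curve of critical
  -- states starts from water at rest (x₀ = 0). Otherwise it starts at the point K where the 1-wave
  -- curve meets C₋, and `joined_of_lower_state` takes over when K^o is already below or on the
  -- 2-curve.
  rcases le_or_gt (UL.u + 2 * cel g UL.h) 0 with h0 | h0
  · refine joined_of_critical hg hU hR ha hr (y₀ := UL.a - UR.a) le_rfl ?_ ?_ ?_ ?_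
    · rw [zero_pow two_ne_zero, zero_div, jump_of_le hg hU.le, cel_zero]
      linarith
    · rw [zero_pow two_ne_zero, zero_div]
      linarith
    · simp [specEnergy]
    · simp only [ne_eq, OfNat.ofNat_ne_zero, not_false_eq_true, zero_pow, neg_zero, zero_div]
      linarith
  · set y := |UL.u| + 2 * cel g UL.h with hy
    have cU := cel_nonneg g UL.h
    have aU := abs_nonneg UL.u
    have hy0 : 0 ≤ y := by positivity
    have hc := cel_sq_div hg hy0
    have cont : ContinuousOn (fun h => UL.u - jump g h UL.h + cel g h) (Set.Icc 0 (y ^ 2 / g)) :=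
      ((continuous_const.sub (continuous_jump hg hU)).add (continuous_cel g)).continuousOn
    have j0 := jump_of_le hg hU.le
    rw [cel_zero] at j0
    obtain ⟨k, hk, e⟩ := intermediate_value_Icc' (by positivity) cont (show (0 : ℝ) ∈ _ from ⟨by
      have k1 := jump_steep hg hU (le_of_cel_le hg (by positivity)
        (show cel g UL.h ≤ cel g (y ^ 2 / g) by rw [hc]; linarith))
      rw [jump_self, hc] at k1
      rw [hc]
      linarith [le_abs_self UL.u], by rw [j0, cel_zero]; linarith⟩)
    simp only at e
    have hk0 : 0 < k := by
      refine hk.1.lt_of_ne fun h => ?_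
      rw [← h, j0, cel_zero] at e
      linarith
    set x := cel g k with hx
    have hx0 : 0 < x := cel_pos hg hk0
    have hxk : x ^ 2 = g * k := cel_sq hg hk0.le
    set K : State := ⟨k, -x, UL.a⟩ with hKdef
    have pK : Psi1 g K UL = 0 := by
      rw [Psi1_eq]
      change -x - UL.u + jump g k UL.h = 0
      linarith
    obtain ⟨Ko, k1, k2, k3, k4, k5, k6⟩ := exists_subcritical_contact hg (X := K) hk0
      (by change (-x) ^ 2 ≤ g * k; rw [neg_sq, hxk]) (a := UR.a) ha.le
    rcases le_or_gt (Phi2 g Ko UR) 0 with f | f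
    · refine joined_of_lower_state (K := K) hg hU hR ha hk0 rfl pK ?_ k6 k2 k3 f ?_
      · change -x + x = 0
        ring
      · intro Y hY hY' fY hlt
        refine (hr.trans (IsShock2.lam2_lt_speed (U := Y) hg ?_)).le
        have w := isWave_kind2 (U := Y) hY'.1.1.le hR hY.1.symm fY
        rwa [kind2, if_pos hlt] at w
    · have hKo : 0 < Ko.h := hk0.trans_le k1
      have q : -x ^ 3 / g = Ko.h * Ko.u := by
        rw [k4]
        change _ = k * -x
        rw [pow_succ, hxk]; field_simp
      have en : energy g Ko = 3 / 2 * x ^ 2 + g * (UL.a - UR.a) := by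
        rw [k2] at k5
        change _ = (-x) ^ 2 / 2 + g * k + g * UL.a at k5
        linarith
      have xk : x ^ 2 / g = k := by rw [hxk]; field_simp
      refine joined_of_critical hg hU hR ha hr (y₀ := Ko.h) hx0.le ?_ ?_ ?_ ?_
      · rw [xk]
        linarith
      · rw [xk]
        by_contra hlt
        have k7 := specEnergy_lt_of_subcritical hg hKo ((discharge_sq_le_iff hKo).2 k3)
          (not_le.1 hlt)
        rw [← energy_eq_specEnergy hKo.ne', en, ← q] at k7
        have k8 : (-x ^ 3 / g) ^ 2 / (2 * (k + (UL.a - UR.a) / 2) ^ 2) ≤ x ^ 2 / 2 := by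
          rw [div_le_iff₀ (by positivity)]
          calc (-x ^ 3 / g) ^ 2 = x ^ 2 / 2 * (2 * (x ^ 2 / g) ^ 2) := by field_simp
            _ ≤ _ := by rw [xk]; gcongr; linarith
        unfold specEnergy at k7
        have := mul_pos hg hd0
        linarith
      · rw [q, ← energy_eq_specEnergy hKo.ne', en]
      · rw [q, mul_div_cancel_left₀ _ hKo.ne']
        exact f

/-- Water at rest over the higher bottom level lies below the forward 1-wave curve. -/
theorem rest_lt_of_lower_state (hg : 0 < g) (hU : 0 < UL.h) (ha : UL.a < UR.a)
    (h : IsLowerState g UL UR.a K Ko) : jump g (UR.a - UL.a) UL.h < UL.u := by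
  obtain ⟨⟨hK, aK, pK⟩, sK, c, aKo, -, -, hC⟩ := h
  obtain ⟨hKo, uKo⟩ := hC ha
  have sub := (subcritical_iff hg hK.le).2 sK.2
  have head := c.head hg
  have hq := c.2.2.1
  set x := cel g Ko.h with hx
  change Ko.u = -x at uKo
  have hx0 : 0 < x := cel_pos hg hKo
  have hx2 : x ^ 2 = g * Ko.h := cel_sq hg hKo.le
  set c := cel g K.h with hc
  have hc0 : 0 < c := cel_pos hg hK
  have hc2 : c ^ 2 = g * K.h := cel_sq hg hK.le
  obtain ⟨v, hv⟩ : ∃ v, K.u = -v := ⟨-K.u, by ring⟩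
  rw [hv, neg_sq, ← hc2] at sub
  have cube : x ^ 3 = c ^ 2 * v := by
    rw [uKo, hv] at hq
    rw [pow_succ, hx2, hc2]
    linear_combination -g * hq
  have hv0 : 0 < v := by
    have : 0 < c ^ 2 * v := cube ▸ pow_pos hx0 3
    exact pos_of_mul_pos_right this (by positivity)
  have hvc : v ≤ c := le_of_pow_le_pow_left₀ two_ne_zero hc0.le sub
  have hxc : x ≤ c := by
    refine le_of_pow_le_pow_left₀ three_ne_zero hc0.le ?_
    calc x ^ 3 = c ^ 2 * v := cube
      _ ≤ c ^ 2 * c := by gcongr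
      _ = c ^ 3 := by ring
  have hcv : c * v ≤ x ^ 2 := by
    refine le_of_mul_le_mul_left ?_ hc0
    calc c * (c * v) = x ^ 2 * x := by rw [← pow_succ, cube]; ring
      _ ≤ x ^ 2 * c := by gcongr
      _ = c * x ^ 2 := by ring
  set z := cel g (UR.a - UL.a) with hz
  have hz2 : z ^ 2 = g * (UR.a - UL.a) := cel_sq hg (sub_pos.2 ha).le
  -- By conservation of head z² = c² + v²/2 - 3x²/2, so the claim is cv + v²/4 < 3x²/2; it follows
  -- from v² ≤ cv ≤ x². The steepness of the jump then converts this gap in celerity into the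
  -- required gap in velocity.
  have hzc : z < c - v / 2 := by
    refine lt_of_pow_lt_pow_left₀ 2 (by linarith) ?_
    unfold energy at head
    rw [aKo, aK, uKo, hv, neg_sq, neg_sq, ← hx2, ← hc2] at head
    have : v * v ≤ c * v := by gcongr
    have := pow_pos hx0 2
    nlinarith
  have hdK : UR.a - UL.a ≤ K.h := le_of_cel_le hg hK.le (by linarith)
  have k := jump_steep hg hU hdK
  rw [Psi1_eq] at pK
  linarith

/-- Over a rising bottom the problem is reflected: `rest_lt_of_lower_state` becomes the condition of
`joined_of_rest`, and λ₁(U_L) < 0 becomes its condition on λ₂. -/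
theorem exists_solution_of_lower_state (hg : 0 < g) (hU : 0 < UL.h) (hR : 0 < UR.h)
    (hl : lam1 g UL < 0) (h : IsLowerState g UL UR.a K Ko) (hKo : Phi2 g Ko UR ≤ 0)
    (hs : ∀ M ∈ W1a g UL UR.a, M ∈ G2minus g → Phi2 g M UR = 0 → UR.h < M.h →
      0 ≤ shockSpeed M UR) : ∃ v, IsRiemannSolution g UL UR v := by
  rcases lt_trichotomy UL.a UR.a with ha | ha | ha
  · have hrest := rest_lt_of_lower_state hg hU ha h
    obtain ⟨v, hv⟩ := (joined_of_rest (UL := mirror UR) (UR := mirror UL) hg hR hU ha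
      (by rw [lam2_mirror]; linarith) (by
        change -UL.u + jump g (UR.a - UL.a) UL.h < 0
        linarith)).exists_solution hg
    have := hv.mirror hg
    rw [mirror_mirror, mirror_mirror] at this
    exact ⟨_, this⟩
  · exact (joined_of_flat hg hU hR ha.symm).exists_solution hg
  · obtain ⟨⟨hK, aK, pK⟩, -, c, aKo, sKo, hC, -⟩ := h
    obtain ⟨-, uK⟩ := hC ha.le
    refine (joined_of_lower_state hg hU hR ha hK aK pK ?_ c aKo
      ((subcritical_iff hg sKo.1.le).2 sKo.2) hKo hs).exists_solution hg
    rw [lam2, uK]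
    exact neg_add_cancel _

/-- The stationary subcritical flow over the lower bottom is deeper than the one behind a zero-speed
shock, since the shock dissipates energy. -/
theorem AreUpperStates.sharp_lt (hg : 0 < g) {a : ℝ} {U₁ U₁o U₂ : State}
    (h : AreUpperStates g UL a U₁ U₁o U₂) : (sharp g U₂).h < U₁o.h := by
  obtain ⟨-, -, c₁, a₁, s₁, c₂, a₂, s₂⟩ := h
  obtain ⟨hp, hq, hl, hu, -⟩ := sharp_spec hg s₂.1 s₂.2.le
  have q : U₁o.h * U₁o.u = (sharp g U₂).h * (sharp g U₂).u :=
    c₁.2.2.1.trans (c₂.2.2.1.symm.trans hq.symm)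
  have e : energy g U₁o = energy g U₂ := by
    have k1 := c₁.head hg
    have k2 := c₂.head hg
    rw [a₁] at k1
    rw [a₂] at k2
    linarith
  have hlt := energy_sharp_lt hg s₂.1 s₂.2
  have sub := (strictly_subcritical_iff hg s₁.1.le).2 s₁.2
  by_contra hle
  have k := specEnergy_le_of_subcritical hg s₁.1 ((discharge_sq_le_iff s₁.1).2 sub.le)
    (not_lt.1 hle)
  rw [← energy_eq_specEnergy s₁.1.ne', q, ← energy_eq_specEnergy hp.ne'] at k
  linarith

end ShallowWater
end

open ShallowWater in
theorem theorem3p2 (g : ℝ) (hg : 0 < g) (UL UR : State) (hL : UL ∈ G2 g) (hR : 0 < UR.h) :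
    -- existence
    (∀ K Ko : State, IsLowerState g UL UR.a K Ko → Phi2 g Ko UR ≤ 0 →
      (∀ M ∈ W1a g UL UR.a, M ∈ G2minus g → Phi2 g M UR = 0 → UR.h < M.h →
        0 ≤ shockSpeed M UR) →
      ∃ v : ℝ → State, IsRiemannSolution g UL UR v) ∧
    -- uniqueness
    (UR ∈ G1 g ∪ CPlus g ∪ G2 g →
      (UL.a ≤ UR.a → AtMostOneSolution g UL UR) ∧
      (UR.a < UL.a → ∀ U₁ U₁o U₂ : State, AreUpperStates g UL UR.a U₁ U₁o U₂ →
        ((sharp g U₂).h ≤ U₁o.h ∨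
          (U₁o.h < (sharp g U₂).h ∧ 0 < Phi2 g U₁o UR * Phi2 g (sharp g U₂) UR)) →
        AtMostOneSolution g UL UR)) ∧
    -- three solutions
    (UR.a < UL.a → ∀ U₁ U₁o U₂ : State, AreUpperStates g UL UR.a U₁ U₁o U₂ →
      U₁o.h < (sharp g U₂).h → 0 < Phi2 g U₁o UR → Phi2 g (sharp g U₂) UR < 0 →
      ThreeSolutions g UL UR) := by
  -- The clause on three solutions is closed by contradiction, since `AreUpperStates.sharp_lt`
  -- refutes its assumption on the two heights.
  refine ⟨fun K Ko h hKo hs => exists_solution_of_lower_state hg hL.1 hR hL.2.1 h hKo hs,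
    fun hUR => ?_, fun _ U₁ U₁o U₂ h hlt => absurd hlt (h.sharp_lt hg).not_gt⟩
  have hr : 0 < lam2 g UR := by
    rcases hUR with (h | h) | h
    · exact h.2.trans (lam1_lt_lam2 hg hR)
    · have := cel_pos hg hR
      rw [lam2_eq, show UR.u = cel g UR.h from h.2]
      linarith
    · exact h.2.2
  have hu := atMostOneSolution hg hL.1 hR hL.2.1 hr
  exact ⟨fun _ => hu, fun _ _ _ _ _ _ => hu⟩
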